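/- Let $r\ge 5$, $m\ge 3$ and $h\ge 1$ be integers, and let $F(x,y)\in\mathbb{Z}[x,y]$ be a diagonalizable form of degree $r$, i.e. a binary form that can be written as $$F(x,y)=(\alpha x+\beta y)^r-(\gamma x+\delta y)^r,\qquad \alpha,\beta,\gamma,\delta\in\mathbb{C},\quad \alpha\delta-\beta\gamma\neq 0 .$$ Let $\Delta$ be the discriminant of $F$, and put $$\Delta'=\frac{|\Delta|}{2^{r^2-r}\,r^r\,h^{2r-2}},\qquad \alpha_1=\frac{7r^2(r-1)}{(r-1)^{m-1}-2r-1},\qquad \alpha_2=\frac{(r-1)(r^2+r+2)}{(r-1)^{m-1}-2r-1}.$$ Let $N_F(h)$ be the number of pairs $(x,y)\in\mathbb{Z}^2$ with $\gcd(x,y)=1$ and $0<|F(x,y)|\le h$, where $(x,y)$ and $(-x,-y)$ are counted as one. Assume that $\Delta'\ge r^{\alpha_1}h^{\alpha_2}$. Then there are a representation of $F$ as above, a constant $\chi\in\mathbb{C}$ and integers $A,B,C$ such that $$(\alpha x+\beta y)(\gamma x+\delta y)=\chi\,(Ax^2+Bxy+Cy^2),$$ and for every such choice, with $D=B^2-4AC$,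 $$N_F(h)\le\begin{cases} rm & \text{if } D<0,\\ 2m & \text{if } D>0,\ r \text{ is even and } F \text{ is indefinite},\\ m & \text{if } D>0,\ r \text{ is odd and } F \text{ is indefinite.}\end{cases}$$ Moreover $N_F(h)\le 1$ if $F$ is definite. Here $F$ is definite if it is positive on all of $\mathbb{R}^2\setminus\{(0,0)\}$ or negative on all of it, and indefinite if it takes both positive and negative values on $\mathbb{R}^2$. -/

import Mathlib

open MvPolynomial

/-- The linear form `a x + b y` over `ℂ`. -/
noncomputable def linForm (a b : ℂ) : MvPolynomial (Fin 2) ℂ :=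
  C a * X 0 + C b * X 1

/-- The representation `F = (α x + β y)^r - (γ x + δ y)^r` with `α δ - β γ ≠ 0`. -/
def IsDiagonalization (F : MvPolynomial (Fin 2) ℤ) (r : ℕ) (α β γ δ : ℂ) : Prop :=
  α * δ - β * γ ≠ 0 ∧
    MvPolynomial.map (Int.castRingHom ℂ) F = linForm α β ^ r - linForm γ δ ^ r

/-- `F ∈ ℤ[x, y]` is a diagonalizable binary form of degree `r`. -/
def IsDiagonalizable (F : MvPolynomial (Fin 2) ℤ) (r : ℕ) : Prop :=
  F.IsHomogeneous r ∧ ∃ α β γ δ : ℂ, IsDiagonalization F r α β γ δ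

/-- `D = B² - 4AC` for some integers `A, B, C` such that
`(α x + β y)(γ x + δ y) = χ (A x² + B x y + C y²)` for a diagonalization of `F`
and a constant `χ`. -/
def IsQuadDisc (F : MvPolynomial (Fin 2) ℤ) (r : ℕ) (D : ℤ) : Prop :=
  ∃ α β γ δ χ : ℂ, ∃ a b c : ℤ, IsDiagonalization F r α β γ δ ∧
    linForm α β * linForm γ δ =
      C χ * (C (a : ℂ) * X 0 ^ 2 + C (b : ℂ) * (X 0 * X 1) + C (c : ℂ) * X 1 ^ 2) ∧
    D = b ^ 2 - 4 * a * c

/-- The one-variable polynomial `G(t, 1)`. -/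
noncomputable def dehomog (G : MvPolynomial (Fin 2) ℤ) : Polynomial ℤ :=
  MvPolynomial.aeval ![Polynomial.X, 1] G

/-- The discriminant of a binary form `F` of degree `r ≥ 2`:
`(-1)^(r(r-1)/2) Res(F_x, F_y) / r^(r-2)`, where `Res` is the resultant of two binary forms
of degree `r - 1` (so the formal degrees in the Sylvester matrix are both `r - 1`). It equals
`∏_{i<j} (a_i b_j - a_j b_i)²` when `F = ∏_i (a_i x + b_i y)` over `ℂ`. -/
noncomputable def formDiscr (F : MvPolynomial (Fin 2) ℤ) (r : ℕ) : ℚ :=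
  (-1) ^ (r * (r - 1) / 2) *
    (Polynomial.resultant (dehomog (pderiv 0 F)) (dehomog (pderiv 1 F)) (r - 1) (r - 1) : ℤ) /
      (r : ℚ) ^ (r - 2)

/-- `Δ' = |Δ| / (2^(r² - r) r^r h^(2r - 2))`. -/
noncomputable def discrPrime (F : MvPolynomial (Fin 2) ℤ) (r : ℕ) (h : ℤ) : ℝ :=
  |(formDiscr F r : ℝ)| / (2 ^ (r ^ 2 - r) * (r : ℝ) ^ r * (h : ℝ) ^ (2 * r - 2))

/-- The value `F(x, y)` at a real point. -/
noncomputable def realVal (F : MvPolynomial (Fin 2) ℤ) (x y : ℝ) : ℝ :=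
  MvPolynomial.aeval ![x, y] F

/-- `F` has constant strict sign on `ℝ² \ {0}`. -/
def IsDefinite (F : MvPolynomial (Fin 2) ℤ) : Prop :=
  (∀ x y : ℝ, (x, y) ≠ (0, 0) → 0 < realVal F x y) ∨
    (∀ x y : ℝ, (x, y) ≠ (0, 0) → realVal F x y < 0)

/-- `F` takes both positive and negative values on `ℝ²`. -/
def IsIndefinite (F : MvPolynomial (Fin 2) ℤ) : Prop :=
  (∃ x y : ℝ, 0 < realVal F x y) ∧ (∃ x y : ℝ, realVal F x y < 0)

/-- The primitive solutions `(x, y) ∈ ℤ²` of `0 < |F(x, y)| ≤ h`. -/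
def primitiveSolutions (F : MvPolynomial (Fin 2) ℤ) (h : ℤ) : Set (ℤ × ℤ) :=
  {p | Int.gcd p.1 p.2 = 1 ∧
    0 < |MvPolynomial.eval ![p.1, p.2] F| ∧ |MvPolynomial.eval ![p.1, p.2] F| ≤ h}

/-- `N_F(h)`: the number of primitive solutions of `0 < |F(x, y)| ≤ h`, where `(x, y)` and
`(-x, -y)` are counted as one solution. -/
noncomputable def numSolutions (F : MvPolynomial (Fin 2) ℤ) (h : ℤ) : ℕ∞ :=
  ((fun p : ℤ × ℤ => s(p, -p)) '' primitiveSolutions F h).encard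

/-- The exponent `α₁ = 7 r² (r - 1) / ((r - 1)^(m - 1) - 2 r - 1)`. -/
noncomputable def alphaOne (r m : ℕ) : ℝ :=
  7 * (r : ℝ) ^ 2 * ((r : ℝ) - 1) / (((r : ℝ) - 1) ^ (m - 1) - 2 * (r : ℝ) - 1)

/-- The exponent `α₂ = (r - 1) (r² + r + 2) / ((r - 1)^(m - 1) - 2 r - 1)`. -/
noncomputable def alphaTwo (r m : ℕ) : ℝ :=
  ((r : ℝ) - 1) * ((r : ℝ) ^ 2 + (r : ℝ) + 2) / (((r : ℝ) - 1) ^ (m - 1) - 2 * (r : ℝ) - 1)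

/-! Write `ξ = αx + βy`, `η = γx + δy`, `j = αδ - βγ`, and let the size of a point be `max |ξ| |η|`.
The proof is the Thue–Siegel method with Padé approximants to the `r`-th root. At a solution of size
at least `√(|j|/2)` the quotient `η/ξ` is close to an `r`-th root of unity `ω`, which sorts these
large solutions into classes. Two independent solutions in one class, of sizes `Z ≤ Z'`, satisfy the
gap principle `(|j|/2) Z^(r-1) ≤ h Z'` (`padeClose_gap`), so sizes within a class grow doubly
exponentially (`exists_large_of_card`).

Evaluating the Padé approximant of degree `n` at the first solution and pairing it with the second
gives a number `Λ_n` (`padeLambda`). It is small by the remainder estimate (`norm_padeLambda_le`).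
On the other hand `(r³ s)^n Λ_n`, with `s² = disc`, is `j` times a rational integer
(`exists_int_padeLambda`), because `r s ξ^r` and `r s η^r` are conjugate in a quadratic order. Two
consecutive `Λ_n` cannot both vanish (`padeForm_cross_ne_zero`), so a pair whose smaller member is
already large is impossible (`padeClose_pair_false`).

Since `Δ' = ((|j|/2)^r / h²)^(r-1)`, the hypothesis on `Δ'` makes the second largest of `m`
solutions in a class large in this sense; the dependence on `s` is removed by `norm_s_pow_le`. Hence
each class has at most `m - 1` large solutions, and outside all classes there is at most one
solution (`norm_det_le_two_mul`).

It remains to count classes. If `D < 0` then `|ξ| = |η|` and there are `r` of them. If `D > 0` all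
quotients are real multiples of one another, which leaves `ω` and `-ω`, the latter only for even
`r`. If `F` is definite there is no large solution. The integral quadratic form itself comes from a
linear recurrence between the coefficients of `F` (`exists_isQuadDisc`). -/

/-! ### Padé coefficients: denominators and size. -/

-- Prime by prime: if `p ∣ r`, Legendre's formula bounds the exponent of `p` in `k!` by `k`, and `r
-- ^ k` suffices. Otherwise `r` has an inverse `t` modulo `p ^ e`, and multiplication by `t ^ k`
-- turns the progression into `k` consecutive integers.
open Finset in
theorem factorial_dvd_pow_mul_prod_arith (r q k : ℕ) :
    k.factorial ∣ r ^ k * ∏ i ∈ range k, (q + i * r) := by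
  rw [Nat.dvd_iff_prime_pow_dvd_dvd]
  intro p e hp hpe
  by_cases hpr : p ∣ r
  · have : Fact p.Prime := ⟨hp⟩
    have h1 : e ≤ padicValNat p k.factorial :=
      (padicValNat_dvd_iff_le (Nat.factorial_ne_zero k)).1 hpe
    have h2 : (p - 1) * padicValNat p k.factorial = k - (p.digits k).sum :=
      sub_one_mul_padicValNat_factorial k
    have h3 : 1 ≤ p - 1 := by have := hp.two_le; omega
    have h4 : e ≤ k := by nlinarith [Nat.sub_le k (p.digits k).sum]
    exact Dvd.dvd.mul_right ((pow_dvd_pow p h4).trans (pow_dvd_pow_of_dvd hpr k)) _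
  · refine Dvd.dvd.mul_left ?_ _
    rcases Nat.eq_zero_or_pos e with rfl | he
    · simp
    have hco : Nat.Coprime r (p ^ e) :=
      (Nat.Coprime.pow_right e ((hp.coprime_iff_not_dvd.2 hpr).symm))
    obtain ⟨t, ht⟩ := Nat.exists_mul_mod_eq_one_of_coprime hco (Nat.one_lt_pow he.ne' hp.one_lt)
    have ht' : r * t ≡ 1 [MOD p ^ e] := by
      rw [Nat.ModEq, ht.2, Nat.mod_eq_of_lt (Nat.one_lt_pow he.ne' hp.one_lt)]
    have h5 : (q * t).ascFactorial k ≡ t ^ k * ∏ i ∈ range k, (q + i * r) [MOD p ^ e] := by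
      rw [Nat.ascFactorial_eq_prod_range, ← Finset.card_range k, ← Finset.prod_const,
        Finset.card_range, ← Finset.prod_mul_distrib]
      refine Nat.ModEq.prod fun i _ => ?_
      calc q * t + i = q * t + i * 1 := by ring
        _ ≡ q * t + i * (r * t) [MOD p ^ e] := (Nat.ModEq.refl _).add ((Nat.ModEq.refl _).mul ht'.symm)
        _ = t * (q + i * r) := by ring
    have h6 : p ^ e ∣ t ^ k * ∏ i ∈ range k, (q + i * r) :=
      (h5.dvd_iff dvd_rfl).1 (hpe.trans (Nat.factorial_dvd_ascFactorial _ _))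
    have h7 : Nat.Coprime (p ^ e) (t ^ k) := by
      refine Nat.Coprime.pow_right k ?_
      refine Nat.Coprime.symm (Nat.coprime_of_mul_modEq_one r ?_)
      rw [mul_comm]; exact ht'
    exact h7.dvd_of_dvd_mul_left h6

/-- The coefficients `binom(n - 1/r, j) * binom(n + 1/r, n - j)` of the diagonal Padé approximants
of the `r`-th root. -/
noncomputable def padeCoeff (r n j : ℕ) : ℝ :=
  (∏ i ∈ Finset.range j, (((n - j + i + 1 : ℕ) : ℝ) - 1 / r)) / j.factorial *
    ((∏ i ∈ Finset.range (n - j), (((j + i + 1 : ℕ) : ℝ) + 1 / r)) / (n - j).factorial)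

theorem padeCoeff_nonneg {r : ℕ} (hr : 1 ≤ r) (n j : ℕ) : 0 ≤ padeCoeff r n j := by
  have h1 : (1 : ℝ) / r ≤ 1 := by
    rw [div_le_one (by positivity)]; exact_mod_cast hr
  unfold padeCoeff
  refine mul_nonneg (div_nonneg (Finset.prod_nonneg fun i _ => ?_) (by positivity)) (by positivity)
  push_cast
  have : (0 : ℝ) ≤ ((n - j : ℕ) : ℝ) + i := by positivity
  linarith

/-- One factor `r` per term turns each product into an arithmetic progression of difference `r`; a
second one per term makes it divisible by the factorial. There are `j + (n - j) = n` terms in all.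
-/
theorem pow_mul_padeCoeff_int {r : ℕ} (hr : 1 ≤ r) {n j : ℕ} (hj : j ≤ n) :
    ∃ e : ℤ, (r : ℝ) ^ (2 * n) * padeCoeff r n j = e := by
  have hr0 : (r : ℝ) ≠ 0 := by positivity
  obtain ⟨u, hu⟩ := factorial_dvd_pow_mul_prod_arith r ((n - j + 1) * r - 1) j
  obtain ⟨v, hv⟩ := factorial_dvd_pow_mul_prod_arith r ((j + 1) * r + 1) (n - j)
  refine ⟨u * v, ?_⟩
  have h1 : (r : ℝ) ^ (2 * j) * (∏ i ∈ Finset.range j, (((n - j + i + 1 : ℕ) : ℝ) - 1 / r)) =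
      j.factorial * u := by
    have : ((r ^ j * ∏ i ∈ Finset.range j, ((n - j + 1) * r - 1 + i * r) : ℕ) : ℝ) =
      ((j.factorial * u : ℕ) : ℝ) := by exact_mod_cast hu
    push_cast at this
    rw [← this, two_mul, pow_add, mul_assoc]
    congr 1
    rw [← Finset.card_range j, ← Finset.prod_const, Finset.card_range, ← Finset.prod_mul_distrib]
    refine Finset.prod_congr rfl fun i _ => ?_
    have h2 : 1 ≤ (n - j + 1) * r := Nat.one_le_iff_ne_zero.2 (by positivity)
    rw [Nat.cast_sub h2]
    push_cast
    field_simp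
    ring
  have h2 : (r : ℝ) ^ (2 * (n - j)) *
      (∏ i ∈ Finset.range (n - j), (((j + i + 1 : ℕ) : ℝ) + 1 / r)) = (n - j).factorial * v := by
    have : ((r ^ (n - j) * ∏ i ∈ Finset.range (n - j), ((j + 1) * r + 1 + i * r) : ℕ) : ℝ) =
      (((n - j).factorial * v : ℕ) : ℝ) := by exact_mod_cast hv
    push_cast at this
    rw [← this, two_mul, pow_add, mul_assoc]
    congr 1
    rw [← Finset.card_range (n - j), ← Finset.prod_const, Finset.card_range,
      ← Finset.prod_mul_distrib]
    refine Finset.prod_congr rfl fun i _ => ?_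
    push_cast
    field_simp
    ring
  have h3 : (r : ℝ) ^ (2 * n) = r ^ (2 * j) * r ^ (2 * (n - j)) := by
    rw [← pow_add]; congr 1; omega
  have hf1 : (j.factorial : ℝ) ≠ 0 := by positivity
  have hf2 : ((n - j).factorial : ℝ) ≠ 0 := by positivity
  unfold padeCoeff
  rw [h3]
  calc _ = ((r : ℝ) ^ (2 * j) * (∏ i ∈ Finset.range j, (((n - j + i + 1 : ℕ) : ℝ) - 1 / r))) /
        j.factorial * (((r : ℝ) ^ (2 * (n - j)) *
      (∏ i ∈ Finset.range (n - j), (((j + i + 1 : ℕ) : ℝ) + 1 / r))) / (n - j).factorial) := by ring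
    _ = _ := by rw [h1, h2]; push_cast; field_simp

/-- Replacing `-1/r` by `0` and `1/r` by `1` in every factor gives ordinary binomial coefficients,
to which Vandermonde's identity applies. -/
theorem padeCoeff_le {r : ℕ} (hr : 1 ≤ r) {n j : ℕ} (hj : j ≤ n) :
    padeCoeff r n j ≤ ((n.choose j * (n + 1).choose (n - j) : ℕ) : ℝ) := by
  have h1 : (1 : ℝ) / r ≤ 1 := by
    rw [div_le_one (by positivity)]; exact_mod_cast hr
  have h0 : (0 : ℝ) ≤ 1 / r := by positivity
  have e1 : (n.choose j : ℝ) = (∏ i ∈ Finset.range j, ((n - j + i + 1 : ℕ) : ℝ)) / j.factorial := by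
    rw [eq_div_iff (by positivity), mul_comm]
    have := Nat.ascFactorial_eq_factorial_mul_choose (n - j) j
    rw [show n - j + j = n by omega, Nat.ascFactorial_eq_prod_range] at this
    rw [← Nat.cast_mul, ← this]
    push_cast
    exact Finset.prod_congr rfl fun i _ => by ring
  have e2 : ((n + 1).choose (n - j) : ℝ) =
      (∏ i ∈ Finset.range (n - j), ((j + i + 2 : ℕ) : ℝ)) / (n - j).factorial := by
    rw [eq_div_iff (by positivity), mul_comm]
    have := Nat.ascFactorial_eq_factorial_mul_choose (j + 1) (n - j)
    rw [show j + 1 + (n - j) = n + 1 by omega, Nat.ascFactorial_eq_prod_range] at this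
    rw [← Nat.cast_mul, ← this]
    push_cast
    exact Finset.prod_congr rfl fun i _ => by ring
  rw [Nat.cast_mul, e1, e2]
  have h2 : ∀ i : ℕ, (0 : ℝ) ≤ ((n - j + i + 1 : ℕ) : ℝ) - 1 / r := fun i => by
    push_cast
    have : (0 : ℝ) ≤ ((n - j : ℕ) : ℝ) + i := by positivity
    linarith
  unfold padeCoeff
  refine mul_le_mul ?_ ?_ (by positivity) (by positivity)
  · gcongr with i _
    · exact fun i _ => h2 i
    · linarith
  · gcongr with i _
    push_cast
    linarith

theorem sum_padeCoeff_le {r : ℕ} (hr : 1 ≤ r) (n : ℕ) :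
    ∑ j ∈ Finset.range (n + 1), padeCoeff r n j ≤ 4 ^ n := by
  calc _ ≤ ∑ j ∈ Finset.range (n + 1), ((n.choose j * (n + 1).choose (n - j) : ℕ) : ℝ) :=
        Finset.sum_le_sum fun j hj => padeCoeff_le hr (by simpa [Nat.lt_succ_iff] using hj)
    _ = (((n + (n + 1)).choose n : ℕ) : ℝ) := by
        rw [Nat.add_choose_eq, Finset.Nat.sum_antidiagonal_eq_sum_range_succ_mk]
        push_cast; rfl
    _ ≤ ((4 ^ n : ℕ) : ℝ) := by
        exact_mod_cast (show (n + (n + 1)).choose n ≤ 4 ^ n by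
          rw [show n + (n + 1) = 2 * n + 1 by ring]; exact Nat.choose_middle_le_pow n)
    _ = _ := by push_cast; rfl

/-! ### The remainder of the Padé approximation. -/

/-- `∏_{l=1}^{n} (l - 1/r) (l + 1/r) / l²`. -/
noncomputable def padeNorm (r n : ℕ) : ℝ :=
  (∏ i ∈ Finset.range n, (((i + 1 : ℕ) : ℝ) - 1 / r)) *
    (∏ i ∈ Finset.range n, (((i + 1 : ℕ) : ℝ) + 1 / r)) / (n.factorial : ℝ) ^ 2

theorem padeNorm_nonneg {r : ℕ} (hr : 1 ≤ r) (n : ℕ) : 0 ≤ padeNorm r n := by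
  have h1 : (1 : ℝ) / r ≤ 1 := by
    rw [div_le_one (by positivity)]; exact_mod_cast hr
  unfold padeNorm
  refine div_nonneg (mul_nonneg (Finset.prod_nonneg fun i _ => ?_) (by positivity)) (by positivity)
  push_cast
  have : (0 : ℝ) ≤ i := by positivity
  linarith

theorem padeNorm_le_one {r : ℕ} (hr : 1 ≤ r) (n : ℕ) : padeNorm r n ≤ 1 := by
  have h1 : (1 : ℝ) / r ≤ 1 := by
    rw [div_le_one (by positivity)]; exact_mod_cast hr
  unfold padeNorm
  rw [div_le_one (by positivity), ← Finset.prod_mul_distrib, ← Finset.prod_range_add_one_eq_factorial]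
  push_cast
  rw [← Finset.prod_pow]
  refine Finset.prod_le_prod (fun i _ => ?_) fun i _ => ?_
  · have : (0 : ℝ) ≤ i := by positivity
    exact mul_nonneg (by linarith) (by positivity)
  · nlinarith [sq_nonneg ((1 : ℝ) / r)]

/-- Partial fractions. -/
theorem sum_neg_one_pow_choose_div (n : ℕ) (x : ℝ) (hx : ∀ i ≤ n, x + i ≠ 0) :
    ∑ i ∈ Finset.range (n + 1), (-1 : ℝ) ^ i * n.choose i / (x + i) =
      n.factorial / ∏ i ∈ Finset.range (n + 1), (x + i) := by
  induction n generalizing x with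
  | zero => simp
  | succ n ih =>
    have hx1 : ∀ i ≤ n, x + i ≠ 0 := fun i hi => hx i (by omega)
    have hx2 : ∀ i ≤ n, x + 1 + (i : ℝ) ≠ 0 := fun i hi => by
      have := hx (i + 1) (by omega); push_cast at this; convert this using 1; ring
    -- Pascal's rule: the sum for `n + 1` is the difference of the sums for `n` at `x` and at `x +
    -- 1`.
    have key : ∑ i ∈ Finset.range (n + 1 + 1), (-1 : ℝ) ^ i * (n + 1).choose i / (x + i) =
        ∑ i ∈ Finset.range (n + 1), (-1 : ℝ) ^ i * n.choose i / (x + i) -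
        ∑ i ∈ Finset.range (n + 1), (-1 : ℝ) ^ i * n.choose i / (x + 1 + i) := by
      rw [Finset.sum_range_succ']
      have e : ∑ i ∈ Finset.range (n + 1), (-1 : ℝ) ^ i * n.choose i / (x + i) =
          ∑ i ∈ Finset.range (n + 1), (-1 : ℝ) ^ (i + 1) * n.choose (i + 1) / (x + (i + 1 : ℕ)) +
            1 / x := by
        have h1 := Finset.sum_range_succ' (fun i => (-1 : ℝ) ^ i * n.choose i / (x + i)) (n + 1)
        rw [Finset.sum_range_succ] at h1
        simpa using h1
      rw [e]
      have e2 : ∀ i ∈ Finset.range (n + 1),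
          (-1 : ℝ) ^ (i + 1) * (n + 1).choose (i + 1) / (x + (i + 1 : ℕ)) =
          (-1 : ℝ) ^ (i + 1) * n.choose (i + 1) / (x + (i + 1 : ℕ)) -
          (-1 : ℝ) ^ i * n.choose i / (x + 1 + i) := fun i _ => by
        rw [Nat.choose_succ_succ]; push_cast
        rw [show x + 1 + (i : ℝ) = x + (i + 1) by ring, ← sub_div]; ring
      rw [Finset.sum_congr rfl e2, Finset.sum_sub_distrib]
      simp
      ring
    rw [key, ih x hx1, ih (x + 1) hx2]
    have hp1 : ∏ i ∈ Finset.range (n + 1 + 1), (x + i) =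
        (∏ i ∈ Finset.range (n + 1), (x + i)) * (x + (n + 1)) := by
      rw [Finset.prod_range_succ]; push_cast; rfl
    have hp2 : ∏ i ∈ Finset.range (n + 1 + 1), (x + i) =
        (∏ i ∈ Finset.range (n + 1), (x + 1 + i)) * x := by
      rw [Finset.prod_range_succ']; simp only [Nat.cast_zero, add_zero]
      congr 1; exact Finset.prod_congr rfl fun i _ => by push_cast; ring
    have n1 : ∏ i ∈ Finset.range (n + 1), (x + i) ≠ 0 :=
      Finset.prod_ne_zero_iff.2 fun i hi => hx1 i (by simpa [Nat.lt_succ_iff] using hi)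
    have n2 : ∏ i ∈ Finset.range (n + 1), (x + 1 + i) ≠ 0 :=
      Finset.prod_ne_zero_iff.2 fun i hi => hx2 i (by simpa [Nat.lt_succ_iff] using hi)
    have n3 : x ≠ 0 := by simpa using hx 0 (by omega)
    have n4 : x + (n + 1) ≠ 0 := by have := hx (n + 1) le_rfl; push_cast at this; exact this
    have e3 : (n.factorial : ℝ) / ∏ i ∈ Finset.range (n + 1), (x + i) =
        n.factorial * (x + (n + 1)) / ∏ i ∈ Finset.range (n + 1 + 1), (x + i) := by
      rw [hp1]; field_simp
    have e4 : (n.factorial : ℝ) / ∏ i ∈ Finset.range (n + 1), (x + 1 + i) =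
        n.factorial * x / ∏ i ∈ Finset.range (n + 1 + 1), (x + i) := by
      rw [hp2]; field_simp
    rw [e3, e4, ← sub_div, Nat.factorial_succ]
    push_cast; ring

/-- This evaluates the sums met at the endpoints of `padePrimitive`. By partial fractions the sum is
a factorial over a product of shifts of `1/r`; splitting that product at its term `1/r` separates
the factors `l - 1/r` from the factors `l + 1/r`, and `padeNorm` completes both products. -/
theorem padeCoeff_eq_sum {r : ℕ} (hr : 2 ≤ r) {n j : ℕ} (hj : j ≤ n) :
    padeNorm r n * ((-1 : ℝ) ^ (n - j) * n.choose j * ∑ i ∈ Finset.range (n + 1),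
      (-1 : ℝ) ^ i * n.choose i / (r * ((i : ℝ) + j - n) + 1)) = padeCoeff r n j := by
  have hr0 : (0 : ℝ) < r := by positivity
  have hr1 : (1 : ℝ) / r < 1 := by
    rw [div_lt_one hr0]; exact_mod_cast hr
  have hr2 : (0 : ℝ) < 1 / r := by positivity
  obtain ⟨k, rfl⟩ : ∃ k, n = k + j := ⟨n - j, by omega⟩
  have hUpos : ∀ i : ℕ, (0 : ℝ) < ((i + 1 : ℕ) : ℝ) - 1 / r := fun i => by
    push_cast; have : (0 : ℝ) ≤ i := by positivity
    linarith
  set ν : ℝ := 1 / r with hν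
  have hx : ∀ i ≤ k + j, (ν - k) + (i : ℝ) ≠ 0 := fun i _ h0 => by
    rcases le_or_gt k i with h | h
    · have : (k : ℝ) ≤ i := by exact_mod_cast h
      linarith
    · have : (i : ℝ) + 1 ≤ k := by exact_mod_cast h
      linarith
  have hs := sum_neg_one_pow_choose_div (k + j) (ν - k) hx
  have hsum : ∑ i ∈ Finset.range (k + j + 1),
      (-1 : ℝ) ^ i * (k + j).choose i / (r * ((i : ℝ) + j - (k + j : ℕ)) + 1) =
      ν * ((k + j).factorial / ∏ i ∈ Finset.range (k + j + 1), ((ν - k) + (i : ℝ))) := by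
    rw [← hs, Finset.mul_sum]
    refine Finset.sum_congr rfl fun i hi => ?_
    have h1 := hx i (by simpa [Nat.lt_succ_iff] using hi)
    have h2 : (r : ℝ) * ((i : ℝ) + j - (k + j : ℕ)) + 1 = r * ((ν - k) + i) := by
      rw [hν]; push_cast; field_simp; ring
    rw [h2, hν]; field_simp
  have hprod : ∏ i ∈ Finset.range (k + j + 1), ((ν - k) + (i : ℝ)) =
      (-1) ^ k * (∏ i ∈ Finset.range k, (((i + 1 : ℕ) : ℝ) - ν)) * ν *
        ∏ i ∈ Finset.range j, (((i + 1 : ℕ) : ℝ) + ν) := by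
    rw [show k + j + 1 = k + (j + 1) by ring, Finset.prod_range_add, Finset.prod_range_succ']
    have h1 : ∏ i ∈ Finset.range k, ((ν - k) + (i : ℝ)) =
        (-1) ^ k * ∏ i ∈ Finset.range k, (((i + 1 : ℕ) : ℝ) - ν) := by
      have h0 : (-1 : ℝ) ^ k = ∏ _i ∈ Finset.range k, (-1 : ℝ) := by simp
      rw [← Finset.prod_range_reflect, h0, ← Finset.prod_mul_distrib]
      refine Finset.prod_congr rfl fun i hi => ?_
      have : i + 1 ≤ k := Finset.mem_range.1 hi
      rw [show k - 1 - i = k - (i + 1) by omega, Nat.cast_sub this]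
      push_cast; ring
    rw [h1]
    have h2 : ∏ i ∈ Finset.range j, (ν - (k : ℝ) + ((k + (i + 1) : ℕ) : ℝ)) =
        ∏ i ∈ Finset.range j, (((i + 1 : ℕ) : ℝ) + ν) :=
      Finset.prod_congr rfl fun i _ => by push_cast; ring
    rw [h2]; push_cast; ring
  have hU : ∏ i ∈ Finset.range (k + j), (((i + 1 : ℕ) : ℝ) - ν) =
      (∏ i ∈ Finset.range k, (((i + 1 : ℕ) : ℝ) - ν)) *
        ∏ i ∈ Finset.range j, (((k + j - j + i + 1 : ℕ) : ℝ) - ν) := by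
    rw [Finset.prod_range_add, Nat.add_sub_cancel]
  have hV : ∏ i ∈ Finset.range (k + j), (((i + 1 : ℕ) : ℝ) + ν) =
      (∏ i ∈ Finset.range j, (((i + 1 : ℕ) : ℝ) + ν)) *
        ∏ i ∈ Finset.range (k + j - j), (((j + i + 1 : ℕ) : ℝ) + ν) := by
    rw [add_comm k j, Finset.prod_range_add, Nat.add_sub_cancel_left]
  have hUne : ∏ i ∈ Finset.range k, (((i + 1 : ℕ) : ℝ) - ν) ≠ 0 :=
    Finset.prod_ne_zero_iff.2 fun i _ => (hUpos i).ne'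
  have hVne : ∏ i ∈ Finset.range j, (((i + 1 : ℕ) : ℝ) + ν) ≠ 0 :=
    Finset.prod_ne_zero_iff.2 fun i _ => by positivity
  have hch : ((k + j).choose j : ℝ) = (k + j).factorial / (j.factorial * k.factorial) := by
    rw [Nat.cast_choose ℝ (Nat.le_add_left j k), Nat.add_sub_cancel]
  have hsq : ((-1 : ℝ) ^ k) * (-1) ^ k = 1 := by rw [← mul_pow]; simp
  have hne : (-1 : ℝ) ^ k ≠ 0 := pow_ne_zero _ (by norm_num)
  rw [hsum, hprod, hch]
  unfold padeNorm padeCoeff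
  rw [← hν, hU, hV]
  simp only [Nat.add_sub_cancel]
  generalize (∏ i ∈ Finset.range k, (((i + 1 : ℕ) : ℝ) - ν)) = u at *
  generalize (∏ i ∈ Finset.range j, (((i + 1 : ℕ) : ℝ) + ν)) = v at *
  have hνne : ν ≠ 0 := hr2.ne'
  have f1 : ((k + j).factorial : ℝ) ≠ 0 := by positivity
  have f2 : (j.factorial : ℝ) ≠ 0 := by positivity
  have f3 : (k.factorial : ℝ) ≠ 0 := by positivity
  field_simp

/-- The diagonal Padé form `∑ j, padeCoeff r n j * X ^ j * Y ^ (n - j)`. -/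
noncomputable def padeForm (r n : ℕ) (X Y : ℂ) : ℂ :=
  ∑ j ∈ Finset.range (n + 1), (padeCoeff r n j : ℂ) * X ^ j * Y ^ (n - j)

theorem padeForm_smul (r n : ℕ) (c X Y : ℂ) :
    padeForm r n (c * X) (c * Y) = c ^ n * padeForm r n X Y := by
  unfold padeForm
  rw [Finset.mul_sum]
  refine Finset.sum_congr rfl fun j hj => ?_
  have : j ≤ n := by simpa [Nat.lt_succ_iff] using hj
  have h : c ^ n = c ^ j * c ^ (n - j) := by rw [← pow_add]; congr 1; omega
  rw [mul_pow, mul_pow, h]; ring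

theorem norm_padeForm_le {r : ℕ} (hr : 1 ≤ r) (n : ℕ) {X Y : ℂ} {Z : ℝ} (hX : ‖X‖ ≤ Z)
    (hY : ‖Y‖ ≤ Z) : ‖padeForm r n X Y‖ ≤ 4 ^ n * Z ^ n := by
  have hZ : 0 ≤ Z := (norm_nonneg X).trans hX
  calc ‖padeForm r n X Y‖ ≤ ∑ j ∈ Finset.range (n + 1), padeCoeff r n j * Z ^ n := by
        refine norm_sum_le_of_le _ fun j hj => ?_
        have hjn : j ≤ n := by simpa [Nat.lt_succ_iff] using hj
        rw [norm_mul, norm_mul, norm_pow, norm_pow, Complex.norm_real,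
          Real.norm_of_nonneg (padeCoeff_nonneg hr n j), mul_assoc]
        refine mul_le_mul_of_nonneg_left ?_ (padeCoeff_nonneg hr n j)
        calc ‖X‖ ^ j * ‖Y‖ ^ (n - j) ≤ Z ^ j * Z ^ (n - j) := by gcongr
          _ = Z ^ n := by rw [← pow_add]; congr 1; omega
    _ ≤ _ := by
        rw [← Finset.sum_mul]
        exact mul_le_mul_of_nonneg_right (sum_padeCoeff_le hr n) (by positivity)

/-- A primitive, in `t`, of `μ u ((u ^ r - 1) (v ^ r - u ^ r) u ^ (-r)) ^ n` with `u = exp (μ t)`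
and `v = exp μ`. -/
noncomputable def padePrimitive (r n : ℕ) (μ : ℂ) (t : ℝ) : ℂ :=
  ∑ i ∈ Finset.range (n + 1), ∑ j ∈ Finset.range (n + 1),
    (((-1 : ℝ) ^ i * n.choose i * ((-1 : ℝ) ^ (n - j) * n.choose j) /
      (r * ((i : ℝ) + j - n) + 1) : ℝ) : ℂ) * Complex.exp (μ * r) ^ (n - i) *
      Complex.exp (μ * (r * ((i : ℂ) + j - n) + 1) * t)

/-- The number is congruent to `1` modulo `r`. Hence no constant term occurs in the expanded
integrand, and its primitive is again a sum of exponentials. -/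
theorem mul_add_one_ne_zero {r : ℕ} (hr : 2 ≤ r) (i j n : ℕ) :
    (r : ℝ) * ((i : ℝ) + j - n) + 1 ≠ 0 := by
  intro h
  have h1 : (r : ℤ) * ((i : ℤ) + j - n) + 1 = 0 := by exact_mod_cast h
  have h2 : (r : ℤ) ∣ 1 := ⟨-((i : ℤ) + j - n), by linarith⟩
  have := Int.le_of_dvd one_pos h2
  omega

/-- Each denominator cancels against the factor brought down from the exponent; the remaining double
sum is the binomial expansion of the two `n`-th powers. -/
theorem hasDerivAt_padePrimitive {r : ℕ} (hr : 2 ≤ r) (n : ℕ) (μ : ℂ) (t : ℝ) :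
    HasDerivAt (padePrimitive r n μ) (μ * Complex.exp (μ * t) *
      ((Complex.exp (μ * r) - Complex.exp (μ * r * t)) * (Complex.exp (μ * r * t) - 1) *
        Complex.exp (-(μ * r * t))) ^ n) t := by
  have h1 : ∀ i ∈ Finset.range (n + 1), ∀ j ∈ Finset.range (n + 1), HasDerivAt (fun t : ℝ =>
      (((-1 : ℝ) ^ i * n.choose i * ((-1 : ℝ) ^ (n - j) * n.choose j) /
      (r * ((i : ℝ) + j - n) + 1) : ℝ) : ℂ) * Complex.exp (μ * r) ^ (n - i) *
      Complex.exp (μ * (r * ((i : ℂ) + j - n) + 1) * t))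
      (μ * Complex.exp (μ * t) * ((((-1) ^ i * n.choose i) * Complex.exp (μ * r) ^ (n - i) *
        Complex.exp (μ * r * t) ^ i) * (((-1) ^ (n - j) * n.choose j) *
          Complex.exp (μ * r * t) ^ j) * Complex.exp (-(μ * r * t)) ^ n)) t := by
    intro i _ j _
    have h2 : HasDerivAt (fun t : ℝ => μ * (r * ((i : ℂ) + j - n) + 1) * (t : ℂ))
        (μ * (r * ((i : ℂ) + j - n) + 1) * 1) t :=
      (Complex.ofRealCLM.hasDerivAt (x := t)).const_mul _
    have h3 := (h2.cexp).const_mul ((((-1 : ℝ) ^ i * n.choose i * ((-1 : ℝ) ^ (n - j) * n.choose j) /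
      (r * ((i : ℝ) + j - n) + 1) : ℝ) : ℂ) * Complex.exp (μ * r) ^ (n - i))
    refine h3.congr_deriv ?_
    have h4 : Complex.exp (μ * (r * ((i : ℂ) + j - n) + 1) * t) = Complex.exp (μ * t) *
        Complex.exp (μ * r * t) ^ i * Complex.exp (μ * r * t) ^ j *
          Complex.exp (-(μ * r * t)) ^ n := by
      rw [← Complex.exp_nat_mul, ← Complex.exp_nat_mul, ← Complex.exp_nat_mul, ← Complex.exp_add,
        ← Complex.exp_add, ← Complex.exp_add]
      congr 1; ring
    rw [h4]
    have h5 : (r : ℂ) * ((i : ℂ) + j - n) + 1 ≠ 0 := by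
      exact_mod_cast mul_add_one_ne_zero hr i j n
    push_cast
    field_simp
  have h2 := HasDerivAt.fun_sum fun i hi => HasDerivAt.fun_sum fun j hj => h1 i hi j hj
  refine h2.congr_deriv ?_
  simp_rw [← Finset.mul_sum, ← Finset.sum_mul]
  rw [mul_pow, mul_pow, sub_eq_neg_add, add_pow, sub_eq_add_neg (Complex.exp (μ * r * t)) 1, add_pow,
    ← Finset.sum_mul_sum]
  congr 3
  · refine Finset.sum_congr rfl fun i _ => ?_
    rw [neg_pow]; ring
  · exact Finset.sum_congr rfl fun i _ => by ring

theorem padeNorm_mul_padePrimitive_one {r : ℕ} (hr : 2 ≤ r) (n : ℕ) (μ : ℂ) :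
    (padeNorm r n : ℂ) * padePrimitive r n μ 1 =
      Complex.exp μ * padeForm r n (Complex.exp (μ * r)) 1 := by
  unfold padePrimitive padeForm
  rw [Finset.sum_comm, Finset.mul_sum, Finset.mul_sum]
  refine Finset.sum_congr rfl fun j hj => ?_
  have hjn : j ≤ n := by simpa [Nat.lt_succ_iff] using hj
  rw [← padeCoeff_eq_sum hr hjn]
  push_cast
  simp only [Finset.mul_sum, Finset.sum_mul]
  refine Finset.sum_congr rfl fun i hi => ?_
  have hin : i ≤ n := by simpa [Nat.lt_succ_iff] using hi
  have h4 : Complex.exp (μ * (r * ((i : ℂ) + j - n) + 1) * 1) = Complex.exp μ *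
      (Complex.exp (μ * r) ^ (n - i))⁻¹ * Complex.exp (μ * r) ^ j := by
    rw [← Complex.exp_nat_mul, ← Complex.exp_nat_mul, ← Complex.exp_neg, ← Complex.exp_add,
        ← Complex.exp_add, Nat.cast_sub hin]
    congr 1; ring
  have h5 : Complex.exp (μ * r) ^ (n - i) ≠ 0 := pow_ne_zero _ (Complex.exp_ne_zero _)
  rw [h4]
  field_simp
  ring

/-- At `t = 0` the index that survives is the outer one, so the two indices exchange roles compared
with `t = 1`; the signs agree because `j + (n - i)` and `i + (n - j)` have the same parity. -/
theorem padeNorm_mul_padePrimitive_zero {r : ℕ} (hr : 2 ≤ r) (n : ℕ) (μ : ℂ) :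
    (padeNorm r n : ℂ) * padePrimitive r n μ 0 = padeForm r n 1 (Complex.exp (μ * r)) := by
  unfold padePrimitive padeForm
  rw [Finset.mul_sum]
  refine Finset.sum_congr rfl fun j hj => ?_
  have hjn : j ≤ n := by simpa [Nat.lt_succ_iff] using hj
  rw [← padeCoeff_eq_sum hr hjn]
  push_cast
  simp only [Finset.mul_sum, Finset.sum_mul]
  refine Finset.sum_congr rfl fun i hi => ?_
  have hin : i ≤ n := by simpa [Nat.lt_succ_iff] using hi
  have h6 : (-1 : ℂ) ^ j * (-1) ^ (n - i) = (-1) ^ i * (-1) ^ (n - j) := by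
    obtain ⟨a, rfl⟩ := Nat.exists_eq_add_of_le hjn
    obtain ⟨b, hb⟩ := Nat.exists_eq_add_of_le hin
    rw [show j + a - i = b by omega, Nat.add_sub_cancel_left, ← pow_add, ← pow_add]
    have : (j + b) + 2 * i = (i + a) + 2 * j := by omega
    have h7 : (-1 : ℂ) ^ ((j + b) + 2 * i) = (-1) ^ ((i + a) + 2 * j) := by rw [this]
    simpa [pow_add, pow_mul] using h7
  rw [show (i : ℂ) + j - n = j + i - n by ring] at *
  simp only [mul_zero, Complex.exp_zero, one_pow, mul_one]
  linear_combination (padeNorm r n : ℂ) * (n.choose j * n.choose i) / (r * ((j : ℂ) + i - n) + 1) *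
    Complex.exp (μ * r) ^ (n - j) * h6

/-- A bound for the remainder in the Padé approximation to the `r`-th root. -/
theorem norm_padeForm_sub_le {r : ℕ} (hr : 2 ≤ r) (n : ℕ) (μ : ℂ) (B B' : ℝ → ℝ)
    (hB : ∀ t, HasDerivAt B (B' t) t)
    (hb : ∀ t ∈ Set.Ico (0 : ℝ) 1, ‖μ * Complex.exp (μ * t) *
      ((Complex.exp (μ * r) - Complex.exp (μ * r * t)) * (Complex.exp (μ * r * t) - 1) *
        Complex.exp (-(μ * r * t))) ^ n‖ ≤ B' t) :
    ‖padeForm r n 1 (Complex.exp (μ * r)) -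
      Complex.exp μ * padeForm r n (Complex.exp (μ * r)) 1‖ ≤ B 1 - B 0 := by
  rw [← padeNorm_mul_padePrimitive_one hr, ← padeNorm_mul_padePrimitive_zero hr, ← mul_sub,
    norm_mul, norm_sub_rev, Complex.norm_real, Real.norm_of_nonneg (padeNorm_nonneg (by omega) n)]
  have hd := fun t => hasDerivAt_padePrimitive hr n μ t
  -- Comparison of a complex-valued function with a real majorant through their derivatives; no
  -- integral has to be written down.
  have key := image_norm_le_of_norm_deriv_right_le_deriv_boundary'
    (f := fun t => padePrimitive r n μ t - padePrimitive r n μ 0)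
    (B := fun t => B t - B 0) (B' := B') (a := 0) (b := 1)
    (fun t _ => ((hd t).sub_const _).continuousAt.continuousWithinAt)
    (fun t _ => ((hd t).sub_const _).hasDerivWithinAt) (by simp)
    (fun t _ => ((hB t).sub_const _).continuousAt.continuousWithinAt)
    (fun t _ => ((hB t).sub_const _).hasDerivWithinAt) hb (Set.right_mem_Icc.2 zero_le_one)
  calc _ ≤ 1 * ‖padePrimitive r n μ 1 - padePrimitive r n μ 0‖ :=
        mul_le_mul_of_nonneg_right (padeNorm_le_one (by omega) n) (norm_nonneg _)
    _ ≤ _ := by rw [one_mul]; exact key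

/-- With `w = exp (μ r)` and `s` between `1` and `w`, the quantity `|w - s| |s - 1| / s` is at most
`(w - 1)² / max 1 w`; what remains to integrate is `|μ| exp (μ t)`, with total `|exp μ - 1|`. -/
theorem norm_padeForm_sub_le_of_real {r : ℕ} (hr : 2 ≤ r) (n : ℕ) (μ : ℝ) :
    ‖padeForm r n 1 (Real.exp (μ * r) : ℝ) -
      (Real.exp μ : ℝ) * padeForm r n (Real.exp (μ * r) : ℝ) 1‖ ≤
      |Real.exp μ - 1| * ((Real.exp (μ * r) - 1) ^ 2 / max 1 (Real.exp (μ * r))) ^ n := by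
  set w := Real.exp (μ * r) with hw
  have hw0 : 0 < w := Real.exp_pos _
  set K := (w - 1) ^ 2 / max 1 w with hK
  have hK0 : 0 ≤ K := by positivity
  -- `σ` is a sign of `μ`; it makes the majorant `K ^ n * σ * exp (μ t)` increasing in both cases.
  obtain ⟨σ, hσ1, hσ2⟩ : ∃ σ : ℝ, σ * μ = |μ| ∧ σ * (Real.exp μ - 1) = |Real.exp μ - 1| := by
    rcases le_total 0 μ with h | h
    · exact ⟨1, by rw [abs_of_nonneg h, one_mul],
        by rw [abs_of_nonneg (by linarith [Real.one_le_exp h]), one_mul]⟩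
    · exact ⟨-1, by rw [abs_of_nonpos h]; ring,
        by rw [abs_of_nonpos (by linarith [Real.exp_le_one_iff.2 h])]; ring⟩
  have hKbound : ∀ t ∈ Set.Ico (0 : ℝ) 1,
      |(w - Real.exp (μ * r * t)) * (Real.exp (μ * r * t) - 1) * Real.exp (-(μ * r * t))| ≤ K := by
    intro t ht
    set s := Real.exp (μ * r * t) with hs
    have hs0 : 0 < s := Real.exp_pos _
    rw [Real.exp_neg, ← hs, abs_mul, abs_mul, abs_inv, abs_of_pos hs0, hK, ← div_eq_mul_inv,
      div_le_div_iff₀ hs0 (by positivity)]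
    rcases le_total 0 μ with h | h
    · have hmr : 0 ≤ μ * r := by positivity
      have h1 : 1 ≤ s := Real.one_le_exp (by nlinarith [ht.1])
      have h2 : s ≤ w := Real.exp_le_exp.2 (by nlinarith [ht.1, ht.2])
      rw [max_eq_right (by linarith), abs_of_nonneg (by linarith), abs_of_nonneg (by linarith)]
      have h3 : (s - 1) * w ≤ (w - 1) * s := by nlinarith
      calc (w - s) * (s - 1) * w = (w - s) * ((s - 1) * w) := by ring
        _ ≤ (w - 1) * ((w - 1) * s) := by
          refine mul_le_mul (by linarith) h3 (by nlinarith) (by linarith)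
        _ = _ := by ring
    · have hmr : μ * r ≤ 0 := mul_nonpos_of_nonpos_of_nonneg h (by positivity)
      have h1 : s ≤ 1 := Real.exp_le_one_iff.2 (by nlinarith [ht.1])
      have h2 : w ≤ s := Real.exp_le_exp.2 (by nlinarith [ht.1, ht.2])
      rw [max_eq_left (by linarith), abs_of_nonpos (by linarith), abs_of_nonpos (by linarith)]
      have h3 : (s - w) ≤ (1 - w) * s := by nlinarith
      calc -(w - s) * -(s - 1) * 1 = (s - w) * (1 - s) := by ring
        _ ≤ ((1 - w) * s) * (1 - w) := by
          refine mul_le_mul h3 (by linarith) (by linarith) (by nlinarith)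
        _ = _ := by ring
  have key := norm_padeForm_sub_le hr n (μ : ℂ) (fun t => K ^ n * σ * Real.exp (μ * t))
    (fun t => K ^ n * σ * (Real.exp (μ * t) * μ)) (fun t => by
      have := ((((hasDerivAt_id t).const_mul μ).exp).const_mul (K ^ n * σ))
      simpa using this) (fun t ht => by
      have e : (μ : ℂ) * Complex.exp (μ * t) *
        ((Complex.exp (μ * r) - Complex.exp (μ * r * t)) * (Complex.exp (μ * r * t) - 1) *
        Complex.exp (-(μ * r * t))) ^ n = ((μ * Real.exp (μ * t) *
          ((w - Real.exp (μ * r * t)) * (Real.exp (μ * r * t) - 1) *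
            Real.exp (-(μ * r * t))) ^ n : ℝ) : ℂ) := by
        rw [hw]; push_cast; rfl
      rw [e, Complex.norm_real, Real.norm_eq_abs, abs_mul, abs_mul, abs_pow,
        abs_of_pos (Real.exp_pos _)]
      calc |μ| * Real.exp (μ * t) * _ ^ n ≤ |μ| * Real.exp (μ * t) * K ^ n := by
            gcongr
            exact hKbound t ht
        _ = _ := by rw [← hσ1]; ring)
  have e1 : Complex.exp (μ * r) = (w : ℂ) := by rw [hw]; push_cast; rfl
  have e2 : Complex.exp (μ : ℂ) = (Real.exp μ : ℝ) := by push_cast; rfl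
  rw [e1, e2] at key
  refine key.trans (le_of_eq ?_)
  rw [← hσ2]; simp; ring

theorem norm_exp_mul_I_sub_exp_mul_I (a b : ℝ) :
    ‖Complex.exp (a * Complex.I) - Complex.exp (b * Complex.I)‖ = 2 * |Real.sin ((a - b) / 2)| := by
  have h : Complex.exp (a * Complex.I) - Complex.exp (b * Complex.I) =
      Complex.exp (b * Complex.I) * (Complex.exp (Complex.I * ((a - b : ℝ) : ℂ)) - 1) := by
    rw [mul_sub, ← Complex.exp_add, mul_one]
    congr 2; push_cast; ring
  rw [h, norm_mul, Complex.norm_exp_ofReal_mul_I, one_mul, Complex.norm_exp_I_mul_ofReal_sub_one,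
    norm_mul, Real.norm_eq_abs, Real.norm_eq_abs, abs_of_pos (by norm_num : (0 : ℝ) < 2)]

theorem abs_sin_le_abs_sin {x y : ℝ} (hxy : |x| ≤ |y|) (hy : |y| ≤ Real.pi / 2) :
    |Real.sin x| ≤ |Real.sin y| := by
  have hpi := Real.pi_pos
  rw [Real.abs_sin_eq_sin_abs_of_abs_le_pi (by linarith),
    Real.abs_sin_eq_sin_abs_of_abs_le_pi (by linarith)]
  exact Real.sin_le_sin_of_le_of_le_pi_div_two (by linarith [abs_nonneg x]) hy hxy

/-- On an arc of angle at most `π` both chords from an intermediate point to the endpoints are no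
longer than the whole chord, so a linear majorant suffices. -/
theorem norm_padeForm_sub_le_of_arc {r : ℕ} (hr : 2 ≤ r) (n : ℕ) (φ : ℝ)
    (hφ : |φ| ≤ Real.pi / r) :
    ‖padeForm r n 1 (Complex.exp ((φ * r : ℝ) * Complex.I)) -
      Complex.exp (φ * Complex.I) * padeForm r n (Complex.exp ((φ * r : ℝ) * Complex.I)) 1‖ ≤
      |φ| * (‖1 - Complex.exp ((φ * r : ℝ) * Complex.I)‖ ^ 2) ^ n := by
  have hr0 : (0 : ℝ) < r := by positivity
  set ψ : ℝ := φ * r with hψ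
  have hψ' : |ψ| ≤ Real.pi := by
    rw [hψ, abs_mul, abs_of_pos hr0]
    calc |φ| * r ≤ Real.pi / r * r := by gcongr
      _ = _ := by field_simp
  set k := ‖1 - Complex.exp (ψ * Complex.I)‖ with hk
  have hk' : k = 2 * |Real.sin (ψ / 2)| := by
    have := norm_exp_mul_I_sub_exp_mul_I ψ 0
    rw [hk, norm_sub_rev]; simpa using this
  have hhalf : |ψ / 2| ≤ Real.pi / 2 := by
    rw [abs_div, abs_of_pos (by norm_num : (0 : ℝ) < 2)]; linarith
  have e0 : (φ * Complex.I : ℂ) * r = (ψ : ℂ) * Complex.I := by rw [hψ]; push_cast; ring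
  have key := norm_padeForm_sub_le hr n (φ * Complex.I : ℂ) (fun t => |φ| * (k ^ 2) ^ n * t)
    (fun t => |φ| * (k ^ 2) ^ n) (fun t => by
      simpa using (hasDerivAt_id t).const_mul (|φ| * (k ^ 2) ^ n)) (fun t ht => by
      have e1 : (ψ : ℂ) * Complex.I * t = ((ψ * t : ℝ) : ℂ) * Complex.I := by push_cast; ring
      have e2 : (φ : ℂ) * Complex.I * t = ((φ * t : ℝ) : ℂ) * Complex.I := by push_cast; ring
      have e3 : -(((ψ * t : ℝ) : ℂ) * Complex.I) = ((-(ψ * t) : ℝ) : ℂ) * Complex.I := by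
        push_cast; ring
      have e4 := norm_exp_mul_I_sub_exp_mul_I (ψ * t) 0
      simp only [Complex.ofReal_zero, zero_mul, Complex.exp_zero] at e4
      rw [e0, e1, e2, e3, norm_mul, norm_mul, norm_pow, norm_mul, norm_mul,
        Complex.norm_exp_ofReal_mul_I, Complex.norm_exp_ofReal_mul_I, norm_mul, Complex.norm_I,
        Complex.norm_real, Real.norm_eq_abs, mul_one, mul_one, mul_one, sq,
        norm_exp_mul_I_sub_exp_mul_I, e4, hk']
      have f1 : |Real.sin ((ψ - ψ * t) / 2)| ≤ |Real.sin (ψ / 2)| := by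
        refine abs_sin_le_abs_sin ?_ hhalf
        rw [show (ψ - ψ * t) / 2 = ψ / 2 * (1 - t) by ring, abs_mul]
        refine mul_le_of_le_one_right (abs_nonneg _) ?_
        rw [abs_of_nonneg (by linarith [ht.2])]; linarith [ht.1]
      have f2 : |Real.sin ((ψ * t - 0) / 2)| ≤ |Real.sin (ψ / 2)| := by
        refine abs_sin_le_abs_sin ?_ hhalf
        rw [show (ψ * t - 0) / 2 = ψ / 2 * t by ring, abs_mul]
        refine mul_le_of_le_one_right (abs_nonneg _) ?_
        rw [abs_of_nonneg ht.1]; exact ht.2.le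
      gcongr)
  rw [e0] at key
  refine key.trans (le_of_eq ?_)
  ring

/-- Jordan's inequality bounds the chord below by `2 r |φ| / π`, and `2 r ≥ 4 ≥ π`. -/
theorem abs_le_norm_one_sub_exp {r : ℕ} (hr : 2 ≤ r) (φ : ℝ) (hφ : |φ| ≤ Real.pi / r) :
    |φ| ≤ ‖1 - Complex.exp ((φ * r : ℝ) * Complex.I)‖ := by
  have hr0 : (0 : ℝ) < r := by positivity
  have hr2 : (2 : ℝ) ≤ r := by exact_mod_cast hr
  have hpi := Real.pi_pos
  have hψ' : |φ * r| ≤ Real.pi := by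
    rw [abs_mul, abs_of_pos hr0]
    calc |φ| * r ≤ Real.pi / r * r := by gcongr
      _ = _ := by field_simp
  have h := norm_exp_mul_I_sub_exp_mul_I (φ * r) 0
  rw [norm_sub_rev]
  simp only [Complex.ofReal_zero, zero_mul, Complex.exp_zero, sub_zero] at h
  have habs : |φ * r / 2| = |φ * r| / 2 := by
    rw [abs_div, abs_of_pos (by norm_num : (0 : ℝ) < 2)]
  rw [h, Real.abs_sin_eq_sin_abs_of_abs_le_pi (by rw [habs]; linarith)]
  have h2 := Real.mul_le_sin (abs_nonneg (φ * r / 2)) (by rw [habs]; linarith)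
  rw [habs, abs_mul, abs_of_pos hr0] at *
  have h3 : |φ| ≤ 2 * (2 / Real.pi * (|φ| * r / 2)) := by
    rw [show 2 * (2 / Real.pi * (|φ| * r / 2)) = 2 * r * |φ| / Real.pi by ring, le_div_iff₀ hpi]
    nlinarith [abs_nonneg φ, Real.pi_le_four]
  linarith

/-! ### Solutions close to a root of unity. -/

/-- `η / ξ` is close to `ω`, in the sense of all diagonal Padé approximants of the `r`-th root. -/
def PadeClose (r : ℕ) (h : ℝ) (ω ξ η : ℂ) : Prop :=
  ∀ n : ℕ, ‖ξ * padeForm r n (ξ ^ r) (η ^ r) - ω⁻¹ * η * padeForm r n (η ^ r) (ξ ^ r)‖ ≤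
    (h ^ 2 / max ‖ξ‖ ‖η‖ ^ r) ^ n * (h / max ‖ξ‖ ‖η‖ ^ (r - 1))

theorem sub_mul_pow_le_pow_sub_pow {x y : ℝ} (hy : 0 ≤ y) (hxy : y ≤ x) {r : ℕ} (hr : 1 ≤ r) :
    (x - y) * x ^ (r - 1) ≤ x ^ r - y ^ r := by
  obtain ⟨k, rfl⟩ := Nat.exists_eq_add_of_le' hr
  have := pow_le_pow_left₀ hy hxy k
  simp only [Nat.add_sub_cancel, pow_succ]
  nlinarith

/-- By homogeneity the left side is `ξ ^ (r n + 1)` times the remainder at `w = v ^ r`. Both factors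
of the bound then come from `‖ξ‖ ^ r * |w - 1| ≤ h`: squared it gives the base of the `n`-th power,
and with `|v - 1| * max 1 v ^ (r - 1) ≤ |w - 1|` the last factor. -/
theorem padeClose_of_pos {r : ℕ} (hr : 2 ≤ r) {h v : ℝ} {ω ξ : ℂ} (hω : ω ^ r = 1)
    (hv : 0 < v) (hξ : ξ ≠ 0) (hF : ‖ξ ^ r - (ω * v * ξ) ^ r‖ ≤ h) :
    PadeClose r h ω ξ (ω * v * ξ) := by
  intro n
  have hω0 : ω ≠ 0 := by
    rintro rfl
    rw [zero_pow (by omega)] at hω; exact zero_ne_one hω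
  have hωn : ‖ω‖ = 1 := Complex.norm_eq_one_of_pow_eq_one hω (by omega)
  have hexp : Real.exp (Real.log v) = v := Real.exp_log hv
  have hexp' : Real.exp (Real.log v * r) = v ^ r := by
    rw [mul_comm, Real.exp_nat_mul, hexp]
  have key := norm_padeForm_sub_le_of_real hr n (Real.log v)
  rw [hexp, hexp'] at key
  set w := v ^ r with hw
  have hw0 : 0 < w := by positivity
  have e1 : (ω * v * ξ) ^ r = ξ ^ r * (w : ℂ) := by
    rw [mul_pow, mul_pow, hω, hw]; push_cast; ring
  have e2 : ξ * padeForm r n (ξ ^ r) ((ω * v * ξ) ^ r) -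
      ω⁻¹ * (ω * v * ξ) * padeForm r n ((ω * v * ξ) ^ r) (ξ ^ r) =
      ξ * (ξ ^ r) ^ n * (padeForm r n 1 w - v * padeForm r n w 1) := by
    have a1 := padeForm_smul r n (ξ ^ r) 1 w
    have a2 := padeForm_smul r n (ξ ^ r) w 1
    rw [mul_one] at a1 a2
    rw [e1, a1, a2]
    field_simp
  have hξn : 0 < ‖ξ‖ := norm_pos_iff.2 hξ
  have hη : ‖ω * v * ξ‖ = v * ‖ξ‖ := by
    rw [norm_mul, norm_mul, hωn, Complex.norm_real, Real.norm_of_nonneg hv.le, one_mul]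
  have hF' : ‖ξ‖ ^ r * |w - 1| ≤ h := by
    have : ξ ^ r - (ω * v * ξ) ^ r = ξ ^ r * ((1 - w : ℝ) : ℂ) := by rw [e1]; push_cast; ring
    rw [this, norm_mul, norm_pow, Complex.norm_real, Real.norm_eq_abs, abs_sub_comm] at hF
    exact hF
  have hZ : max ‖ξ‖ (v * ‖ξ‖) = max 1 v * ‖ξ‖ := by
    rw [max_mul_of_nonneg _ _ hξn.le, one_mul]
  have hZr : (max 1 v) ^ r = max 1 w := by
    rcases le_total 1 v with h1 | h1
    · rw [max_eq_right h1, max_eq_right (one_le_pow₀ h1)]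
    · rw [max_eq_left h1, max_eq_left (pow_le_one₀ hv.le h1), one_pow]
  rw [e2, hη, hZ, norm_mul, norm_mul, norm_pow, norm_pow]
  have hb1 : ‖ξ‖ ^ r * ((w - 1) ^ 2 / max 1 w) ≤ h ^ 2 / (max 1 v * ‖ξ‖) ^ r := by
    rw [mul_pow, hZr, ← mul_div_assoc, div_le_div_iff₀ (by positivity) (by positivity)]
    have : (‖ξ‖ ^ r * |w - 1|) ^ 2 ≤ h ^ 2 := by gcongr
    calc ‖ξ‖ ^ r * (w - 1) ^ 2 * (max 1 w * ‖ξ‖ ^ r) = (‖ξ‖ ^ r * |w - 1|) ^ 2 * max 1 w := by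
          rw [mul_pow, sq_abs]; ring
      _ ≤ _ := by gcongr
  have hb2 : ‖ξ‖ * |v - 1| ≤ h / (max 1 v * ‖ξ‖) ^ (r - 1) := by
    rw [le_div_iff₀ (by positivity)]
    refine le_trans ?_ hF'
    have hpow : ‖ξ‖ ^ r = ‖ξ‖ * ‖ξ‖ ^ (r - 1) := by rw [← pow_succ']; congr 1; omega
    have hm : |v - 1| * max 1 v ^ (r - 1) ≤ |w - 1| := by
      rcases le_total 1 v with h1 | h1
      · rw [max_eq_right h1, abs_of_nonneg (by linarith),
          abs_of_nonneg (by linarith [one_le_pow₀ h1 (n := r)])]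
        simpa using sub_mul_pow_le_pow_sub_pow zero_le_one h1 (by omega : 1 ≤ r)
      · rw [max_eq_left h1, abs_of_nonpos (by linarith),
          abs_of_nonpos (by linarith [pow_le_one₀ hv.le h1 (n := r)])]
        have := sub_mul_pow_le_pow_sub_pow hv.le h1 (by omega : 1 ≤ r)
        simp only [one_pow] at this ⊢; linarith
    rw [mul_pow, hpow]
    calc ‖ξ‖ * |v - 1| * (max 1 v ^ (r - 1) * ‖ξ‖ ^ (r - 1)) =
        ‖ξ‖ * ‖ξ‖ ^ (r - 1) * (|v - 1| * max 1 v ^ (r - 1)) := by ring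
      _ ≤ _ := by gcongr
  calc _ ≤ ‖ξ‖ * (‖ξ‖ ^ r) ^ n * (|v - 1| * ((w - 1) ^ 2 / max 1 w) ^ n) := by gcongr
    _ = (‖ξ‖ ^ r * ((w - 1) ^ 2 / max 1 w)) ^ n * (‖ξ‖ * |v - 1|) := by
      rw [mul_pow (‖ξ‖ ^ r)]; ring
    _ ≤ _ := by gcongr

theorem padeClose_of_arc {r : ℕ} (hr : 2 ≤ r) {h φ : ℝ} {ω ξ : ℂ} (hω : ω ^ r = 1)
    (hφ : |φ| ≤ Real.pi / r) (hξ : ξ ≠ 0)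
    (hF : ‖ξ ^ r - (ω * Complex.exp (φ * Complex.I) * ξ) ^ r‖ ≤ h) :
    PadeClose r h ω ξ (ω * Complex.exp (φ * Complex.I) * ξ) := by
  intro n
  have hω0 : ω ≠ 0 := by
    rintro rfl
    rw [zero_pow (by omega)] at hω; exact zero_ne_one hω
  have hωn : ‖ω‖ = 1 := Complex.norm_eq_one_of_pow_eq_one hω (by omega)
  have key := norm_padeForm_sub_le_of_arc hr n φ hφ
  have key2 := abs_le_norm_one_sub_exp hr φ hφ
  set w := Complex.exp ((φ * r : ℝ) * Complex.I) with hw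
  set v := Complex.exp (φ * Complex.I) with hv
  have hvw : v ^ r = w := by
    rw [hv, ← Complex.exp_nat_mul, hw]; congr 1; push_cast; ring
  have e1 : (ω * v * ξ) ^ r = ξ ^ r * w := by
    rw [mul_pow, mul_pow, hω, hvw]; ring
  have e2 : ξ * padeForm r n (ξ ^ r) ((ω * v * ξ) ^ r) -
      ω⁻¹ * (ω * v * ξ) * padeForm r n ((ω * v * ξ) ^ r) (ξ ^ r) =
      ξ * (ξ ^ r) ^ n * (padeForm r n 1 w - v * padeForm r n w 1) := by
    have a1 := padeForm_smul r n (ξ ^ r) 1 w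
    have a2 := padeForm_smul r n (ξ ^ r) w 1
    rw [mul_one] at a1 a2
    rw [e1, a1, a2]
    field_simp
  have hξn : 0 < ‖ξ‖ := norm_pos_iff.2 hξ
  have hη : ‖ω * v * ξ‖ = ‖ξ‖ := by
    rw [norm_mul, norm_mul, hωn, hv, Complex.norm_exp_ofReal_mul_I, one_mul, one_mul]
  have hF' : ‖ξ‖ ^ r * ‖1 - w‖ ≤ h := by
    have : ξ ^ r - (ω * v * ξ) ^ r = ξ ^ r * (1 - w) := by rw [e1]; ring
    rwa [this, norm_mul, norm_pow] at hF
  rw [e2, hη, max_self, norm_mul, norm_mul, norm_pow, norm_pow]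
  have hb1 : ‖ξ‖ ^ r * ‖1 - w‖ ^ 2 ≤ h ^ 2 / ‖ξ‖ ^ r := by
    rw [le_div_iff₀ (by positivity)]
    calc _ = (‖ξ‖ ^ r * ‖1 - w‖) ^ 2 := by ring
      _ ≤ _ := by gcongr
  have hb2 : ‖ξ‖ * |φ| ≤ h / ‖ξ‖ ^ (r - 1) := by
    rw [le_div_iff₀ (by positivity)]
    have hpow : ‖ξ‖ ^ r = ‖ξ‖ * ‖ξ‖ ^ (r - 1) := by rw [← pow_succ']; congr 1; omega
    calc _ = ‖ξ‖ ^ r * |φ| := by rw [hpow]; ring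
      _ ≤ ‖ξ‖ ^ r * ‖1 - w‖ := by gcongr
      _ ≤ _ := hF'
  calc _ ≤ ‖ξ‖ * (‖ξ‖ ^ r) ^ n * (|φ| * (‖1 - w‖ ^ 2) ^ n) := by gcongr
    _ = (‖ξ‖ ^ r * ‖1 - w‖ ^ 2) ^ n * (‖ξ‖ * |φ|) := by
      rw [mul_pow (‖ξ‖ ^ r)]; ring
    _ ≤ _ := by gcongr

/-! ### Independence of consecutive Padé approximants. -/

/-- A one-sided estimate is enough: it forces `p(1) = 0` by continuity, and dividing by `X - 1`
lowers the order by one. -/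
theorem X_sub_one_pow_dvd_of_abs_eval_le (k : ℕ) (c : ℝ) (p : Polynomial ℝ)
    (hp : ∀ w : ℝ, 1 < w → w < 2 → |p.eval w| ≤ c * (w - 1) ^ k) :
    (Polynomial.X - Polynomial.C 1) ^ k ∣ p := by
  induction k generalizing p with
  | zero => simp
  | succ k ih =>
    have hmem : Set.Ioo (1 : ℝ) 2 ∈ nhdsWithin (1 : ℝ) (Set.Ioi 1) := Ioo_mem_nhdsGT (by norm_num)
    have hroot : p.eval 1 = 0 := by
      have h1 : Filter.Tendsto (fun w : ℝ => p.eval w) (nhdsWithin 1 (Set.Ioi 1)) (nhds (p.eval 1)) :=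
        (p.continuous.tendsto 1).mono_left nhdsWithin_le_nhds
      have h2 : Filter.Tendsto (fun w : ℝ => c * (w - 1) ^ (k + 1)) (nhdsWithin 1 (Set.Ioi 1))
          (nhds 0) := by
        have : Continuous fun w : ℝ => c * (w - 1) ^ (k + 1) := by fun_prop
        simpa using (this.tendsto 1).mono_left (nhdsWithin_le_nhds (s := Set.Ioi 1))
      have h3 : Filter.Tendsto (fun w : ℝ => p.eval w) (nhdsWithin 1 (Set.Ioi 1)) (nhds 0) := by
        refine squeeze_zero_norm' ?_ h2
        filter_upwards [hmem] with w hw using hp w hw.1 hw.2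
      exact tendsto_nhds_unique h1 h3
    obtain ⟨q, rfl⟩ := Polynomial.dvd_iff_isRoot.2 hroot
    rw [pow_succ']
    refine mul_dvd_mul_left _ (ih q fun w h1 h2 => ?_)
    have h3 := hp w h1 h2
    have h4 : 0 < w - 1 := by linarith
    rw [Polynomial.eval_mul, abs_mul] at h3
    simp only [Polynomial.eval_sub, Polynomial.eval_X, Polynomial.eval_C, abs_of_pos h4] at h3
    rw [pow_succ'] at h3
    refine le_of_mul_le_mul_left ?_ h4
    linarith

/-- The polynomial `∑ j, padeCoeff r n j * X ^ (n - j)`. -/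
noncomputable def padeNum (r n : ℕ) : Polynomial ℝ :=
  ∑ j ∈ Finset.range (n + 1), Polynomial.C (padeCoeff r n j) * Polynomial.X ^ (n - j)

/-- The polynomial `∑ j, padeCoeff r n j * X ^ j`. -/
noncomputable def padeDen (r n : ℕ) : Polynomial ℝ :=
  ∑ j ∈ Finset.range (n + 1), Polynomial.C (padeCoeff r n j) * Polynomial.X ^ j

theorem natDegree_padeNum_le (r n : ℕ) : (padeNum r n).natDegree ≤ n :=
  Polynomial.natDegree_sum_le_of_forall_le _ _ fun _ _ =>
    (Polynomial.natDegree_C_mul_X_pow_le _ _).trans (Nat.sub_le _ _)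

theorem natDegree_padeDen_le (r n : ℕ) : (padeDen r n).natDegree ≤ n :=
  Polynomial.natDegree_sum_le_of_forall_le _ _ fun j hj =>
    (Polynomial.natDegree_C_mul_X_pow_le _ _).trans (by simpa [Nat.lt_succ_iff] using hj)

theorem coeff_padeNum (r n : ℕ) : (padeNum r n).coeff n = padeCoeff r n 0 := by
  unfold padeNum
  rw [Polynomial.finsetSum_coeff, Finset.sum_eq_single 0]
  · simp
  · intro j hj hj0
    have : j ≤ n := by simpa [Nat.lt_succ_iff] using hj
    rw [Polynomial.coeff_C_mul_X_pow, if_neg (by omega)]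
  · simp

theorem coeff_padeDen (r n : ℕ) : (padeDen r n).coeff n = padeCoeff r n n := by
  unfold padeDen
  rw [Polynomial.finsetSum_coeff, Finset.sum_eq_single n]
  · simp
  · intro j hj hj0
    rw [Polynomial.coeff_C_mul_X_pow, if_neg (by omega)]
  · simp

theorem aeval_padeNum (r n : ℕ) (w : ℂ) : Polynomial.aeval w (padeNum r n) = padeForm r n 1 w := by
  simp [padeNum, padeForm]

theorem aeval_padeDen (r n : ℕ) (w : ℂ) : Polynomial.aeval w (padeDen r n) = padeForm r n w 1 := by
  simp [padeDen, padeForm]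

/-- The cross determinant of two consecutive Padé approximants. -/
noncomputable def padeCross (r n : ℕ) : Polynomial ℝ :=
  padeNum r n * padeDen r (n + 1) - padeNum r (n + 1) * padeDen r n

theorem natDegree_padeCross_le (r n : ℕ) : (padeCross r n).natDegree ≤ 2 * n + 1 := by
  unfold padeCross
  refine (Polynomial.natDegree_sub_le _ _).trans (max_le ?_ ?_)
  · refine Polynomial.natDegree_mul_le.trans ?_
    linarith [natDegree_padeNum_le r n, natDegree_padeDen_le r (n + 1)]
  · refine Polynomial.natDegree_mul_le.trans ?_
    linarith [natDegree_padeNum_le r (n + 1), natDegree_padeDen_le r n]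

/-- The coefficient of degree `2 n + 1` is a negative multiple of `2 / r`: the two products of
extreme coefficients differ only in `n + 1 - 1/r` against `n + 1 + 1/r`. -/
theorem padeCross_ne_zero {r : ℕ} (hr : 2 ≤ r) (n : ℕ) : padeCross r n ≠ 0 := by
  intro h
  have hc : (padeCross r n).coeff (2 * n + 1) = 0 := by rw [h]; simp
  have hr1 : (1 : ℝ) / r < 1 := by
    rw [div_lt_one (by positivity)]; exact_mod_cast hr
  have h1 := Polynomial.coeff_mul_add_eq_of_natDegree_le (natDegree_padeNum_le r n)
    (natDegree_padeDen_le r (n + 1))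
  have h2 := Polynomial.coeff_mul_add_eq_of_natDegree_le (natDegree_padeNum_le r (n + 1))
    (natDegree_padeDen_le r n)
  rw [padeCross, Polynomial.coeff_sub, show 2 * n + 1 = n + (n + 1) by ring, h1,
    show n + (n + 1) = n + 1 + n by ring, h2, coeff_padeNum, coeff_padeNum, coeff_padeDen,
    coeff_padeDen] at hc
  have hU : (0 : ℝ) < ∏ i ∈ Finset.range n, (((i + 1 : ℕ) : ℝ) - 1 / r) :=
    Finset.prod_pos fun i _ => by
      push_cast; have : (0 : ℝ) ≤ i := by positivity
      linarith
  have hV : (0 : ℝ) < ∏ i ∈ Finset.range n, (((i + 1 : ℕ) : ℝ) + 1 / r) :=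
    Finset.prod_pos fun i _ => by positivity
  simp only [padeCoeff, Nat.sub_self, Nat.sub_zero, Finset.range_zero, Finset.prod_empty,
    Nat.factorial_zero, Nat.cast_one, div_one, one_mul, mul_one, zero_add, Finset.prod_range_succ,
    Nat.factorial_succ] at hc
  set U := ∏ i ∈ Finset.range n, (((i + 1 : ℕ) : ℝ) - 1 / r)
  set V := ∏ i ∈ Finset.range n, (((i + 1 : ℕ) : ℝ) + 1 / r)
  have hf : (n.factorial : ℝ) ≠ 0 := by positivity
  have hn : (n : ℝ) + 1 ≠ 0 := by positivity
  have hr0 : (r : ℝ) ≠ 0 := by positivity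
  push_cast at hc
  have : V / n.factorial * (U * ((n : ℝ) + 1 - 1 / r) / ((n + 1) * n.factorial)) -
      V * ((n : ℝ) + 1 + 1 / r) / ((n + 1) * n.factorial) * (U / n.factorial) =
      -(U * V * (2 / r) / ((n + 1) * n.factorial ^ 2)) := by
    field_simp; ring
  rw [this, neg_eq_zero] at hc
  have : 0 < U * V * (2 / r) / ((n + 1) * (n.factorial : ℝ) ^ 2) := by positivity
  linarith

/-- Numerator and denominator of degree `k` satisfy `num - v * den = O((w - 1) ^ (2 k + 1))` with `v
= w ^ (1/r)`; eliminating `v` between `n` and `n + 1` leaves order `2 n + 1`. The powers of `8`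
bound the denominators on `1 < w < 2`. -/
theorem X_sub_one_pow_dvd_padeCross {r : ℕ} (hr : 2 ≤ r) (n : ℕ) :
    (Polynomial.X - Polynomial.C 1) ^ (2 * n + 1) ∣ padeCross r n := by
  refine X_sub_one_pow_dvd_of_abs_eval_le _ (8 ^ (n + 1) + 8 ^ n) _ fun w h1 h2 => ?_
  have hw0 : 0 < w := by linarith
  set μ := Real.log w / r with hμ
  have hr0 : (r : ℝ) ≠ 0 := by positivity
  have hexp : Real.exp (μ * r) = w := by
    rw [hμ, div_mul_cancel₀ _ hr0, Real.exp_log hw0]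
  set v := Real.exp μ with hv
  have hvw : v ^ r = w := by rw [hv, ← Real.exp_nat_mul, mul_comm, hexp]
  have hv1 : 1 ≤ v := by
    by_contra hlt
    have := pow_le_one₀ (Real.exp_pos μ).le (not_le.1 hlt).le (n := r)
    rw [← hv, hvw] at this
    linarith
  have hvw' : v ≤ w := by rw [← hvw]; exact le_self_pow₀ hv1 (by omega)
  have hbound : ∀ k, |(padeNum r k).eval w - v * (padeDen r k).eval w| ≤ (w - 1) ^ (2 * k + 1) := by
    intro k
    have h3 := norm_padeForm_sub_le_of_real hr k μ
    rw [hexp, ← hv, ← aeval_padeNum, ← aeval_padeDen] at h3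
    have e1 : ∀ p : Polynomial ℝ, Polynomial.aeval (w : ℂ) p = ((p.eval w : ℝ) : ℂ) := fun p =>
      Polynomial.aeval_algebraMap_apply_eq_algebraMap_eval w p
    rw [e1, e1, ← Complex.ofReal_mul, ← Complex.ofReal_sub, Complex.norm_real,
      Real.norm_eq_abs] at h3
    refine h3.trans ?_
    rw [abs_of_nonneg (by linarith), max_eq_right h1.le,
      show (w - 1) ^ (2 * k + 1) = (w - 1) * ((w - 1) ^ 2) ^ k by rw [← pow_mul, pow_succ']]
    have h4 : (w - 1) ^ 2 / w ≤ (w - 1) ^ 2 := div_le_self (by positivity) h1.le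
    have h5 : 0 ≤ w - 1 := by linarith
    gcongr
  have hden : ∀ k, |(padeDen r k).eval w| ≤ 8 ^ k := by
    intro k
    have h3 := norm_padeForm_le (r := r) (by omega) k (X := (w : ℂ)) (Y := 1) (Z := 2)
      (by rw [Complex.norm_real, Real.norm_of_nonneg hw0.le]; exact h2.le) (by simp)
    have e1 : Polynomial.aeval (w : ℂ) (padeDen r k) = (((padeDen r k).eval w : ℝ) : ℂ) :=
      Polynomial.aeval_algebraMap_apply_eq_algebraMap_eval w _
    rw [← aeval_padeDen, e1, Complex.norm_real, Real.norm_eq_abs, ← mul_pow] at h3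
    norm_num at h3
    exact h3
  have e : (padeCross r n).eval w =
      ((padeNum r n).eval w - v * (padeDen r n).eval w) * (padeDen r (n + 1)).eval w -
      ((padeNum r (n + 1)).eval w - v * (padeDen r (n + 1)).eval w) * (padeDen r n).eval w := by
    simp only [padeCross, Polynomial.eval_sub, Polynomial.eval_mul]; ring
  have h5 : 0 ≤ w - 1 := by linarith
  have h6 : (w - 1) ^ (2 * (n + 1) + 1) ≤ (w - 1) ^ (2 * n + 1) :=
    pow_le_pow_of_le_one h5 (by linarith) (by omega)
  rw [e]
  calc _ ≤ (w - 1) ^ (2 * n + 1) * 8 ^ (n + 1) + (w - 1) ^ (2 * (n + 1) + 1) * 8 ^ n := by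
        refine (abs_sub _ _).trans ?_
        rw [abs_mul, abs_mul]
        gcongr
        · exact hbound n
        · exact hden (n + 1)
        · exact hbound (n + 1)
        · exact hden n
    _ ≤ (w - 1) ^ (2 * n + 1) * 8 ^ (n + 1) + (w - 1) ^ (2 * n + 1) * 8 ^ n := by gcongr
    _ = _ := by ring

/-- The vanishing order at `1` equals the degree bound, so the cross determinant is a nonzero
constant times `(w - 1) ^ (2 n + 1)` and vanishes only at `w = 1`. -/
theorem padeForm_cross_ne_zero {r : ℕ} (hr : 2 ≤ r) (n : ℕ) {X Y : ℂ} (hX : X ≠ 0) (hXY : X ≠ Y) :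
    padeForm r n X Y * padeForm r (n + 1) Y X - padeForm r (n + 1) X Y * padeForm r n Y X ≠ 0 := by
  obtain ⟨q, hq⟩ := X_sub_one_pow_dvd_padeCross hr n
  have hne := padeCross_ne_zero hr n
  have hq0 : q ≠ 0 := by rintro rfl; rw [mul_zero] at hq; exact hne hq
  have hdeg : q.natDegree = 0 := by
    have h1 := natDegree_padeCross_le r n
    rw [hq, Polynomial.Monic.natDegree_mul' ((Polynomial.monic_X_sub_C 1).pow _) hq0,
      Polynomial.natDegree_pow, Polynomial.natDegree_X_sub_C] at h1
    omega
  obtain ⟨c, rfl⟩ := Polynomial.natDegree_eq_zero.1 hdeg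
  have hc : c ≠ 0 := by rintro rfl; simp at hq0
  obtain ⟨w, rfl⟩ : ∃ w, Y = X * w := ⟨Y / X, by field_simp⟩
  have hw : w ≠ 1 := by rintro rfl; simp at hXY
  have e : ∀ k, padeForm r k X (X * w) = X ^ k * padeForm r k 1 w := fun k => by
    simpa using padeForm_smul r k X 1 w
  have e' : ∀ k, padeForm r k (X * w) X = X ^ k * padeForm r k w 1 := fun k => by
    simpa using padeForm_smul r k X w 1
  have h2 : padeForm r n 1 w * padeForm r (n + 1) w 1 - padeForm r (n + 1) 1 w * padeForm r n w 1 =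
      (w - 1) ^ (2 * n + 1) * c := by
    have := congrArg (Polynomial.aeval w) hq
    simpa [padeCross, aeval_padeNum, aeval_padeDen] using this
  have h3 : padeForm r n X (X * w) * padeForm r (n + 1) (X * w) X -
      padeForm r (n + 1) X (X * w) * padeForm r n (X * w) X =
      X ^ n * X ^ (n + 1) * ((w - 1) ^ (2 * n + 1) * c) := by
    rw [← h2, e, e, e', e']; ring
  rw [h3]
  have := sub_ne_zero.2 hw
  have hcc : (c : ℂ) ≠ 0 := by exact_mod_cast hc
  positivity

/-! ### Two close solutions: gap principle and contradiction. -/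

/-- The choice of the degree of the Padé approximants. -/
theorem exists_pade_degree {r : ℕ} (hr : 5 ≤ r) {h a W Z Z' : ℝ} (hh : 1 ≤ h) (ha : 0 < a)
    (hah : h ^ 2 < a ^ r) (hW : 1 ≤ W) (hZ : 0 < Z)
    (hgap : a * Z ^ (r - 1) ≤ h * Z') (hbig : 16 * W ^ 2 * h ^ 3 ≤ Z ^ r) :
    ∃ n : ℕ, ∀ k, k = n ∨ k = n + 1 → (4 * W) ^ k * h * Z ^ (r * k + 1) < a * Z' ^ (r - 1) ∧
      (W * h ^ 2) ^ k * h * Z' < a * Z ^ (r * k + (r - 1)) := by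
  obtain ⟨s, rfl⟩ := Nat.exists_eq_add_of_le' hr
  rw [show s + 5 - 1 = s + 4 by omega] at *
  set Q := Z ^ (s + 5) with hQ
  have hW0 : 0 < W := by linarith
  have hh0 : 0 < h := by linarith
  have hQ0 : 0 < Q := by positivity
  have hWh : 2 * (W * h ^ 2) ≤ Q := by
    refine le_trans ?_ hbig
    have h1 : W * h ^ 2 * 1 ≤ W * h ^ 2 * (W * h) := by
      gcongr; nlinarith
    nlinarith
  -- The second inequality holds for large `n`, and the least such `n` is taken. It is not `0`, by
  -- the gap; failure at its predecessor `k` bounds `Z'` from below, which yields the first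
  -- inequality up to degree `k + 2`.
  have hex : ∃ n : ℕ, (W * h ^ 2) ^ n * h * Z' < a * Z ^ ((s + 5) * n + (s + 4)) := by
    obtain ⟨n, hn⟩ := pow_unbounded_of_one_lt (h * Z' / (a * Z ^ (s + 4))) one_lt_two
    refine ⟨n, ?_⟩
    rw [div_lt_iff₀ (by positivity)] at hn
    calc (W * h ^ 2) ^ n * h * Z' = (W * h ^ 2) ^ n * (h * Z') := by ring
      _ < (W * h ^ 2) ^ n * (2 ^ n * (a * Z ^ (s + 4))) := by gcongr
      _ = (2 * (W * h ^ 2)) ^ n * (a * Z ^ (s + 4)) := by rw [mul_pow]; ring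
      _ ≤ Q ^ n * (a * Z ^ (s + 4)) := by gcongr
      _ = _ := by rw [hQ, ← pow_mul, pow_add]; ring
  classical
  have hfind := Nat.find_spec hex
  have hmin := fun k => Nat.find_min hex (m := k)
  rcases hN : Nat.find hex with _ | k
  · rw [hN] at hfind
    simp only [pow_zero, one_mul, mul_zero, zero_add] at hfind
    linarith
  rw [hN] at hfind hmin
  have hk := not_lt.1 (hmin k (Nat.lt_succ_self k))
  have hZ1 : 1 ≤ Z := by
    by_contra hlt
    have h1 : Q ≤ 1 := pow_le_one₀ hZ.le (not_le.1 hlt).le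
    have h2 : 1 ≤ W * h ^ 2 := one_le_mul_of_one_le_of_one_le hW (one_le_pow₀ hh)
    linarith
  have hI : (4 * W) ^ (k + 2) * h * Z ^ ((s + 5) * (k + 2) + 1) < a * Z' ^ (s + 4) := by
    have hc : 0 < ((W * h ^ 2) ^ k * h) ^ (s + 4) := by positivity
    refine lt_of_mul_lt_mul_left ?_ hc.le
    -- `e` counts the powers of `Z ^ r` left over: with `r = s + 5`, `(r k + r - 1)(r - 1) = r e +
    -- (r (k + 2) + 1)`. They absorb the powers of `4`, `W` and `h`.
    set e := k * (s + 3) + s + 1 with he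
    have hQe : (4 * W) ^ (k + 2) * h ^ (s + 3) * (W * h ^ 2) ^ (k * (s + 4)) ≤ Q ^ e := by
      calc (4 * W) ^ (k + 2) * h ^ (s + 3) * (W * h ^ 2) ^ (k * (s + 4)) =
          4 ^ (k + 2) * W ^ (k + 2 + k * (s + 4)) * h ^ (s + 3 + 2 * (k * (s + 4))) := by
            rw [mul_pow, mul_pow, ← pow_mul, pow_add W, pow_add h]; ring
        _ ≤ 4 ^ (2 * e) * W ^ (2 * e) * h ^ (3 * e) := by
            gcongr
            · norm_num
            · rw [he]; nlinarith
            · rw [he]; nlinarith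
            · rw [he]; nlinarith
        _ = (16 * W ^ 2 * h ^ 3) ^ e := by
            rw [mul_pow, mul_pow, ← pow_mul, ← pow_mul, pow_mul]; norm_num
        _ ≤ Q ^ e := by gcongr
    calc ((W * h ^ 2) ^ k * h) ^ (s + 4) * ((4 * W) ^ (k + 2) * h * Z ^ ((s + 5) * (k + 2) + 1)) =
        h ^ 2 * ((4 * W) ^ (k + 2) * h ^ (s + 3) * (W * h ^ 2) ^ (k * (s + 4))) *
          Z ^ ((s + 5) * (k + 2) + 1) := by
          rw [mul_pow ((W * h ^ 2) ^ k), ← pow_mul]; ring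
      _ < a ^ (s + 5) * ((4 * W) ^ (k + 2) * h ^ (s + 3) * (W * h ^ 2) ^ (k * (s + 4))) *
          Z ^ ((s + 5) * (k + 2) + 1) := by gcongr
      _ ≤ a ^ (s + 5) * Q ^ e * Z ^ ((s + 5) * (k + 2) + 1) := by gcongr
      _ = a * (a * Z ^ ((s + 5) * k + (s + 4))) ^ (s + 4) := by
          rw [hQ, mul_pow, ← pow_mul, ← pow_mul, mul_assoc (a ^ (s + 5)), ← pow_add,
            pow_succ a (s + 4)]
          have : (s + 5) * e + ((s + 5) * (k + 2) + 1) = ((s + 5) * k + (s + 4)) * (s + 4) := by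
            rw [he]; ring
          rw [this]; ring
      _ ≤ a * ((W * h ^ 2) ^ k * h * Z') ^ (s + 4) := by gcongr
      _ = _ := by rw [mul_pow ((W * h ^ 2) ^ k * h)]; ring
  refine ⟨k + 1, fun i hi => ?_⟩
  rcases hi with rfl | rfl
  · refine ⟨lt_of_le_of_lt ?_ hI, hfind⟩
    gcongr
    · linarith
    · omega
    · omega
  · refine ⟨hI, ?_⟩
    calc (W * h ^ 2) ^ (k + 1 + 1) * h * Z' = (W * h ^ 2) * ((W * h ^ 2) ^ (k + 1) * h * Z') := by ring
      _ < (W * h ^ 2) * (a * Z ^ ((s + 5) * (k + 1) + (s + 4))) := by gcongr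
      _ ≤ Q * (a * Z ^ ((s + 5) * (k + 1) + (s + 4))) := by
          gcongr
          have : 0 < W * h ^ 2 := by positivity
          linarith
      _ = _ := by rw [hQ]; ring

theorem padeForm_zero (r : ℕ) (X Y : ℂ) : padeForm r 0 X Y = 1 := by
  simp [padeForm, padeCoeff]

theorem PadeClose.norm_sub_le {r : ℕ} {h : ℝ} {ω ξ η : ℂ} (hω : ‖ω‖ = 1)
    (hc : PadeClose r h ω ξ η) : ‖η - ω * ξ‖ ≤ h / max ‖ξ‖ ‖η‖ ^ (r - 1) := by
  have hω0 : ω ≠ 0 := by rintro rfl; simp at hω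
  have h1 := hc 0
  simp only [padeForm_zero, mul_one, pow_zero, one_mul] at h1
  have h2 : η - ω * ξ = -ω * (ξ - ω⁻¹ * η) := by field_simp; ring
  rwa [h2, norm_mul, norm_neg, hω, one_mul]

/-- The form `η₂ ξ₁ P(ξ₁ ^ r, η₁ ^ r) - η₁ ξ₂ P(η₁ ^ r, ξ₁ ^ r)`. -/
noncomputable def padeLambda (r n : ℕ) (ξ₁ η₁ ξ₂ η₂ : ℂ) : ℂ :=
  η₂ * ξ₁ * padeForm r n (ξ₁ ^ r) (η₁ ^ r) - η₁ * ξ₂ * padeForm r n (η₁ ^ r) (ξ₁ ^ r)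

/-- Substituting `η₂ = ω ξ₂ + (η₂ - ω ξ₂)` splits the form into the Padé remainder at the first
solution, times `ω ξ₂`, and the approximation error at the second, times a Padé polynomial. -/
theorem norm_padeLambda_le {r : ℕ} (hr : 1 ≤ r) (n : ℕ) {h : ℝ} (hh : 0 ≤ h) {ω ξ₁ η₁ ξ₂ η₂ : ℂ}
    (hω : ‖ω‖ = 1) (h1 : PadeClose r h ω ξ₁ η₁) (h2 : PadeClose r h ω ξ₂ η₂) :
    ‖padeLambda r n ξ₁ η₁ ξ₂ η₂‖ ≤
      max ‖ξ₂‖ ‖η₂‖ * ((h ^ 2 / max ‖ξ₁‖ ‖η₁‖ ^ r) ^ n * (h / max ‖ξ₁‖ ‖η₁‖ ^ (r - 1))) +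
      h / max ‖ξ₂‖ ‖η₂‖ ^ (r - 1) * max ‖ξ₁‖ ‖η₁‖ *
        (4 ^ n * (max ‖ξ₁‖ ‖η₁‖ ^ r) ^ n) := by
  have hω0 : ω ≠ 0 := by rintro rfl; simp at hω
  have e : padeLambda r n ξ₁ η₁ ξ₂ η₂ =
      ω * ξ₂ * (ξ₁ * padeForm r n (ξ₁ ^ r) (η₁ ^ r) - ω⁻¹ * η₁ * padeForm r n (η₁ ^ r) (ξ₁ ^ r)) +
      (η₂ - ω * ξ₂) * ξ₁ * padeForm r n (ξ₁ ^ r) (η₁ ^ r) := by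
    unfold padeLambda; field_simp; ring
  have h3 : ‖padeForm r n (ξ₁ ^ r) (η₁ ^ r)‖ ≤ 4 ^ n * (max ‖ξ₁‖ ‖η₁‖ ^ r) ^ n := by
    refine norm_padeForm_le hr n ?_ ?_ <;> rw [norm_pow] <;> gcongr
    · exact le_max_left _ _
    · exact le_max_right _ _
  rw [e]
  refine (norm_add_le _ _).trans ?_
  rw [norm_mul, norm_mul, norm_mul, norm_mul, hω, one_mul]
  gcongr
  · exact le_max_left _ _
  · exact h1 n
  · exact h2.norm_sub_le hω
  · exact le_max_left _ _

/-- For two consecutive degrees the upper bound, scaled by `W ^ n`, is below `2 a`, so both values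
of `padeLambda` vanish; eliminating `ξ₂` contradicts the nonvanishing cross determinant. -/
theorem padeClose_pair_false {r : ℕ} (hr : 5 ≤ r) {h a W : ℝ} (hh : 1 ≤ h) (ha : 0 < a)
    (hah : h ^ 2 < a ^ r) (hW : 1 ≤ W) {ω ξ₁ η₁ ξ₂ η₂ : ℂ} (hω : ‖ω‖ = 1)
    (h1 : PadeClose r h ω ξ₁ η₁) (h2 : PadeClose r h ω ξ₂ η₂)
    (hξ₁ : ξ₁ ≠ 0) (hη₂ : η₂ ≠ 0) (hne : ξ₁ ^ r ≠ η₁ ^ r)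
    (hgap : a * max ‖ξ₁‖ ‖η₁‖ ^ (r - 1) ≤ h * max ‖ξ₂‖ ‖η₂‖)
    (hbig : 16 * W ^ 2 * h ^ 3 ≤ max ‖ξ₁‖ ‖η₁‖ ^ r)
    (hint : ∀ n, padeLambda r n ξ₁ η₁ ξ₂ η₂ ≠ 0 →
      2 * a ≤ W ^ n * ‖padeLambda r n ξ₁ η₁ ξ₂ η₂‖) : False := by
  set Z := max ‖ξ₁‖ ‖η₁‖ with hZ
  set Z' := max ‖ξ₂‖ ‖η₂‖ with hZ'
  have hZ0 : 0 < Z := lt_of_lt_of_le (norm_pos_iff.2 hξ₁) (le_max_left _ _)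
  have hW0 : 0 < W := by linarith
  obtain ⟨n, hn⟩ := exists_pade_degree hr hh ha hah hW hZ0 hgap hbig
  have hzero : ∀ k, k = n ∨ k = n + 1 → padeLambda r k ξ₁ η₁ ξ₂ η₂ = 0 := by
    intro k hk
    by_contra hne0
    have h3 := hint k hne0
    obtain ⟨hI, hII⟩ := hn k hk
    have h4 := norm_padeLambda_le (by omega : 1 ≤ r) k (by linarith) hω h1 h2
    rw [← hZ, ← hZ'] at h4
    have hT2 : W ^ k * (Z' * ((h ^ 2 / Z ^ r) ^ k * (h / Z ^ (r - 1)))) < a := by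
      have : W ^ k * (Z' * ((h ^ 2 / Z ^ r) ^ k * (h / Z ^ (r - 1)))) =
          (W * h ^ 2) ^ k * h * Z' / Z ^ (r * k + (r - 1)) := by
        rw [div_pow, pow_add, pow_mul, mul_pow]; field_simp
      rw [this, div_lt_iff₀ (by positivity)]
      exact hII
    have hT1 : W ^ k * (h / Z' ^ (r - 1) * Z * (4 ^ k * (Z ^ r) ^ k)) < a := by
      have : W ^ k * (h / Z' ^ (r - 1) * Z * (4 ^ k * (Z ^ r) ^ k)) =
          (4 * W) ^ k * h * Z ^ (r * k + 1) / Z' ^ (r - 1) := by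
        rw [pow_add, pow_mul, mul_pow]; field_simp
      rw [this, div_lt_iff₀ (by positivity)]
      exact hI
    have h5 := mul_le_mul_of_nonneg_left h4 (by positivity : 0 ≤ W ^ k)
    rw [mul_add] at h5
    linarith
  have hcross := padeForm_cross_ne_zero (by omega : 2 ≤ r) n (pow_ne_zero r hξ₁) hne
  have e0 := hzero n (Or.inl rfl)
  have e1 := hzero (n + 1) (Or.inr rfl)
  unfold padeLambda at e0 e1
  have : η₂ * ξ₁ * (padeForm r n (ξ₁ ^ r) (η₁ ^ r) * padeForm r (n + 1) (η₁ ^ r) (ξ₁ ^ r) -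
      padeForm r (n + 1) (ξ₁ ^ r) (η₁ ^ r) * padeForm r n (η₁ ^ r) (ξ₁ ^ r)) = 0 := by
    linear_combination padeForm r (n + 1) (η₁ ^ r) (ξ₁ ^ r) * e0 -
      padeForm r n (η₁ ^ r) (ξ₁ ^ r) * e1
  exact mul_ne_zero (mul_ne_zero hη₂ hξ₁) hcross this

/-- This is degree `0`, where `padeLambda` is the determinant of the two points and, since `Z ≤ Z'`,
the second term of its bound is at most the first. -/
theorem padeClose_gap {r : ℕ} (hr : 1 ≤ r) {h a : ℝ} (hh : 0 ≤ h) {ω ξ₁ η₁ ξ₂ η₂ : ℂ}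
    (hω : ‖ω‖ = 1) (h1 : PadeClose r h ω ξ₁ η₁) (h2 : PadeClose r h ω ξ₂ η₂) (hξ₁ : ξ₁ ≠ 0)
    (hle : max ‖ξ₁‖ ‖η₁‖ ≤ max ‖ξ₂‖ ‖η₂‖) (hdet : 2 * a ≤ ‖ξ₁ * η₂ - ξ₂ * η₁‖) :
    a * max ‖ξ₁‖ ‖η₁‖ ^ (r - 1) ≤ h * max ‖ξ₂‖ ‖η₂‖ := by
  have h3 := norm_padeLambda_le hr 0 hh hω h1 h2
  have e : padeLambda r 0 ξ₁ η₁ ξ₂ η₂ = ξ₁ * η₂ - ξ₂ * η₁ := by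
    simp only [padeLambda, padeForm_zero]; ring
  rw [e] at h3
  set Z := max ‖ξ₁‖ ‖η₁‖ with hZ
  set Z' := max ‖ξ₂‖ ‖η₂‖ with hZ'
  have hZ0 : 0 < Z := lt_of_lt_of_le (norm_pos_iff.2 hξ₁) (le_max_left _ _)
  simp only [pow_zero, one_mul, mul_one] at h3
  have h4 : h / Z' ^ (r - 1) * Z ≤ h / Z ^ (r - 1) * Z' := by gcongr
  have h5 : a ≤ h * Z' / Z ^ (r - 1) := by
    have : h / Z ^ (r - 1) * Z' = h * Z' / Z ^ (r - 1) := by ring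
    have h6 : Z' * (h / Z ^ (r - 1)) = h * Z' / Z ^ (r - 1) := by ring
    linarith
  rwa [le_div_iff₀ (by positivity)] at h5

/-! ### Arithmetic of the quadratic resolvent. -/

/-- A diagonalization of `F` together with a primitive integral quadratic form `(a, b, c)`
proportional to the product of the two linear forms; `s ^ 2` is its discriminant. -/
structure QuadResolvent (F : MvPolynomial (Fin 2) ℤ) (r : ℕ) where
  α : ℂ
  β : ℂ
  γ : ℂ
  δ : ℂ
  χ : ℂ
  s : ℂ
  a : ℤ
  b : ℤ
  c : ℤ
  diag : IsDiagonalization F r α β γ δ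
  mul_a : α * γ = χ * a
  mul_b : α * δ + β * γ = χ * b
  mul_c : β * δ = χ * c
  mul_s : s * χ = α * δ - β * γ
  coprime : ∃ u v w : ℤ, u * a + v * b + w * c = 1

theorem IsDiagonalization.eval_eq {F : MvPolynomial (Fin 2) ℤ} {r : ℕ} {α β γ δ : ℂ}
    (hd : IsDiagonalization F r α β γ δ) (x y : ℂ) :
    aeval ![x, y] F = (α * x + β * y) ^ r - (γ * x + δ * y) ^ r := by
  have h := congrArg (MvPolynomial.eval ![x, y]) hd.2
  rw [MvPolynomial.eval_map] at h
  simpa [linForm, MvPolynomial.aeval_def] using h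

theorem aeval_intCast_eq (G : MvPolynomial (Fin 2) ℤ) (x y : ℤ) :
    aeval ![(x : ℂ), (y : ℂ)] G = ((MvPolynomial.eval ![x, y] G : ℤ) : ℂ) := by
  have h := MvPolynomial.aeval_algebraMap_apply ℂ (![x, y] : Fin 2 → ℤ) G
  have e : (algebraMap ℤ ℂ ∘ ![x, y] : Fin 2 → ℂ) = ![(x : ℂ), (y : ℂ)] := by
    ext i; fin_cases i <;> simp
  rw [e] at h
  rw [h]
  simp

theorem aeval_realCast_eq (G : MvPolynomial (Fin 2) ℤ) (x y : ℝ) :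
    aeval ![(x : ℂ), (y : ℂ)] G = ((realVal G x y : ℝ) : ℂ) := by
  have h := MvPolynomial.aeval_algebraMap_apply ℂ (![x, y] : Fin 2 → ℝ) G
  have e : (algebraMap ℝ ℂ ∘ ![x, y] : Fin 2 → ℂ) = ![(x : ℂ), (y : ℂ)] := by
    ext i; fin_cases i <;> simp
  rw [e] at h
  rw [h]; rfl

theorem pderiv_zero_linForm (a b : ℂ) : pderiv 0 (linForm a b) = C a := by
  simp [linForm, pderiv_X]

theorem pderiv_one_linForm (a b : ℂ) : pderiv 1 (linForm a b) = C b := by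
  simp [linForm, pderiv_X]

theorem aeval_eq_eval_map (G : MvPolynomial (Fin 2) ℤ) (x y : ℂ) :
    aeval ![x, y] G = MvPolynomial.eval ![x, y] (MvPolynomial.map (Int.castRingHom ℂ) G) := by
  rw [MvPolynomial.eval_map, MvPolynomial.aeval_def]; rfl

theorem IsDiagonalization.aeval_pderiv_zero {F : MvPolynomial (Fin 2) ℤ} {r : ℕ} {α β γ δ : ℂ}
    (hd : IsDiagonalization F r α β γ δ) (x y : ℂ) :
    aeval ![x, y] (pderiv 0 F) =
      r * (α * (α * x + β * y) ^ (r - 1) - γ * (γ * x + δ * y) ^ (r - 1)) := by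
  rw [aeval_eq_eval_map, ← pderiv_map, hd.2, map_sub, pderiv_pow, pderiv_pow,
    pderiv_zero_linForm, pderiv_zero_linForm]
  simp [linForm]; ring

theorem IsDiagonalization.aeval_pderiv_one {F : MvPolynomial (Fin 2) ℤ} {r : ℕ} {α β γ δ : ℂ}
    (hd : IsDiagonalization F r α β γ δ) (x y : ℂ) :
    aeval ![x, y] (pderiv 1 F) =
      r * (β * (α * x + β * y) ^ (r - 1) - δ * (γ * x + δ * y) ^ (r - 1)) := by
  rw [aeval_eq_eval_map, ← pderiv_map, hd.2, map_sub, pderiv_pow, pderiv_pow,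
    pderiv_one_linForm, pderiv_one_linForm]
  simp [linForm]; ring

namespace QuadResolvent

variable {F : MvPolynomial (Fin 2) ℤ} {r : ℕ} (Q : QuadResolvent F r)

/-- The first linear form. -/
noncomputable def xi (x y : ℂ) : ℂ := Q.α * x + Q.β * y

/-- The second linear form. -/
noncomputable def eta (x y : ℂ) : ℂ := Q.γ * x + Q.δ * y

/-- The determinant of the two linear forms. -/
noncomputable def det : ℂ := Q.α * Q.δ - Q.β * Q.γ

/-- The discriminant of the quadratic form. -/
def disc : ℤ := Q.b ^ 2 - 4 * Q.a * Q.c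

theorem det_ne_zero : Q.det ≠ 0 := Q.diag.1

theorem chi_ne_zero : Q.χ ≠ 0 := fun h => Q.det_ne_zero (by
  rw [det, ← Q.mul_s, h, mul_zero])

theorem s_sq : Q.s ^ 2 = Q.disc := by
  have h := Q.chi_ne_zero
  have h2 : Q.χ ^ 2 * Q.s ^ 2 = Q.χ ^ 2 * Q.disc := by
    unfold disc; push_cast
    linear_combination (Q.s * Q.χ + (Q.α * Q.δ - Q.β * Q.γ)) * Q.mul_s +
      (Q.α * Q.δ + Q.β * Q.γ + Q.χ * Q.b) * Q.mul_b - 4 * Q.β * Q.δ * Q.mul_a -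
      4 * Q.χ * Q.a * Q.mul_c
  exact mul_left_cancel₀ (pow_ne_zero 2 h) h2

theorem s_ne_zero : Q.s ≠ 0 := fun h => Q.det_ne_zero (by
  rw [det, ← Q.mul_s, h, zero_mul])

theorem disc_ne_zero : Q.disc ≠ 0 := fun h => Q.s_ne_zero (by
  have := Q.s_sq
  rw [h] at this
  simpa using this)

theorem xi_mul_eta (x y : ℂ) :
    Q.xi x y * Q.eta x y = Q.χ * (Q.a * x ^ 2 + Q.b * (x * y) + Q.c * y ^ 2) := by
  unfold xi eta
  linear_combination x ^ 2 * Q.mul_a + x * y * Q.mul_b + y ^ 2 * Q.mul_c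

theorem aeval_eq (x y : ℂ) : aeval ![x, y] F = Q.xi x y ^ r - Q.eta x y ^ r := Q.diag.eval_eq x y

theorem eval_eq (x y : ℤ) :
    ((MvPolynomial.eval ![x, y] F : ℤ) : ℂ) = Q.xi x y ^ r - Q.eta x y ^ r := by
  rw [← aeval_intCast_eq, Q.aeval_eq]

theorem realVal_eq (x y : ℝ) : ((realVal F x y : ℝ) : ℂ) = Q.xi x y ^ r - Q.eta x y ^ r := by
  rw [← aeval_realCast_eq, Q.aeval_eq]

theorem xi_mul_eta_sub (x₁ y₁ x₂ y₂ : ℂ) :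
    Q.xi x₁ y₁ * Q.eta x₂ y₂ - Q.xi x₂ y₂ * Q.eta x₁ y₁ = Q.det * (x₁ * y₂ - x₂ * y₁) := by
  unfold xi eta det; ring

/-- The covariant `(b x + 2 c y) F_x - (2 a x + b y) F_y`. -/
theorem covariant_eq (hr : 1 ≤ r) (x y : ℂ) :
    (Q.b * x + 2 * Q.c * y) * aeval ![x, y] (pderiv 0 F) -
      (2 * Q.a * x + Q.b * y) * aeval ![x, y] (pderiv 1 F) =
      r * Q.s * (Q.xi x y ^ r + Q.eta x y ^ r) := by
  refine mul_left_cancel₀ Q.chi_ne_zero ?_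
  obtain ⟨k, rfl⟩ := Nat.exists_eq_add_of_le' hr
  rw [Q.diag.aeval_pderiv_zero, Q.diag.aeval_pderiv_one]
  simp only [Nat.add_sub_cancel, xi, eta, pow_succ]
  generalize (Q.α * x + Q.β * y) ^ k = U
  generalize (Q.γ * x + Q.δ * y) ^ k = V
  have ha := Q.mul_a
  have hb := Q.mul_b
  have hc := Q.mul_c
  have hs := Q.mul_s
  linear_combination ((k + 1 : ℕ) : ℂ) * (
    (2 * x * (Q.β * U - Q.δ * V)) * ha
    - (x * (Q.α * U - Q.γ * V) - y * (Q.β * U - Q.δ * V)) * hb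
    - 2 * y * (Q.α * U - Q.γ * V) * hc
    - (U * (Q.α * x + Q.β * y) + V * (Q.γ * x + Q.δ * y)) * hs)

/-- The difference of `ξ ^ r` and `η ^ r` is the value of `F`, and `r s` times their sum is the
value of the integral covariant. Half-integers are avoided because, by Euler's identity, the
covariant minus `b r F` is visibly even. -/
theorem exists_kappa (hr : 1 ≤ r) (x y : ℤ) : ∃ p q : ℤ,
    r * Q.s * Q.xi x y ^ r = p + q * ((Q.b + Q.s) / 2) ∧
    r * Q.s * Q.eta x y ^ r = p + q * ((Q.b - Q.s) / 2) := by
  have hG := Q.covariant_eq hr x y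
  have hF := Q.eval_eq x y
  have hE : (x : ℂ) * aeval ![(x : ℂ), (y : ℂ)] (pderiv 0 F) +
      y * aeval ![(x : ℂ), (y : ℂ)] (pderiv 1 F) = r * (Q.xi x y ^ r - Q.eta x y ^ r) := by
    obtain ⟨k, rfl⟩ := Nat.exists_eq_add_of_le' hr
    rw [Q.diag.aeval_pderiv_zero, Q.diag.aeval_pderiv_one]
    simp only [Nat.add_sub_cancel, xi, eta, pow_succ]
    ring
  rw [aeval_intCast_eq, aeval_intCast_eq] at hG hE
  refine ⟨Q.c * y * MvPolynomial.eval ![x, y] (pderiv 0 F) -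
    Q.a * x * MvPolynomial.eval ![x, y] (pderiv 1 F) -
    Q.b * y * MvPolynomial.eval ![x, y] (pderiv 1 F), r * MvPolynomial.eval ![x, y] F, ?_, ?_⟩
  · push_cast
    rw [hF]
    linear_combination (1 / 2) * Q.b * hE - (1 / 2) * hG
  · push_cast
    rw [hF]
    linear_combination (1 / 2) * Q.b * hE - (1 / 2) * hG

theorem exists_tau (x₁ y₁ x₂ y₂ : ℤ) : ∃ p q : ℤ,
    Q.eta x₂ y₂ * Q.xi x₁ y₁ = Q.χ * (p + q * ((Q.b + Q.s) / 2)) ∧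
    Q.eta x₁ y₁ * Q.xi x₂ y₂ = Q.χ * (p + q * ((Q.b - Q.s) / 2)) := by
  refine ⟨Q.a * x₁ * x₂ + Q.c * y₁ * y₂ + Q.b * x₂ * y₁, x₁ * y₂ - x₂ * y₁, ?_, ?_⟩
  · push_cast; unfold xi eta
    linear_combination (x₁ * x₂ : ℂ) * Q.mul_a + (y₁ * y₂ : ℂ) * Q.mul_c +
      (1 / 2) * (x₁ * y₂ + x₂ * y₁ : ℂ) * Q.mul_b - (1 / 2) * (x₁ * y₂ - x₂ * y₁ : ℂ) * Q.mul_s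
  · push_cast; unfold xi eta
    linear_combination (x₁ * x₂ : ℂ) * Q.mul_a + (y₁ * y₂ : ℂ) * Q.mul_c +
      (1 / 2) * (x₁ * y₂ + x₂ * y₁ : ℂ) * Q.mul_b + (1 / 2) * (x₁ * y₂ - x₂ * y₁ : ℂ) * Q.mul_s

/-- `w` and `w'` are conjugate elements of the quadratic order of discriminant `disc`. -/
def Conjugate (w w' : ℂ) : Prop :=
  ∃ p q : ℤ, w = p + q * ((Q.b + Q.s) / 2) ∧ w' = p + q * ((Q.b - Q.s) / 2)

theorem Conjugate.symm {Q : QuadResolvent F r} {w w' : ℂ} (h : Q.Conjugate w w') :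
    Q.Conjugate w' w := by
  obtain ⟨p, q, rfl, rfl⟩ := h
  exact ⟨p + q * Q.b, -q, by push_cast; ring, by push_cast; ring⟩

theorem Conjugate.mul {Q : QuadResolvent F r} {w w' z z' : ℂ} (h : Q.Conjugate w w')
    (h' : Q.Conjugate z z') : Q.Conjugate (w * z) (w' * z') := by
  obtain ⟨p, q, rfl, rfl⟩ := h
  obtain ⟨p', q', rfl, rfl⟩ := h'
  have hs := Q.s_sq
  unfold disc at hs
  push_cast at hs
  refine ⟨p * p' - q * q' * (Q.a * Q.c), p * q' + q * p' + q * q' * Q.b, ?_, ?_⟩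
  · push_cast; linear_combination (q * q' : ℂ) / 4 * hs
  · push_cast; linear_combination (q * q' : ℂ) / 4 * hs

theorem Conjugate.pow {Q : QuadResolvent F r} {w w' : ℂ} (h : Q.Conjugate w w') (n : ℕ) :
    Q.Conjugate (w ^ n) (w' ^ n) := by
  induction n with
  | zero => exact ⟨1, 0, by simp, by simp⟩
  | succ n ih => rw [pow_succ, pow_succ]; exact ih.mul h

/-- After the scaling each term is an integer times `χ` times the difference of two conjugate
elements of the order. Such a difference is `s` times an integer, and `χ s` is the determinant. -/
theorem exists_int_padeLambda (hr : 1 ≤ r) (n : ℕ) (x₁ y₁ x₂ y₂ : ℤ) : ∃ q : ℤ,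
    ((r : ℂ) ^ 3 * Q.s) ^ n *
      padeLambda r n (Q.xi x₁ y₁) (Q.eta x₁ y₁) (Q.xi x₂ y₂) (Q.eta x₂ y₂) = Q.det * q := by
  obtain ⟨p₁, q₁, hκ, hκ'⟩ := Q.exists_kappa hr x₁ y₁
  obtain ⟨p₂, q₂, hτ, hτ'⟩ := Q.exists_tau x₁ y₁ x₂ y₂
  set κ := r * Q.s * Q.xi x₁ y₁ ^ r with hκd
  set κ' := r * Q.s * Q.eta x₁ y₁ ^ r with hκd'
  set τ := (p₂ : ℂ) + q₂ * ((Q.b + Q.s) / 2) with hτd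
  set τ' := (p₂ : ℂ) + q₂ * ((Q.b - Q.s) / 2) with hτd'
  have hc : Q.Conjugate κ κ' := ⟨p₁, q₁, hκ, hκ'⟩
  have ht : Q.Conjugate τ τ' := ⟨p₂, q₂, rfl, rfl⟩
  have hterm : ∀ j ∈ Finset.range (n + 1), ∃ q : ℤ, (r : ℂ) ^ (2 * n) * (padeCoeff r n j : ℂ) *
      (τ * (κ ^ j * κ' ^ (n - j)) - τ' * (κ' ^ j * κ ^ (n - j))) = Q.s * q := by
    intro j hj
    obtain ⟨e, he⟩ := pow_mul_padeCoeff_int hr (by simpa [Nat.lt_succ_iff] using hj : j ≤ n)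
    obtain ⟨p, q, h1, h2⟩ := ht.mul ((hc.pow j).mul (hc.symm.pow (n - j)))
    refine ⟨e * q, ?_⟩
    have he' : (r : ℂ) ^ (2 * n) * (padeCoeff r n j : ℂ) = e := by exact_mod_cast he
    rw [he', h1, h2]; push_cast; ring
  choose! f hf using hterm
  refine ⟨∑ j ∈ Finset.range (n + 1), f j, ?_⟩
  have hX : ∀ j ∈ Finset.range (n + 1), ((r : ℂ) ^ 3 * Q.s) ^ n *
      (Q.eta x₂ y₂ * Q.xi x₁ y₁ * ((padeCoeff r n j : ℂ) * (Q.xi x₁ y₁ ^ r) ^ j *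
        (Q.eta x₁ y₁ ^ r) ^ (n - j)) - Q.eta x₁ y₁ * Q.xi x₂ y₂ * ((padeCoeff r n j : ℂ) *
        (Q.eta x₁ y₁ ^ r) ^ j * (Q.xi x₁ y₁ ^ r) ^ (n - j))) = Q.det * f j := by
    intro j hj
    have hjn : j ≤ n := by simpa [Nat.lt_succ_iff] using hj
    have e1 : (r * Q.s : ℂ) ^ n = (r * Q.s) ^ j * (r * Q.s) ^ (n - j) := by
      rw [← pow_add]; congr 1; omega
    have e2 : ((r : ℂ) ^ 3 * Q.s) ^ n = r ^ (2 * n) * ((r * Q.s) ^ j * (r * Q.s) ^ (n - j)) := by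
      rw [← e1, pow_mul, ← mul_pow]; congr 1; ring
    have e3 := hf j hj
    rw [hκd, hκd', mul_pow, mul_pow, mul_pow, mul_pow] at e3
    rw [hτ, hτ', e2, det, ← Q.mul_s]
    linear_combination Q.χ * e3
  unfold padeLambda padeForm
  rw [Finset.mul_sum, Finset.mul_sum, ← Finset.sum_sub_distrib, Finset.mul_sum,
    Finset.sum_congr rfl hX]
  push_cast
  rw [Finset.mul_sum]

theorem norm_det_le_padeLambda (hr : 1 ≤ r) (n : ℕ) (x₁ y₁ x₂ y₂ : ℤ)
    (hne : padeLambda r n (Q.xi x₁ y₁) (Q.eta x₁ y₁) (Q.xi x₂ y₂) (Q.eta x₂ y₂) ≠ 0) :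
    ‖Q.det‖ ≤ ((r : ℝ) ^ 3 * ‖Q.s‖) ^ n *
      ‖padeLambda r n (Q.xi x₁ y₁) (Q.eta x₁ y₁) (Q.xi x₂ y₂) (Q.eta x₂ y₂)‖ := by
  obtain ⟨q, hq⟩ := Q.exists_int_padeLambda hr n x₁ y₁ x₂ y₂
  have hq0 : q ≠ 0 := by
    rintro rfl
    have hr0 : (r : ℂ) ≠ 0 := by exact_mod_cast (by omega : r ≠ 0)
    rw [Int.cast_zero, mul_zero, mul_eq_zero] at hq
    exact hq.elim (pow_ne_zero _ (mul_ne_zero (pow_ne_zero _ hr0) Q.s_ne_zero)) hne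
  have h1 : (1 : ℝ) ≤ ‖(q : ℂ)‖ := by
    rw [Complex.norm_intCast]; exact_mod_cast Int.one_le_abs hq0
  have h2 := congrArg norm hq
  rw [norm_mul, norm_pow, norm_mul, norm_pow, Complex.norm_natCast, norm_mul] at h2
  rw [h2]
  exact le_mul_of_one_le_right (norm_nonneg _) h1

theorem norm_s_sq : ‖Q.s‖ ^ 2 = |(Q.disc : ℝ)| := by
  rw [← norm_pow, Q.s_sq, Complex.norm_intCast]

theorem one_le_norm_s : 1 ≤ ‖Q.s‖ := by
  have h : (1 : ℝ) ≤ ‖Q.s‖ ^ 2 := by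
    rw [Q.norm_s_sq]; exact_mod_cast Int.one_le_abs Q.disc_ne_zero
  nlinarith [norm_nonneg Q.s]

/-- The discriminant of the quadratic form is bounded in terms of the determinant. -/
theorem norm_s_pow_le (hr : 2 ≤ r) : ‖Q.s‖ ^ (r - 2) ≤ (r : ℝ) ^ 2 * ‖Q.det‖ ^ r := by
  -- `N` times the `r`-th power of a value of the quadratic form is the norm of `r s ξ ^ r`, an
  -- integer. Primitivity makes the values at `(1,0)`, `(0,1)`, `(1,1)` generate the unit ideal, and
  -- so do their `r`-th powers; hence `N` is a nonzero integer.
  set N : ℂ := (r : ℂ) ^ 2 * Q.s ^ 2 * Q.χ ^ r with hN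
  have hval : ∀ x y : ℤ, ∃ k : ℤ,
      N * ((Q.a * x ^ 2 + Q.b * (x * y) + Q.c * y ^ 2 : ℤ) : ℂ) ^ r = k := by
    intro x y
    obtain ⟨p, q, h1, h2⟩ := Q.exists_kappa (by omega) x y
    refine ⟨p ^ 2 + p * q * Q.b + q ^ 2 * Q.a * Q.c, ?_⟩
    have h3 := Q.xi_mul_eta x y
    have h4 : N * ((Q.a * x ^ 2 + Q.b * (x * y) + Q.c * y ^ 2 : ℤ) : ℂ) ^ r =
        (r * Q.s * Q.xi x y ^ r) * (r * Q.s * Q.eta x y ^ r) := by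
      have : Q.xi x y ^ r * Q.eta x y ^ r =
          Q.χ ^ r * ((Q.a * x ^ 2 + Q.b * (x * y) + Q.c * y ^ 2 : ℤ) : ℂ) ^ r := by
        rw [← mul_pow, h3, mul_pow]; push_cast; rfl
      rw [hN]; linear_combination -(r : ℂ) ^ 2 * Q.s ^ 2 * this
    have hs := Q.s_sq
    unfold disc at hs
    push_cast at hs
    rw [h4, h1, h2]; push_cast
    linear_combination -(q : ℂ) ^ 2 / 4 * hs
  obtain ⟨u, v, w, hcop⟩ := Q.coprime
  obtain ⟨k₁, hk₁⟩ := hval 1 0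
  obtain ⟨k₂, hk₂⟩ := hval 0 1
  obtain ⟨k₃, hk₃⟩ := hval 1 1
  set A := Q.a * 1 ^ 2 + Q.b * (1 * 0) + Q.c * 0 ^ 2 with hA
  set B := Q.a * 0 ^ 2 + Q.b * (0 * 1) + Q.c * 1 ^ 2 with hB
  set C' := Q.a * 1 ^ 2 + Q.b * (1 * 1) + Q.c * 1 ^ 2 with hC
  have hspan : ∃ u v w : ℤ, u * A ^ r + v * B ^ r + w * C' ^ r = 1 := by
    have h1 : Ideal.span {A, B, C'} = ⊤ := by
      rw [Ideal.eq_top_iff_one]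
      have hmem : ∀ z ∈ ({A, B, C'} : Set ℤ), z ∈ Ideal.span {A, B, C'} :=
        fun z hz => Ideal.subset_span hz
      have : (1 : ℤ) = (u - v) * A + (w - v) * B + v * C' := by
        rw [hA, hB, hC]; linear_combination -hcop
      rw [this]
      exact add_mem (add_mem (Ideal.mul_mem_left _ _ (hmem A (by simp)))
        (Ideal.mul_mem_left _ _ (hmem B (by simp)))) (Ideal.mul_mem_left _ _ (hmem C' (by simp)))
    have h2 := Ideal.span_pow_eq_top _ h1 r
    rw [Ideal.eq_top_iff_one] at h2
    simp only [Set.image_insert_eq, Set.image_singleton] at h2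
    obtain ⟨u, z, hz, h3⟩ := Ideal.mem_span_insert.1 h2
    obtain ⟨v, z', hz', h4⟩ := Ideal.mem_span_insert.1 hz
    obtain ⟨w, h5⟩ := Ideal.mem_span_singleton'.1 hz'
    exact ⟨u, v, w, by rw [h3, h4, ← h5]; ring⟩
  obtain ⟨u, v, w, hone⟩ := hspan
  have hNint : N = ((u * k₁ + v * k₂ + w * k₃ : ℤ) : ℂ) := by
    have : ((u * A ^ r + v * B ^ r + w * C' ^ r : ℤ) : ℂ) = 1 := by rw [hone]; simp
    push_cast at this ⊢
    linear_combination -N * this + u * hk₁ + v * hk₂ + w * hk₃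
  have hr0 : (r : ℂ) ≠ 0 := by exact_mod_cast (by omega : r ≠ 0)
  have hN0 : N ≠ 0 := mul_ne_zero (mul_ne_zero (pow_ne_zero _ hr0) (pow_ne_zero _ Q.s_ne_zero))
    (pow_ne_zero _ Q.chi_ne_zero)
  have hN1 : 1 ≤ ‖N‖ := by
    rw [hNint, Complex.norm_intCast]
    rw [hNint] at hN0
    exact_mod_cast Int.one_le_abs (by exact_mod_cast hN0)
  rw [hN, norm_mul, norm_mul, norm_pow, norm_pow, norm_pow, Complex.norm_natCast] at hN1
  have hdet : ‖Q.det‖ = ‖Q.s‖ * ‖Q.χ‖ := by rw [det, ← Q.mul_s, norm_mul]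
  have hs0 : 0 < ‖Q.s‖ := norm_pos_iff.2 Q.s_ne_zero
  rw [hdet, mul_pow]
  obtain ⟨k, rfl⟩ := Nat.exists_eq_add_of_le' hr
  rw [Nat.add_sub_cancel, pow_add ‖Q.s‖ k 2]
  calc ‖Q.s‖ ^ k = ‖Q.s‖ ^ k * 1 := by ring
    _ ≤ ‖Q.s‖ ^ k * (((k + 2 : ℕ) : ℝ) ^ 2 * ‖Q.s‖ ^ 2 * ‖Q.χ‖ ^ (k + 2)) := by gcongr
    _ = _ := by ring

end QuadResolvent

/-! ### The discriminant of a diagonalizable form. -/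

/-- Row operations reduce the pair to scalar multiples of `f` and `g`. The pivot is `p`; if `p = 0`
the two polynomials are exchanged instead, which the norm does not see. -/
theorem norm_resultant_linear_comb {N : ℕ} {f g : Polynomial ℂ} (hf : f.natDegree ≤ N)
    (hg : g.natDegree ≤ N) (p q p' q' : ℂ) :
    ‖Polynomial.resultant (Polynomial.C p * f - Polynomial.C q * g)
      (Polynomial.C p' * f - Polynomial.C q' * g) N N‖ =
      ‖p * q' - p' * q‖ ^ N * ‖Polynomial.resultant f g N N‖ := by
  have hdeg : ∀ u v : ℂ, (Polynomial.C u * f - Polynomial.C v * g).natDegree ≤ N := fun u v =>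
    (Polynomial.natDegree_sub_le _ _).trans (max_le ((Polynomial.natDegree_C_mul_le _ _).trans hf)
      ((Polynomial.natDegree_C_mul_le _ _).trans hg))
  by_cases hp : p = 0
  · subst hp
    have e1 : Polynomial.C (0 : ℂ) * f - Polynomial.C q * g = Polynomial.C (-q) * g := by
      simp
    have e2 : Polynomial.C p' * f - Polynomial.C q' * g =
        Polynomial.C p' * f + g * Polynomial.C (-q') := by
      rw [Polynomial.C_neg]; ring
    rw [e1, Polynomial.resultant_C_mul_left, e2,
      Polynomial.resultant_add_mul_right _ _ _ _ _ (by simp) hg, Polynomial.resultant_C_mul_right,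
      Polynomial.resultant_comm]
    simp only [norm_mul, norm_pow, norm_neg, norm_one, one_pow, one_mul, zero_mul, zero_sub]
    rw [mul_pow]; ring
  · have e1 : Polynomial.C p' * f - Polynomial.C q' * g =
        Polynomial.C ((p' * q - p * q') / p) * g +
          (Polynomial.C p * f - Polynomial.C q * g) * Polynomial.C (p' / p) := by
      have h1 : Polynomial.C p * Polynomial.C (p' / p) = Polynomial.C p' := by
        rw [← Polynomial.C_mul]; congr 1; field_simp
      have h2 : Polynomial.C ((p' * q - p * q') / p) =
          Polynomial.C q * Polynomial.C (p' / p) - Polynomial.C q' := by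
        rw [← Polynomial.C_mul, ← Polynomial.C_sub]; congr 1; field_simp
      rw [h2, ← h1]; ring
    have e2 : Polynomial.C p * f - Polynomial.C q * g =
        Polynomial.C p * f + g * Polynomial.C (-q) := by
      rw [Polynomial.C_neg]; ring
    rw [e1, Polynomial.resultant_add_mul_right _ _ _ _ _ (by simp) (hdeg p q),
      Polynomial.resultant_C_mul_right, e2,
      Polynomial.resultant_add_mul_left _ _ _ _ _ (by simp) hg, Polynomial.resultant_C_mul_left]
    rw [norm_mul, norm_mul, norm_pow, norm_pow, ← mul_assoc, ← mul_pow, ← norm_mul,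
      div_mul_cancel₀ _ hp, norm_sub_rev]

/-- For `α ≠ 0` evaluate at the root `-β/α` of multiplicity `N`. For `α = 0` the degree drops below
the formal degree `N`, and the leading coefficient of the other power enters. -/
theorem norm_resultant_linear_pow (N : ℕ) (α β γ δ : ℂ) (h : α * δ - β * γ ≠ 0) :
    ‖Polynomial.resultant ((Polynomial.C α * Polynomial.X + Polynomial.C β) ^ N)
      ((Polynomial.C γ * Polynomial.X + Polynomial.C δ) ^ N) N N‖ =
      ‖α * δ - β * γ‖ ^ (N * N) := by
  have hdeg : ((Polynomial.C γ * Polynomial.X + Polynomial.C δ) ^ N).natDegree ≤ N :=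
    Polynomial.natDegree_pow_le_of_le N Polynomial.natDegree_linear_le |>.trans (by simp)
  by_cases hα : α = 0
  · subst hα
    have e : (Polynomial.C (0 : ℂ) * Polynomial.X + Polynomial.C β) ^ N = Polynomial.C (β ^ N) := by
      simp
    have hcoeff : ((Polynomial.C γ * Polynomial.X + Polynomial.C δ) ^ N).coeff N = γ ^ N := by
      have := Polynomial.coeff_pow_of_natDegree_le
        (p := Polynomial.C γ * Polynomial.X + Polynomial.C δ) (n := 1) (m := N)
        Polynomial.natDegree_linear_le
      rw [mul_one] at this
      rw [this]; simp
    rw [e, Polynomial.resultant_C_left, hcoeff]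
    simp only [norm_mul, norm_pow, norm_neg, norm_one, one_pow, one_mul, zero_mul, zero_sub]
    rw [← pow_mul, ← pow_mul, mul_pow]; ring
  · have hd1 : (Polynomial.C α * Polynomial.X + Polynomial.C β).natDegree = 1 :=
      Polynomial.natDegree_linear hα
    have hd : ((Polynomial.C α * Polynomial.X + Polynomial.C β) ^ N).natDegree = N := by
      rw [Polynomial.natDegree_pow, hd1, mul_one]
    have hsp : ((Polynomial.C α * Polynomial.X + Polynomial.C β) ^ N).Splits :=
      (Polynomial.Splits.of_natDegree_le_one hd1.le).pow N
    have key := Polynomial.resultant_eq_prod_eval _ _ N hdeg hsp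
    rw [hd] at key
    rw [key, Polynomial.leadingCoeff_pow, Polynomial.leadingCoeff_linear hα, Polynomial.roots_pow,
      Polynomial.roots_C_mul_X_add_C _ hα]
    simp only [Multiset.map_nsmul, Multiset.map_singleton, Multiset.prod_nsmul,
      Multiset.prod_singleton, Polynomial.eval_pow, Polynomial.eval_add, Polynomial.eval_mul,
      Polynomial.eval_C, Polynomial.eval_X]
    rw [← pow_mul, ← pow_mul, ← mul_pow, norm_pow]
    congr 2
    field_simp
    ring

theorem map_dehomog (G : MvPolynomial (Fin 2) ℤ) :
    (dehomog G).map (Int.castRingHom ℂ) =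
      MvPolynomial.aeval (![Polynomial.X, 1] : Fin 2 → Polynomial ℂ)
        (MvPolynomial.map (Int.castRingHom ℂ) G) := by
  unfold dehomog
  induction G using MvPolynomial.induction_on with
  | C a => simp
  | add p q hp hq => simp [hp, hq]
  | mul_X p i hp =>
    rw [map_mul, map_mul, map_mul, Polynomial.map_mul, hp]
    fin_cases i <;> simp

/-- Both partial derivatives are `r` times linear combinations of `ξ ^ (r-1)` and `η ^ (r-1)`, with
coefficient determinant `αδ - βγ` up to sign. The exponents add up to `(r - 1) + (r - 1)² = r (r -
1)`. -/
theorem IsDiagonalization.norm_formDiscr {F : MvPolynomial (Fin 2) ℤ} {r : ℕ} (hr : 2 ≤ r)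
    {α β γ δ : ℂ} (hd : IsDiagonalization F r α β γ δ) :
    |(formDiscr F r : ℝ)| = (r : ℝ) ^ r * ‖α * δ - β * γ‖ ^ (r * (r - 1)) := by
  set R : ℤ := Polynomial.resultant (dehomog (pderiv 0 F)) (dehomog (pderiv 1 F)) (r - 1) (r - 1)
    with hR
  have hr0 : (0 : ℝ) < r := by positivity
  have hx : (dehomog (pderiv 0 F)).map (Int.castRingHom ℂ) = Polynomial.C (r : ℂ) *
      (Polynomial.C α * (Polynomial.C α * Polynomial.X + Polynomial.C β) ^ (r - 1) -
       Polynomial.C γ * (Polynomial.C γ * Polynomial.X + Polynomial.C δ) ^ (r - 1)) := by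
    rw [map_dehomog, ← pderiv_map, hd.2, map_sub, pderiv_pow, pderiv_pow,
      pderiv_zero_linForm, pderiv_zero_linForm]
    simp [linForm]; ring
  have hy : (dehomog (pderiv 1 F)).map (Int.castRingHom ℂ) = Polynomial.C (r : ℂ) *
      (Polynomial.C β * (Polynomial.C α * Polynomial.X + Polynomial.C β) ^ (r - 1) -
       Polynomial.C δ * (Polynomial.C γ * Polynomial.X + Polynomial.C δ) ^ (r - 1)) := by
    rw [map_dehomog, ← pderiv_map, hd.2, map_sub, pderiv_pow, pderiv_pow,
      pderiv_one_linForm, pderiv_one_linForm]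
    simp [linForm]; ring
  have hdeg : ∀ u v : ℂ, ((Polynomial.C u * Polynomial.X + Polynomial.C v) ^ (r - 1)).natDegree ≤
      r - 1 := fun u v =>
    Polynomial.natDegree_pow_le_of_le (r - 1) Polynomial.natDegree_linear_le |>.trans (by simp)
  have hRnorm : |(R : ℝ)| = (r : ℝ) ^ (2 * (r - 1)) * ‖α * δ - β * γ‖ ^ (r * (r - 1)) := by
    have h1 : ((R : ℤ) : ℂ) = Polynomial.resultant ((dehomog (pderiv 0 F)).map (Int.castRingHom ℂ))
        ((dehomog (pderiv 1 F)).map (Int.castRingHom ℂ)) (r - 1) (r - 1) := by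
      rw [Polynomial.resultant_map_map]; rfl
    rw [← Complex.norm_intCast, h1, hx, hy, Polynomial.resultant_C_mul_left,
      Polynomial.resultant_C_mul_right, norm_mul, norm_mul, norm_pow, Complex.norm_natCast,
      norm_resultant_linear_comb (hdeg _ _) (hdeg _ _), norm_resultant_linear_pow _ _ _ _ _ hd.1,
      ← pow_add]
    have : r - 1 + (r - 1) * (r - 1) = r * (r - 1) := by
      obtain ⟨k, rfl⟩ := Nat.exists_eq_add_of_le' hr
      simp only [show k + 2 - 1 = k + 1 by omega]; ring
    rw [this]; ring
  unfold formDiscr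
  rw [← hR]
  push_cast
  rw [abs_div, abs_mul, abs_pow, abs_neg, abs_one, one_pow, one_mul, hRnorm,
    abs_of_pos (by positivity : (0 : ℝ) < (r : ℝ) ^ (r - 2)), div_eq_iff (by positivity)]
  have : (r : ℝ) ^ (2 * (r - 1)) = r ^ r * r ^ (r - 2) := by
    rw [← pow_add]; congr 1; omega
  rw [this]; ring

theorem IsDiagonalization.discrPrime_eq {F : MvPolynomial (Fin 2) ℤ} {r : ℕ} (hr : 2 ≤ r)
    {α β γ δ : ℂ} (hd : IsDiagonalization F r α β γ δ) {h : ℤ} (hh : 0 < h) :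
    discrPrime F r h = ((‖α * δ - β * γ‖ / 2) ^ r / (h : ℝ) ^ 2) ^ (r - 1) := by
  have hr0 : (0 : ℝ) < r := by positivity
  have hh0 : (0 : ℝ) < h := by exact_mod_cast hh
  unfold discrPrime
  rw [hd.norm_formDiscr hr]
  have h1 : r ^ 2 - r = r * (r - 1) := by rw [Nat.mul_sub, sq, mul_one]
  have h2 : 2 * r - 2 = 2 * (r - 1) := by omega
  have h3 : ((‖α * δ - β * γ‖ / 2) ^ r / (h : ℝ) ^ 2) ^ (r - 1) = ‖α * δ - β * γ‖ ^ (r * (r - 1)) /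
      (2 ^ (r * (r - 1)) * (h : ℝ) ^ (2 * (r - 1))) := by
    rw [div_pow (_ ^ r), div_pow _ 2 r, div_pow, ← pow_mul, ← pow_mul, ← pow_mul, div_div]
  rw [h1, h2, h3]
  field_simp

/-! ### Existence of the integral quadratic form. -/

theorem IsDiagonalization.map_iterate_pderiv {F : MvPolynomial (Fin 2) ℤ} {r : ℕ} {α β γ δ : ℂ}
    (hd : IsDiagonalization F r α β γ δ) (k : ℕ) :
    MvPolynomial.map (Int.castRingHom ℂ) ((pderiv 1)^[k] F) =
      C (r.descFactorial k : ℂ) * (C (β ^ k) * linForm α β ^ (r - k) -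
        C (δ ^ k) * linForm γ δ ^ (r - k)) := by
  induction k with
  | zero => simpa using hd.2
  | succ k ih =>
    rw [Function.iterate_succ_apply', ← pderiv_map, ih, pderiv_C_mul, map_sub, pderiv_C_mul,
      pderiv_C_mul, pderiv_pow, pderiv_pow, pderiv_one_linForm, pderiv_one_linForm,
      Nat.descFactorial_succ, Nat.sub_sub]
    simp only [Nat.cast_mul, C_mul, pow_succ, C_pow]
    have : ((r - k : ℕ) : MvPolynomial (Fin 2) ℂ) = C ((r - k : ℕ) : ℂ) := by simp
    rw [this]; ring

theorem IsDiagonalization.exists_int_moment {F : MvPolynomial (Fin 2) ℤ} {r : ℕ} {α β γ δ : ℂ}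
    (hd : IsDiagonalization F r α β γ δ) (k : ℕ) :
    ∃ m : ℤ, (r.descFactorial k : ℂ) * (β ^ k * α ^ (r - k) - δ ^ k * γ ^ (r - k)) = m := by
  refine ⟨MvPolynomial.eval ![1, 0] ((pderiv 1)^[k] F), ?_⟩
  have h := congrArg (MvPolynomial.eval ![(1 : ℂ), 0]) (hd.map_iterate_pderiv k)
  rw [← aeval_eq_eval_map] at h
  have h2 := aeval_intCast_eq ((pderiv 1)^[k] F) 1 0
  rw [Int.cast_one, Int.cast_zero] at h2
  rw [h2] at h
  rw [h]
  simp [linForm]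

/-- The numbers `β^k α^(r-k) - δ^k γ^(r-k)` satisfy a second-order recurrence with coefficients
`αγ`, `-(αδ + βγ)`, `βδ`. For `k ≤ 3` a common multiple makes them integers, and two instances of
the recurrence determine the coefficients up to scale as a cross product. -/
theorem exists_isQuadDisc {F : MvPolynomial (Fin 2) ℤ} {r : ℕ} (hr : 3 ≤ r)
    (hF : IsDiagonalizable F r) : ∃ D : ℤ, IsQuadDisc F r D := by
  obtain ⟨-, α, β, γ, δ, hd⟩ := hF
  suffices h : ∃ (χ : ℂ) (a b c : ℤ), α * γ = χ * a ∧ α * δ + β * γ = χ * b ∧ β * δ = χ * c by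
    obtain ⟨χ, a, b, c, ha, hb, hc⟩ := h
    refine ⟨b ^ 2 - 4 * a * c, α, β, γ, δ, χ, a, b, c, hd, ?_, rfl⟩
    have ha' := congrArg (C : ℂ → MvPolynomial (Fin 2) ℂ) ha
    have hb' := congrArg (C : ℂ → MvPolynomial (Fin 2) ℂ) hb
    have hc' := congrArg (C : ℂ → MvPolynomial (Fin 2) ℂ) hc
    simp only [C_mul, C_add] at ha' hb' hc'
    unfold linForm
    linear_combination X 0 ^ 2 * ha' + X 0 * X 1 * hb' + X 1 ^ 2 * hc'
  obtain ⟨k, rfl⟩ := Nat.exists_eq_add_of_le' hr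
  obtain ⟨f₀, h₀⟩ := hd.exists_int_moment 0
  obtain ⟨f₁, h₁⟩ := hd.exists_int_moment 1
  obtain ⟨f₂, h₂⟩ := hd.exists_int_moment 2
  obtain ⟨f₃, h₃⟩ := hd.exists_int_moment 3
  simp only [Nat.descFactorial_succ, Nat.descFactorial_zero, show k + 3 - 1 = k + 2 by omega,
    show k + 3 - 2 = k + 1 by omega, show k + 3 - 3 = k by omega, Nat.sub_zero, pow_zero, one_mul,
    pow_one, mul_one, Nat.cast_one] at h₀ h₁ h₂ h₃
  push_cast at h₀ h₁ h₂ h₃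
  set n : ℂ := ((k : ℂ) + 1) * (k + 2) * (k + 3) with hn
  have hn0 : n ≠ 0 := by rw [hn]; norm_cast
  have hj := hd.1
  obtain ⟨m₀, e₀⟩ : ∃ m : ℤ, n * (α ^ (k + 3) - γ ^ (k + 3)) = m :=
    ⟨(k + 1) * (k + 2) * (k + 3) * f₀, by push_cast; rw [hn]; linear_combination n * h₀⟩
  obtain ⟨m₁, e₁⟩ : ∃ m : ℤ, n * (β * α ^ (k + 2) - δ * γ ^ (k + 2)) = m :=
    ⟨(k + 1) * (k + 2) * f₁, by
      push_cast; rw [hn]; linear_combination ((k : ℂ) + 1) * (k + 2) * h₁⟩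
  obtain ⟨m₂, e₂⟩ : ∃ m : ℤ, n * (β ^ 2 * α ^ (k + 1) - δ ^ 2 * γ ^ (k + 1)) = m :=
    ⟨(k + 1) * f₂, by push_cast; rw [hn]; linear_combination ((k : ℂ) + 1) * h₂⟩
  obtain ⟨m₃, e₃⟩ : ∃ m : ℤ, n * (β ^ 3 * α ^ k - δ ^ 3 * γ ^ k) = m :=
    ⟨f₃, by rw [hn]; linear_combination h₃⟩
  have hrec₁ : α * γ * m₂ - (α * δ + β * γ) * m₁ + β * δ * m₀ = 0 := by
    rw [← e₀, ← e₁, ← e₂]; ring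
  have hrec₂ : α * γ * m₃ - (α * δ + β * γ) * m₂ + β * δ * m₁ = 0 := by
    rw [← e₃, ← e₁, ← e₂]; ring
  have hW : (m₀ * m₂ - m₁ ^ 2 : ℂ) = -(n ^ 2 * (α * γ) ^ (k + 1) * (α * δ - β * γ) ^ 2) := by
    rw [← e₀, ← e₁, ← e₂]; ring
  -- The cross product has first entry `m₀ m₂ - m₁²`, a nonzero multiple of a power of `αγ`. If `αγ
  -- = 0`, the first recurrence has only two unknowns and `m₀ ≠ 0`.
  by_cases hαγ : α * γ = 0
  · have hm₀ : (m₀ : ℂ) ≠ 0 := by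
      rw [← e₀]
      refine mul_ne_zero hn0 ?_
      rcases mul_eq_zero.1 hαγ with h | h
      · have hγ : γ ≠ 0 := by rintro rfl; apply hj; rw [h]; ring
        rw [h, zero_pow (by omega), zero_sub]
        exact neg_ne_zero.2 (pow_ne_zero _ hγ)
      · have hα : α ≠ 0 := by rintro rfl; apply hj; rw [h]; ring
        rw [h, zero_pow (by omega), sub_zero]
        exact pow_ne_zero _ hα
    refine ⟨(α * δ + β * γ) / m₀, 0, m₀, m₁, by simpa using hαγ, by field_simp, ?_⟩
    rw [hαγ] at hrec₁
    field_simp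
    linear_combination hrec₁
  · have hW0 : (m₀ * m₂ - m₁ ^ 2 : ℂ) ≠ 0 := by
      rw [hW]
      exact neg_ne_zero.2 (mul_ne_zero (mul_ne_zero (pow_ne_zero _ hn0) (pow_ne_zero _ hαγ))
        (pow_ne_zero _ hj))
    refine ⟨α * γ / (m₀ * m₂ - m₁ ^ 2), m₀ * m₂ - m₁ ^ 2, m₀ * m₃ - m₁ * m₂, m₁ * m₃ - m₂ ^ 2,
      ?_, ?_, ?_⟩
    · push_cast; field_simp
    · push_cast; rw [div_mul_eq_mul_div, eq_div_iff hW0]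
      linear_combination m₁ * hrec₁ - m₀ * hrec₂
    · push_cast; rw [div_mul_eq_mul_div, eq_div_iff hW0]
      linear_combination m₂ * hrec₁ - m₁ * hrec₂

/-- Dividing the quadratic form by its content `e` changes the discriminant by a square, so its sign
is kept. -/
theorem IsQuadDisc.exists_quadResolvent {F : MvPolynomial (Fin 2) ℤ} {r : ℕ} {D : ℤ}
    (hD : IsQuadDisc F r D) : ∃ (Q : QuadResolvent F r) (e : ℤ), e ≠ 0 ∧ D = e ^ 2 * Q.disc := by
  obtain ⟨α, β, γ, δ, χ, a, b, c, hd, hq, rfl⟩ := hD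
  have hval : ∀ x y : ℂ, (α * x + β * y) * (γ * x + δ * y) =
      χ * (a * x ^ 2 + b * (x * y) + c * y ^ 2) := fun x y => by
    have := congrArg (MvPolynomial.eval ![x, y]) hq
    simpa [linForm] using this
  have h1 := hval 1 0
  have h2 := hval 0 1
  have h3 := hval 1 1
  have ha : α * γ = χ * a := by linear_combination h1
  have hc : β * δ = χ * c := by linear_combination h2
  have hb : α * δ + β * γ = χ * b := by linear_combination h3 - h1 - h2
  set e : ℤ := (Int.gcd a (Int.gcd b c) : ℤ) with he
  have hea : e ∣ a := Int.gcd_dvd_left _ _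
  have hebc : e ∣ (Int.gcd b c : ℤ) := Int.gcd_dvd_right _ _
  have heb : e ∣ b := hebc.trans (Int.gcd_dvd_left _ _)
  have hec : e ∣ c := hebc.trans (Int.gcd_dvd_right _ _)
  have hdet2 : (α * δ - β * γ) ^ 2 = χ ^ 2 * ((b ^ 2 - 4 * a * c : ℤ) : ℂ) := by
    push_cast
    linear_combination (α * δ + β * γ + χ * b) * hb - 4 * β * δ * ha - 4 * χ * a * hc
  have hχ : χ ≠ 0 := by
    rintro rfl
    exact pow_ne_zero 2 hd.1 (by rw [hdet2]; ring)
  have he0 : e ≠ 0 := by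
    intro h
    rw [h, zero_dvd_iff] at hea heb hec
    exact pow_ne_zero 2 hd.1 (by rw [hdet2, hea, heb, hec]; simp)
  obtain ⟨a', ha'⟩ := hea
  obtain ⟨b', hb'⟩ := heb
  obtain ⟨c', hc'⟩ := hec
  have heC : (e : ℂ) ≠ 0 := by exact_mod_cast he0
  refine ⟨⟨α, β, γ, δ, χ * e, (α * δ - β * γ) / (χ * e), a', b', c', hd, ?_, ?_, ?_, ?_, ?_⟩,
    e, he0, ?_⟩
  · rw [ha, ha']; push_cast; ring
  · rw [hb, hb']; push_cast; ring
  · rw [hc, hc']; push_cast; ring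
  · field_simp
  · have b1 := Int.gcd_eq_gcd_ab a (Int.gcd b c)
    have b2 := Int.gcd_eq_gcd_ab b c
    refine ⟨Int.gcdA a (Int.gcd b c), Int.gcdB a (Int.gcd b c) * Int.gcdA b c,
      Int.gcdB a (Int.gcd b c) * Int.gcdB b c, mul_left_cancel₀ he0 ?_⟩
    rw [← he] at b1
    linear_combination -b1 - Int.gcdB a (Int.gcd b c) * b2 -
      Int.gcdA a (Int.gcd b c) * ha' - Int.gcdB a (Int.gcd b c) * Int.gcdA b c * hb' -
      Int.gcdB a (Int.gcd b c) * Int.gcdB b c * hc'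
  · simp only [QuadResolvent.disc]
    nth_rewrite 1 [hb', ha', hc']
    ring

/-! ### Numerical consequences of the hypothesis. -/

/-- `(r - 1) ^ (m - 1) - 2 r - 1`, written in terms of a geometric sum. -/
theorem pow_sub_eq_geom {r m : ℕ} (hr : 5 ≤ r) (hm : 3 ≤ m) :
    ∃ E : ℕ, 0 < E ∧
      E + r + 2 = (r - 1) * (r - 2) * ∑ i ∈ Finset.range (m - 2), (r - 1) ^ i ∧
      ((r : ℝ) - 1) ^ (m - 1) - 2 * (r : ℝ) - 1 = E := by
  obtain ⟨s, rfl⟩ := Nat.exists_eq_add_of_le' hr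
  obtain ⟨k, rfl⟩ := Nat.exists_eq_add_of_le' hm
  simp only [show s + 5 - 1 = s + 4 by omega, show s + 5 - 2 = s + 3 by omega,
    show k + 3 - 2 = k + 1 by omega, show k + 3 - 1 = k + 2 by omega]
  set M := ∑ i ∈ Finset.range (k + 1), (s + 4) ^ i with hM
  have hgeom : (s + 3) * M + 1 = (s + 4) ^ (k + 1) := by
    have h2 := geom_sum_mul_add (s + 3) (k + 1)
    rw [hM, mul_comm]
    exact h2
  have hM1 : 1 ≤ M := by
    rw [hM, Finset.sum_range_succ']; simp
  have hbig : s + 7 + 1 ≤ (s + 4) * (s + 3) * M := by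
    have := Nat.mul_le_mul_left ((s + 4) * (s + 3)) hM1
    nlinarith
  refine ⟨(s + 4) * (s + 3) * M - (s + 7), by omega, by omega, ?_⟩
  rw [Nat.cast_sub (by omega)]
  have : ((s : ℝ) + 3) * M + 1 = (s + 4) ^ (k + 1) := by exact_mod_cast hgeom
  push_cast
  rw [show (s : ℝ) + 5 - 1 = s + 4 by ring, pow_succ ((s : ℝ) + 4) (k + 1), ← this]
  ring

/-- `E` is the common denominator of both exponents: raise to the power `E`, then take the `(r -
1)`-th root. -/
theorem pow_le_of_rpow_le {r m E : ℕ} (hr : 5 ≤ r) (hE : 0 < E)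
    (hE' : ((r : ℝ) - 1) ^ (m - 1) - 2 * (r : ℝ) - 1 = E) {h G : ℝ} (hh : 1 ≤ h) (hG : 0 ≤ G)
    (hyp : (r : ℝ) ^ alphaOne r m * h ^ alphaTwo r m ≤ G ^ (r - 1)) :
    (r : ℝ) ^ (7 * r ^ 2) * h ^ (r ^ 2 + r + 2) ≤ G ^ E := by
  have hr0 : (0 : ℝ) < r := by positivity
  have hh0 : 0 < h := by linarith
  have hE0 : (E : ℝ) ≠ 0 := by positivity
  have hr1 : ((r - 1 : ℕ) : ℝ) = (r : ℝ) - 1 := by rw [Nat.cast_sub (by omega)]; simp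
  have e1 : alphaOne r m * E = ((7 * r ^ 2 * (r - 1) : ℕ) : ℝ) := by
    unfold alphaOne; rw [hE', div_mul_cancel₀ _ hE0]; push_cast [hr1]; ring
  have e2 : alphaTwo r m * E = (((r ^ 2 + r + 2) * (r - 1) : ℕ) : ℝ) := by
    unfold alphaTwo; rw [hE', div_mul_cancel₀ _ hE0]; push_cast [hr1]; ring
  have h1 : ((r : ℝ) ^ alphaOne r m * h ^ alphaTwo r m) ^ E ≤ (G ^ (r - 1)) ^ E := by gcongr
  rw [mul_pow, ← Real.rpow_natCast (_ ^ alphaOne r m), ← Real.rpow_natCast (_ ^ alphaTwo r m),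
    ← Real.rpow_mul hr0.le, ← Real.rpow_mul hh0.le, e1, e2, Real.rpow_natCast, Real.rpow_natCast,
    pow_mul, pow_mul h, ← mul_pow, ← pow_mul G, mul_comm (r - 1) E, pow_mul G] at h1
  exact (pow_le_pow_iff_left₀ (n := r - 1) (by positivity) (by positivity) (by omega)).1 h1

/-- Otherwise `d > r²`, and multiplying `d³ > r⁶ a^r` by `d^(r-5) ≥ r^(2(r-5))` exceeds the given
bound, since `2^r ≤ r^(2r-6)`. -/
theorem norm_cube_le {r : ℕ} (hr : 5 ≤ r) {d a h : ℝ} (hd : 0 < d) (hah : h ^ 2 ≤ a ^ r)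
    (hh : 1 ≤ h) (hdr : d ^ (r - 2) ≤ (r : ℝ) ^ 2 * (2 * a) ^ r) :
    d ^ 3 ≤ (r : ℝ) ^ 6 * a ^ r := by
  obtain ⟨s, rfl⟩ := Nat.exists_eq_add_of_le' hr
  rw [show s + 5 - 2 = s + 3 by omega] at hdr
  by_contra hlt
  push Not at hlt
  set R : ℝ := ((s + 5 : ℕ) : ℝ) with hR
  have hR4 : (4 : ℝ) ≤ R := by rw [hR]; push_cast; linarith [(Nat.cast_nonneg s : (0 : ℝ) ≤ s)]
  have hA : 1 ≤ a ^ (s + 5) := le_trans (one_le_pow₀ hh) hah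
  have hdR : R ^ 2 < d := by
    refine lt_of_pow_lt_pow_left₀ 3 hd.le ?_
    calc (R ^ 2) ^ 3 = R ^ 6 * 1 := by ring
      _ ≤ R ^ 6 * a ^ (s + 5) := by gcongr
      _ < _ := hlt
  have h2 : (2 : ℝ) ^ (s + 5) ≤ R ^ (2 * s + 4) := by
    calc (2 : ℝ) ^ (s + 5) ≤ 2 ^ (2 * (2 * s + 4)) := by gcongr <;> first | omega | norm_num
      _ = 4 ^ (2 * s + 4) := by rw [pow_mul]; norm_num
      _ ≤ _ := by gcongr
  have : R ^ 2 * (2 * a) ^ (s + 5) < d ^ (s + 3) := by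
    calc R ^ 2 * (2 * a) ^ (s + 5) = R ^ 2 * 2 ^ (s + 5) * a ^ (s + 5) := by rw [mul_pow]; ring
      _ ≤ R ^ 2 * R ^ (2 * s + 4) * a ^ (s + 5) := by gcongr
      _ = (R ^ 2) ^ s * (R ^ 6 * a ^ (s + 5)) := by rw [← pow_mul]; ring
      _ < (R ^ 2) ^ s * d ^ 3 := by gcongr
      _ ≤ d ^ s * d ^ 3 := by gcongr
      _ = _ := by ring
  linarith

/-- The lower bound for the penultimate solution of a chain. -/
theorem large_of_chain {r m E : ℕ} (hr : 5 ≤ r) (hm : 3 ≤ m) {d a h Z : ℝ} (hd : 0 < d)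
    (ha : 0 < a) (hh : 1 ≤ h) (hZ : 0 < Z) (hah : h ^ 2 ≤ a ^ r)
    (hE : E + r + 2 = (r - 1) * (r - 2) * ∑ i ∈ Finset.range (m - 2), (r - 1) ^ i)
    (hyp : (r : ℝ) ^ (7 * r ^ 2) * h ^ (r ^ 2 + r + 2) ≤ (a ^ r / h ^ 2) ^ E)
    (hdr : d ^ (r - 2) ≤ (r : ℝ) ^ 2 * (2 * a) ^ r)
    (hZa : a * (a ^ r / h ^ 2) ^ (∑ i ∈ Finset.range (m - 2), (r - 1) ^ i) ≤ Z ^ 2) :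
    16 * ((r : ℝ) ^ 3 * d) ^ 2 * h ^ 3 ≤ Z ^ r := by
  set M := ∑ i ∈ Finset.range (m - 2), (r - 1) ^ i with hM
  set G := a ^ r / h ^ 2 with hG
  have hh0 : 0 < h := by linarith
  have hr0 : (0 : ℝ) < r := by positivity
  have hr1 : (1 : ℝ) ≤ r := by exact_mod_cast (by omega : 1 ≤ r)
  have hG1 : 1 ≤ G := by rw [hG, le_div_iff₀ (by positivity)]; linarith
  have hGa : a ^ r = G * h ^ 2 := by rw [hG]; field_simp
  have hM1 : 1 ≤ M := by
    rw [hM, show m - 2 = m - 3 + 1 by omega, Finset.sum_range_succ']; simp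
  have hd3 := norm_cube_le hr hd hah hh hdr
  -- What the sixth power of the claim requires: `2^24 ≤ r^11` and `(d³)⁴ ≤ (r⁶ G h²)⁴` give
  -- `r^(11+36+24)`, and `h^26 G⁴` is split as `(h² G)³ G h^20`. The sixth power makes both `d³` and
  -- `Z²` usable.
  have hT : (r : ℝ) ^ 71 * h ^ 20 ≤ G ^ (3 * r * M - 1) := by
    have hN : r ^ 2 + r + 2 ≠ 0 := by positivity
    refine (pow_le_pow_iff_left₀ (by positivity) (by positivity) hN).1 ?_
    calc ((r : ℝ) ^ 71 * h ^ 20) ^ (r ^ 2 + r + 2) =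
        (r : ℝ) ^ (71 * (r ^ 2 + r + 2)) * h ^ (20 * (r ^ 2 + r + 2)) := by
          rw [mul_pow, ← pow_mul, ← pow_mul]
      _ ≤ (r : ℝ) ^ (7 * r ^ 2 * 20) * h ^ ((r ^ 2 + r + 2) * 20) := by
          refine mul_le_mul (pow_le_pow_right₀ hr1 (by nlinarith)) (le_of_eq (by rw [mul_comm]))
            (by positivity) (by positivity)
      _ = ((r : ℝ) ^ (7 * r ^ 2) * h ^ (r ^ 2 + r + 2)) ^ 20 := by
          rw [mul_pow, ← pow_mul, ← pow_mul]
      _ ≤ (G ^ E) ^ 20 := by gcongr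
      _ = G ^ (E * 20) := by rw [← pow_mul]
      _ ≤ G ^ ((3 * r * M - 1) * (r ^ 2 + r + 2)) := by
          refine pow_le_pow_right₀ hG1 ?_
          obtain ⟨s, rfl⟩ := Nat.exists_eq_add_of_le' hr
          simp only [show s + 5 - 1 = s + 4 by omega, show s + 5 - 2 = s + 3 by omega] at hE
          obtain ⟨t, ht⟩ := Nat.exists_eq_add_of_le' hM1
          rw [ht] at hE ⊢
          have : 3 * (s + 5) * (t + 1) - 1 = 3 * (s + 5) * t + 3 * s + 14 := by
            have : 3 * (s + 5) * (t + 1) = 3 * (s + 5) * t + 3 * s + 14 + 1 := by ring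
            omega
          rw [this]
          have hE2 : E + s + 7 = (s + 4) * (s + 3) * t + (s ^ 2 + 7 * s + 12) := by
            rw [show E + s + 7 = E + (s + 5) + 2 by ring, hE]; ring
          nlinarith [mul_nonneg (Nat.zero_le s) (Nat.zero_le t),
            mul_nonneg (Nat.zero_le (s ^ 2)) (Nat.zero_le t),
            mul_nonneg (Nat.zero_le (s ^ 3)) (Nat.zero_le t), pow_nonneg (Nat.zero_le s) 3]
      _ = _ := by rw [pow_mul]
  refine (pow_le_pow_iff_left₀ (by positivity) (by positivity) (by norm_num : 6 ≠ 0)).1 ?_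
  have h2 : (2 : ℝ) ^ 24 ≤ (r : ℝ) ^ 11 := by
    calc (2 : ℝ) ^ 24 ≤ 5 ^ 11 := by norm_num
      _ ≤ _ := by gcongr; exact_mod_cast hr
  have hT' : 3 * r * M = 3 * r * M - 1 + 1 := by
    have : 0 < 3 * r * M := by positivity
    omega
  calc (16 * ((r : ℝ) ^ 3 * d) ^ 2 * h ^ 3) ^ 6 = 2 ^ 24 * r ^ 36 * (d ^ 3) ^ 4 * h ^ 18 := by ring
    _ ≤ r ^ 11 * r ^ 36 * (r ^ 6 * (G * h ^ 2)) ^ 4 * h ^ 18 := by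
        rw [← hGa]; gcongr
    _ = (h ^ 2 * G) ^ 3 * G * ((r : ℝ) ^ 71 * h ^ 20) := by ring
    _ ≤ (h ^ 2 * G) ^ 3 * G * G ^ (3 * r * M - 1) := by gcongr
    _ = (h ^ 2 * G) ^ 3 * G ^ (3 * r * M) := by
        rw [mul_assoc, ← pow_succ', ← hT']
    _ = ((a * G ^ M) ^ r) ^ 3 := by
        rw [mul_pow a, hGa, ← pow_mul, mul_pow (G * h ^ 2), ← pow_mul]
        rw [show M * r * 3 = 3 * r * M by ring]; ring
    _ ≤ ((Z ^ 2) ^ r) ^ 3 := by gcongr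
    _ = (Z ^ r) ^ 6 := by rw [← pow_mul, ← pow_mul, ← pow_mul]; congr 1; ring

/-- Remove the largest element and induct. One use of the squared gap inequality sends an exponent
`M` to `(r - 1) M + 1`, which is the next geometric sum. -/
theorem exists_large_of_card {ι : Type*} [DecidableEq ι] {r : ℕ} {a h : ℝ} (hr : 1 ≤ r)
    (ha : 0 < a) (hh : 0 < h) (Z : ι → ℝ) (k : ℕ) (S : Finset ι) (hpos : ∀ i ∈ S, 0 < Z i)
    (hlarge : ∀ i ∈ S, a ≤ Z i ^ 2)
    (hgap : ∀ i ∈ S, ∀ j ∈ S, i ≠ j → Z i ≤ Z j → a * Z i ^ (r - 1) ≤ h * Z j)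
    (hcard : k + 1 ≤ S.card) :
    ∃ i ∈ S, a * (a ^ r / h ^ 2) ^ (∑ l ∈ Finset.range k, (r - 1) ^ l) ≤ Z i ^ 2 := by
  induction k generalizing S with
  | zero =>
    obtain ⟨i, hi⟩ := Finset.card_pos.1 (by omega : 0 < S.card)
    exact ⟨i, hi, by simpa using hlarge i hi⟩
  | succ k ih =>
    obtain ⟨j, hj, hmax⟩ := Finset.exists_max_image S Z (Finset.card_pos.1 (by omega))
    obtain ⟨i, hi, hiZ⟩ := ih (S.erase j) (fun i hi => hpos i (Finset.mem_of_mem_erase hi))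
      (fun i hi => hlarge i (Finset.mem_of_mem_erase hi))
      (fun i hi i' hi' => hgap i (Finset.mem_of_mem_erase hi) i' (Finset.mem_of_mem_erase hi'))
      (by rw [Finset.card_erase_of_mem hj]; omega)
    have hiS := Finset.mem_of_mem_erase hi
    have hg := hgap i hiS j hj (Finset.ne_of_mem_erase hi) (hmax i hiS)
    refine ⟨j, hj, ?_⟩
    have hZi := hpos i hiS
    have hZj := hpos j hj
    have h1 : (a * Z i ^ (r - 1)) ^ 2 ≤ (h * Z j) ^ 2 := by gcongr
    have h2 : a ^ 2 * (a * (a ^ r / h ^ 2) ^ (∑ l ∈ Finset.range k, (r - 1) ^ l)) ^ (r - 1) ≤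
        (h * Z j) ^ 2 := by
      refine le_trans ?_ h1
      calc _ ≤ a ^ 2 * (Z i ^ 2) ^ (r - 1) := by gcongr
        _ = _ := by rw [mul_pow, ← pow_mul, ← pow_mul, mul_comm 2]
    have hsum : ∑ l ∈ Finset.range (k + 1), (r - 1) ^ l =
        (∑ l ∈ Finset.range k, (r - 1) ^ l) * (r - 1) + 1 := by
      rw [geom_sum_succ, mul_comm]
    rw [hsum, pow_succ, pow_mul]
    have hra : a ^ 2 * a ^ (r - 1) = a * a ^ r := by
      obtain ⟨t, rfl⟩ := Nat.exists_eq_add_of_le' hr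
      simp only [Nat.add_sub_cancel]; ring
    refine le_of_mul_le_mul_left ?_ (by positivity : 0 < h ^ 2)
    calc h ^ 2 * (a * (((a ^ r / h ^ 2) ^ (∑ l ∈ Finset.range k, (r - 1) ^ l)) ^ (r - 1) *
          (a ^ r / h ^ 2))) =
        a * a ^ r * ((a ^ r / h ^ 2) ^ (∑ l ∈ Finset.range k, (r - 1) ^ l)) ^ (r - 1) := by
          field_simp
      _ = a ^ 2 * (a * (a ^ r / h ^ 2) ^ (∑ l ∈ Finset.range k, (r - 1) ^ l)) ^ (r - 1) := by
          rw [mul_pow a, ← hra]; ring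
      _ ≤ (h * Z j) ^ 2 := h2
      _ = _ := by ring

/-! ### Large solutions and counting. -/

namespace QuadResolvent

variable {F : MvPolynomial (Fin 2) ℤ} {r : ℕ} (Q : QuadResolvent F r)

/-- The maximum of the absolute values of the two linear forms at an integral point. -/
noncomputable def size (p : ℤ × ℤ) : ℝ := max ‖Q.xi p.1 p.2‖ ‖Q.eta p.1 p.2‖

/-- `p` is a primitive solution at which one of the linear forms is large. -/
def IsLargeSolution (h : ℤ) (p : ℤ × ℤ) : Prop :=
  p ∈ primitiveSolutions F h ∧ ‖Q.det‖ / 2 ≤ Q.size p ^ 2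

theorem norm_sub_le_of_mem {h : ℤ} {p : ℤ × ℤ} (hp : p ∈ primitiveSolutions F h) :
    ‖Q.xi p.1 p.2 ^ r - Q.eta p.1 p.2 ^ r‖ ≤ h := by
  rw [← Q.eval_eq, Complex.norm_intCast]
  exact_mod_cast hp.2.2

theorem pow_ne_pow_of_mem {h : ℤ} {p : ℤ × ℤ} (hp : p ∈ primitiveSolutions F h) :
    Q.xi p.1 p.2 ^ r ≠ Q.eta p.1 p.2 ^ r := by
  rw [← sub_ne_zero, ← Q.eval_eq]
  exact_mod_cast abs_pos.1 hp.2.1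

theorem norm_det_le {p q : ℤ × ℤ} (hpq : p.1 * q.2 - q.1 * p.2 ≠ 0) :
    ‖Q.det‖ ≤ ‖Q.xi p.1 p.2 * Q.eta q.1 q.2 - Q.xi q.1 q.2 * Q.eta p.1 p.2‖ := by
  rw [Q.xi_mul_eta_sub, norm_mul]
  refine le_mul_of_one_le_right (norm_nonneg _) ?_
  have : ((p.1 : ℂ) * q.2 - q.1 * p.2) = ((p.1 * q.2 - q.1 * p.2 : ℤ) : ℂ) := by push_cast; rfl
  rw [this, Complex.norm_intCast]
  exact_mod_cast Int.one_le_abs hpq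

/-- Two independent points cannot both have squared size below `‖Q.det‖ / 2`, so at most one
solution fails to be large. -/
theorem norm_det_le_two_mul {p q : ℤ × ℤ} (hpq : p.1 * q.2 - q.1 * p.2 ≠ 0) :
    ‖Q.det‖ ≤ 2 * (Q.size p * Q.size q) := by
  refine (Q.norm_det_le hpq).trans ((norm_sub_le _ _).trans ?_)
  rw [norm_mul, norm_mul, two_mul]
  unfold size
  refine add_le_add ?_ ?_
  · exact mul_le_mul (le_max_left _ _) (le_max_right _ _) (norm_nonneg _)
      (le_max_of_le_left (norm_nonneg _))
  · rw [mul_comm]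
    exact mul_le_mul (le_max_right _ _) (le_max_left _ _) (norm_nonneg _)
      (le_max_of_le_left (norm_nonneg _))

theorem det_norm_pos : 0 < ‖Q.det‖ := norm_pos_iff.2 Q.det_ne_zero

theorem size_nonneg (p : ℤ × ℤ) : 0 ≤ Q.size p := le_max_of_le_left (norm_nonneg _)

theorem IsLargeSolution.size_pos {Q : QuadResolvent F r} {h : ℤ} {p : ℤ × ℤ}
    (hp : Q.IsLargeSolution h p) : 0 < Q.size p := by
  have h1 := hp.2
  have h2 := Q.det_norm_pos
  refine lt_of_le_of_ne (Q.size_nonneg p) fun h0 => ?_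
  rw [← h0] at h1
  norm_num at h1
  linarith

/-- Pairwise linearly independent. -/
def _root_.PairwiseIndep (S : Finset (ℤ × ℤ)) : Prop :=
  ∀ p ∈ S, ∀ q ∈ S, p ≠ q → p.1 * q.2 - q.1 * p.2 ≠ 0

/-- The numerical hypothesis on the determinant and `h`. -/
structure LargeDet (m : ℕ) (h : ℤ) : Prop where
  hr : 5 ≤ r
  hm : 3 ≤ m
  hh : 1 ≤ h
  lt : (h : ℝ) ^ 2 < (‖Q.det‖ / 2) ^ r
  le : ∃ E : ℕ, E + r + 2 = (r - 1) * (r - 2) * ∑ i ∈ Finset.range (m - 2), (r - 1) ^ i ∧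
    (r : ℝ) ^ (7 * r ^ 2) * (h : ℝ) ^ (r ^ 2 + r + 2) ≤ ((‖Q.det‖ / 2) ^ r / (h : ℝ) ^ 2) ^ E

theorem largeDet {m : ℕ} {h : ℤ} (hr : 5 ≤ r) (hm : 3 ≤ m) (hh : 0 < h)
    (hyp : discrPrime F r h ≥ (r : ℝ) ^ alphaOne r m * (h : ℝ) ^ alphaTwo r m) :
    Q.LargeDet m h := by
  obtain ⟨E, hE0, hE, hE'⟩ := pow_sub_eq_geom hr hm
  have hh1 : (1 : ℝ) ≤ h := by exact_mod_cast hh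
  have hh0 : (0 : ℝ) < h := by linarith
  have ha : 0 < ‖Q.det‖ / 2 := by linarith [Q.det_norm_pos]
  set G := (‖Q.det‖ / 2) ^ r / (h : ℝ) ^ 2 with hG
  have hG0 : 0 < G := by positivity
  have e : discrPrime F r h = G ^ (r - 1) := Q.diag.discrPrime_eq (by omega) hh
  rw [e] at hyp
  have key := pow_le_of_rpow_le hr hE0 hE' hh1 hG0.le hyp
  refine ⟨hr, hm, hh, ?_, E, hE, key⟩
  have hG1 : 1 < G := by
    by_contra hle
    have h1 : G ^ E ≤ 1 := pow_le_one₀ hG0.le (not_lt.1 hle)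
    have h2 : (1 : ℝ) < (r : ℝ) ^ (7 * r ^ 2) :=
      one_lt_pow₀ (by exact_mod_cast (by omega : 1 < r)) (by positivity)
    have h3 : (1 : ℝ) ≤ (h : ℝ) ^ (r ^ 2 + r + 2) := one_le_pow₀ hh1
    nlinarith
  rw [hG, lt_div_iff₀ (by positivity)] at hG1
  linarith

/-- At most `m - 1` large solutions are close to the same root of unity. -/
theorem LargeDet.card_lt {Q : QuadResolvent F r} {m : ℕ} {h : ℤ} (H : Q.LargeDet m h) {ω : ℂ}
    (hω : ‖ω‖ = 1) (S : Finset (ℤ × ℤ)) (hind : PairwiseIndep S)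
    (hS : ∀ p ∈ S, Q.IsLargeSolution h p ∧ Q.xi p.1 p.2 ≠ 0 ∧ Q.eta p.1 p.2 ≠ 0 ∧
      PadeClose r h ω (Q.xi p.1 p.2) (Q.eta p.1 p.2)) : S.card < m := by
  by_contra hcard
  push Not at hcard
  have hr := H.hr
  have hm := H.hm
  have hh1 : (1 : ℝ) ≤ h := by exact_mod_cast H.hh
  have ha : 0 < ‖Q.det‖ / 2 := by linarith [Q.det_norm_pos]
  obtain ⟨E, hE, hyp⟩ := H.le
  have hgap : ∀ i ∈ S, ∀ j ∈ S, i ≠ j → Q.size i ≤ Q.size j →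
      ‖Q.det‖ / 2 * Q.size i ^ (r - 1) ≤ h * Q.size j := by
    intro i hi j hj hij hle
    refine padeClose_gap (by omega) (by linarith) hω (hS i hi).2.2.2 (hS j hj).2.2.2
      (hS i hi).2.1 hle ?_
    have := Q.norm_det_le (hind i hi j hj hij)
    linarith
  obtain ⟨j, hj, hmax⟩ := Finset.exists_max_image S Q.size (Finset.card_pos.1 (by omega))
  -- Without the largest `j` there remain at least `m - 1 = (m - 2) + 1` solutions, enough for `m -
  -- 2` gaps; the resulting `i`, paired with `j`, is contradictory.
  obtain ⟨i, hi, hiZ⟩ := exists_large_of_card (r := r) (by omega) ha (by linarith) Q.size (m - 2)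
    (S.erase j) (fun i hi => (hS i (Finset.mem_of_mem_erase hi)).1.size_pos)
    (fun i hi => (hS i (Finset.mem_of_mem_erase hi)).1.2)
    (fun i hi i' hi' => hgap i (Finset.mem_of_mem_erase hi) i' (Finset.mem_of_mem_erase hi'))
    (by rw [Finset.card_erase_of_mem hj]; omega)
  have hiS := Finset.mem_of_mem_erase hi
  have hs1 := Q.one_le_norm_s
  have hdr := Q.norm_s_pow_le (by omega)
  rw [show ‖Q.det‖ = 2 * (‖Q.det‖ / 2) by ring] at hdr
  have hbig := large_of_chain hr hm (by linarith) ha hh1 (hS i hiS).1.size_pos H.lt.le hE hyp hdr hiZ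
  have hr1 : (1 : ℝ) ≤ (r : ℝ) ^ 3 := one_le_pow₀ (by exact_mod_cast (by omega : 1 ≤ r))
  refine padeClose_pair_false hr hh1 ha H.lt (one_le_mul_of_one_le_of_one_le hr1 hs1) hω
    (hS i hiS).2.2.2 (hS j hj).2.2.2 (hS i hiS).2.1 (hS j hj).2.2.1
    (Q.pow_ne_pow_of_mem (hS i hiS).1.1)
    (hgap i hiS j hj (Finset.ne_of_mem_erase hi) (hmax i hiS)) hbig fun n hne => ?_
  have := Q.norm_det_le_padeLambda (by omega) n _ _ _ _ hne
  linarith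

end QuadResolvent

theorem det_ne_zero_of_gcd_eq_one {p q : ℤ × ℤ} (hp : Int.gcd p.1 p.2 = 1)
    (hq : Int.gcd q.1 q.2 = 1) (h1 : p ≠ q) (h2 : p ≠ -q) : p.1 * q.2 - q.1 * p.2 ≠ 0 := by
  intro h
  obtain ⟨a, b⟩ := p
  obtain ⟨c, d⟩ := q
  simp only at *
  have hab : IsCoprime a b := Int.isCoprime_iff_gcd_eq_one.2 hp
  have hcd : IsCoprime c d := Int.isCoprime_iff_gcd_eq_one.2 hq
  have e : a * d = c * b := by linarith
  have hac : a ∣ c := hab.dvd_of_dvd_mul_right (Dvd.intro _ e)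
  have hca : c ∣ a := hcd.dvd_of_dvd_mul_right (Dvd.intro _ e.symm)
  have hbd : b ∣ d := hab.symm.dvd_of_dvd_mul_left (Dvd.intro_left _ e.symm)
  have hdb : d ∣ b := hcd.symm.dvd_of_dvd_mul_left (Dvd.intro_left _ e)
  have hA : a = c ∨ a = -c := Int.natAbs_eq_natAbs_iff.1
    (Nat.dvd_antisymm (Int.natAbs_dvd_natAbs.2 hac) (Int.natAbs_dvd_natAbs.2 hca))
  have hB : b = d ∨ b = -d := Int.natAbs_eq_natAbs_iff.1
    (Nat.dvd_antisymm (Int.natAbs_dvd_natAbs.2 hbd) (Int.natAbs_dvd_natAbs.2 hdb))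
  have hne1 : ¬(a = c ∧ b = d) := fun h => h1 (by rw [h.1, h.2])
  have hne2 : ¬(a = -c ∧ b = -d) := fun h => h2 (by rw [h.1, h.2]; rfl)
  rcases hA with rfl | rfl <;> rcases hB with rfl | rfl
  · exact hne1 ⟨rfl, rfl⟩
  · have : a * d = 0 := by linarith
    rcases mul_eq_zero.1 this with rfl | rfl
    · exact hne2 ⟨by simp, rfl⟩
    · exact hne1 ⟨rfl, by simp⟩
  · have : c * b = 0 := by linarith
    rcases mul_eq_zero.1 this with rfl | rfl
    · exact hne1 ⟨by simp, rfl⟩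
    · exact hne2 ⟨rfl, by simp⟩
  · exact hne2 ⟨rfl, rfl⟩

/-- To bound the number of solutions up to sign it suffices to bound the size of finite sets of
pairwise independent solutions. -/
theorem numSolutions_le_of_forall {F : MvPolynomial (Fin 2) ℤ} {h : ℤ} {N : ℕ}
    (H : ∀ S : Finset (ℤ × ℤ), (∀ p ∈ S, p ∈ primitiveSolutions F h) → PairwiseIndep S →
      S.card ≤ N) : numSolutions F h ≤ N := by
  classical
  unfold numSolutions
  by_contra hlt
  push Not at hlt
  obtain ⟨T, hT, hTcard⟩ := Set.exists_subset_encard_eq (Order.add_one_le_of_lt hlt)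
  have hfin : T.Finite := Set.finite_of_encard_eq_coe (k := N + 1) (by rw [hTcard]; rfl)
  choose! f hf using fun t (ht : t ∈ T) => hT ht
  set S := hfin.toFinset.image f with hS
  have hinj : Set.InjOn f hfin.toFinset := by
    intro x hx y hy hxy
    have hx' := (hf x (by simpa using hx)).2
    have hy' := (hf y (by simpa using hy)).2
    simp only at hx' hy'
    rw [← hx', ← hy', hxy]
  have hcard : S.card = N + 1 := by
    rw [hS, Finset.card_image_of_injOn hinj]
    have := hfin.encard_eq_coe_toFinset_card
    rw [hTcard] at this
    exact_mod_cast this.symm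
  have hle := H S (fun p hp => by
    obtain ⟨t, ht, rfl⟩ := Finset.mem_image.1 hp
    exact (hf t (by simpa using ht)).1) (fun p hp q hq hpq => by
    obtain ⟨t, ht, rfl⟩ := Finset.mem_image.1 hp
    obtain ⟨u, hu, rfl⟩ := Finset.mem_image.1 hq
    have ht' := hf t (by simpa using ht)
    have hu' := hf u (by simpa using hu)
    refine det_ne_zero_of_gcd_eq_one ht'.1.1 hu'.1.1 hpq fun hneg => hpq ?_
    have : t = u := by
      rw [← ht'.2, ← hu'.2, hneg]
      simp only [neg_neg]
      exact Sym2.eq_swap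
    rw [this])
  omega

theorem QuadResolvent.LargeDet.numSolutions_le {F : MvPolynomial (Fin 2) ℤ} {r : ℕ}
    {Q : QuadResolvent F r} {m : ℕ} {h : ℤ} (H : Q.LargeDet m h) (t : Finset ℂ)
    (ht : ∀ ω ∈ t, ‖ω‖ = 1)
    (hcl : ∀ p, Q.IsLargeSolution h p → Q.xi p.1 p.2 ≠ 0 ∧ Q.eta p.1 p.2 ≠ 0 ∧
      ∃ ω ∈ t, PadeClose r h ω (Q.xi p.1 p.2) (Q.eta p.1 p.2)) :
    numSolutions F h ≤ (((m - 1) * t.card + 1 : ℕ) : ℕ∞) := by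
  classical
  refine numSolutions_le_of_forall fun S hS hind => ?_
  choose hξ hη f hft hfc using hcl
  -- The default `0` is never reached: `g` is only used on large solutions.
  set g : ℤ × ℤ → ℂ := fun p => if hp : Q.IsLargeSolution h p then f p hp else 0 with hg
  rw [← Finset.card_filter_add_card_filter_not (s := S) (fun p => Q.IsLargeSolution h p)]
  refine add_le_add ?_ ?_
  · refine Finset.card_le_mul_card_image_of_maps_to (f := g) (fun p hp => ?_) _ fun ω hω => ?_
    · have hp' := (Finset.mem_filter.1 hp).2
      simp only [hg, dif_pos hp']
      exact hft p hp'
    · refine Nat.le_sub_one_of_lt (H.card_lt (ht ω hω) _ ?_ ?_)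
      · intro p hp q hq
        simp only [Finset.mem_filter] at hp hq
        exact hind p hp.1.1 q hq.1.1
      · intro p hp
        simp only [Finset.mem_filter] at hp
        obtain ⟨⟨-, hp1⟩, hp2⟩ := hp
        refine ⟨hp1, hξ p hp1, hη p hp1, ?_⟩
        simp only [hg, dif_pos hp1] at hp2
        rw [← hp2]
        exact hfc p hp1
  · refine Finset.card_le_one.2 fun p hp q hq => ?_
    by_contra hpq
    simp only [Finset.mem_filter, QuadResolvent.IsLargeSolution, not_and, not_le] at hp hq
    have hp' := hp.2 (hS p hp.1)
    have hq' := hq.2 (hS q hq.1)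
    have h1 := Q.norm_det_le_two_mul (hind p hp.1 q hq.1 hpq)
    nlinarith [sq_nonneg (Q.size p - Q.size q)]

/-- Every point of the unit circle is close to an `r`-th root of unity. -/
theorem exists_root_of_unity_arc {r : ℕ} (hr : 1 ≤ r) {v : ℂ} (hv : ‖v‖ = 1) :
    ∃ k ∈ Finset.range r, ∃ φ : ℝ, |φ| ≤ Real.pi / r ∧
      v = Complex.exp (2 * Real.pi * Complex.I * (k / r)) * Complex.exp (φ * Complex.I) := by
  have hpi := Real.pi_pos
  have hr0 : (0 : ℝ) < r := by positivity
  set ψ := Complex.arg v with hψ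
  have hvψ : v = Complex.exp (ψ * Complex.I) := by
    have := Complex.norm_mul_exp_arg_mul_I v
    rw [hv] at this
    simpa using this.symm
  -- The nearest multiple of `2π/r` to the argument; reducing `n` modulo `r` does not change the
  -- root of unity.
  set n : ℤ := round (ψ * r / (2 * Real.pi)) with hn
  set k : ℕ := (n % r).toNat with hk
  have hrz : (0 : ℤ) < r := by exact_mod_cast hr
  have hknn := Int.emod_nonneg n hrz.ne'
  have hklt := Int.emod_lt_of_pos n hrz
  refine ⟨k, Finset.mem_range.2 (by omega), ψ - 2 * Real.pi * (n / r), ?_, ?_⟩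
  · have h1 := abs_sub_round (ψ * r / (2 * Real.pi))
    rw [← hn] at h1
    have h2 : ψ - 2 * Real.pi * (n / r) = (ψ * r / (2 * Real.pi) - n) * (2 * Real.pi / r) := by
      field_simp
    rw [h2, abs_mul, abs_of_pos (by positivity : 0 < 2 * Real.pi / r)]
    calc _ ≤ 1 / 2 * (2 * Real.pi / r) := by gcongr
      _ = _ := by ring
  · have hkn : (k : ℤ) = n - r * (n / r) := by
      rw [hk, Int.toNat_of_nonneg hknn, Int.emod_def]
    have hkc : (k : ℂ) = n - r * ((n / (r : ℤ) : ℤ) : ℂ) := by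
      have : ((k : ℤ) : ℂ) = ((n - r * (n / r) : ℤ) : ℂ) := by rw [hkn]
      push_cast at this; exact this
    have hrc : (r : ℂ) ≠ 0 := by exact_mod_cast hr0.ne'
    rw [← Complex.exp_add, hvψ, hkc, Complex.exp_eq_exp_iff_exists_int]
    refine ⟨n / (r : ℤ), ?_⟩
    push_cast
    field_simp
    ring

namespace QuadResolvent

variable {F : MvPolynomial (Fin 2) ℤ} {r : ℕ} (Q : QuadResolvent F r)

open ComplexConjugate

theorem conj_s_or : (conj Q.s = Q.s ∧ 0 < Q.disc) ∨ (conj Q.s = -Q.s ∧ Q.disc < 0) := by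
  have h := Q.s_sq
  have h0 := Q.disc_ne_zero
  have h2 : (conj Q.s) ^ 2 = Q.s ^ 2 := by rw [← map_pow, h]; simp
  rcases sq_eq_sq_iff_eq_or_eq_neg.1 h2 with h3 | h3
  · left
    refine ⟨h3, lt_of_le_of_ne ?_ h0.symm⟩
    obtain ⟨t, ht⟩ := Complex.conj_eq_iff_real.1 h3
    rw [ht] at h
    have : t ^ 2 = (Q.disc : ℝ) := by exact_mod_cast h
    have h4 : (0 : ℝ) ≤ Q.disc := by rw [← this]; positivity
    exact_mod_cast h4
  · right
    refine ⟨h3, lt_of_le_of_ne ?_ h0⟩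
    have hn : Q.s * conj Q.s = ((Complex.normSq Q.s : ℝ) : ℂ) := Complex.mul_conj _
    rw [h3, mul_neg, ← sq, h] at hn
    have h4 : -(Q.disc : ℝ) = Complex.normSq Q.s := by exact_mod_cast hn
    have h5 : (Q.disc : ℝ) ≤ 0 := by linarith [Complex.normSq_nonneg Q.s]
    exact_mod_cast h5

/-- The covariant has rational integer coefficients, so `r s (ξ ^ r + η ^ r)` is real at real
points. -/
theorem conj_covariant (hr : 1 ≤ r) (x y : ℝ) :
    conj Q.s * conj (Q.xi x y ^ r + Q.eta x y ^ r) = Q.s * (Q.xi x y ^ r + Q.eta x y ^ r) := by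
  have h := Q.covariant_eq hr x y
  rw [aeval_realCast_eq, aeval_realCast_eq] at h
  have h2 := congrArg conj h
  simp only [map_mul, map_sub, map_add, Complex.conj_ofReal, map_intCast, map_natCast,
    map_ofNat] at h2
  rw [h] at h2
  have hr0 : (r : ℂ) ≠ 0 := by exact_mod_cast (by omega : r ≠ 0)
  refine mul_left_cancel₀ hr0 ?_
  rw [map_add]
  linear_combination -h2

/-- Here `s` is purely imaginary, hence so is `ξ ^ r + η ^ r`, while `ξ ^ r - η ^ r` is real. -/
theorem conj_xi_pow_of_neg (hr : 1 ≤ r) (hD : Q.disc < 0) (x y : ℝ) :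
    conj (Q.xi x y ^ r) = -Q.eta x y ^ r := by
  have h1 := Q.conj_covariant hr x y
  have h2 := congrArg conj (Q.realVal_eq x y)
  rw [Complex.conj_ofReal, Q.realVal_eq] at h2
  rcases Q.conj_s_or with h | h
  · exact absurd h.2 (by omega)
  · rw [h.1] at h1
    have h3 : conj (Q.xi x y ^ r + Q.eta x y ^ r) = -(Q.xi x y ^ r + Q.eta x y ^ r) := by
      refine mul_left_cancel₀ Q.s_ne_zero ?_
      linear_combination -h1
    rw [map_add] at h3
    rw [map_sub] at h2
    linear_combination (1 / 2 : ℂ) * h3 - (1 / 2 : ℂ) * h2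

theorem exists_real_of_pos (hr : 1 ≤ r) (hD : 0 < Q.disc) (x y : ℝ) :
    (∃ t : ℝ, Q.xi x y ^ r = t) ∧ ∃ t : ℝ, Q.eta x y ^ r = t := by
  have h1 := Q.conj_covariant hr x y
  have h2 := congrArg conj (Q.realVal_eq x y)
  rw [Complex.conj_ofReal, Q.realVal_eq] at h2
  rcases Q.conj_s_or with h | h
  · rw [h.1] at h1
    have h3 := mul_left_cancel₀ Q.s_ne_zero h1
    rw [map_add] at h3
    rw [map_sub] at h2
    exact ⟨Complex.conj_eq_iff_real.1 (by linear_combination (1 / 2 : ℂ) * h3 - (1 / 2 : ℂ) * h2),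
      Complex.conj_eq_iff_real.1 (by linear_combination (1 / 2 : ℂ) * h3 + (1 / 2 : ℂ) * h2)⟩
  · exact absurd h.2 (by omega)

/-! ### Negative discriminant -/

theorem norm_xi_eq_norm_eta (hr : 1 ≤ r) (hD : Q.disc < 0) (p : ℤ × ℤ) :
    ‖Q.xi p.1 p.2‖ = ‖Q.eta p.1 p.2‖ := by
  have h := congrArg norm (Q.conj_xi_pow_of_neg hr hD p.1 p.2)
  rw [Complex.norm_conj, norm_neg, norm_pow, norm_pow] at h
  simpa using (pow_left_inj₀ (norm_nonneg _) (norm_nonneg _) (by omega)).1 h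

theorem LargeDet.numSolutions_le_of_neg {Q : QuadResolvent F r} {m : ℕ} {h : ℤ}
    (H : Q.LargeDet m h) (hD : Q.disc < 0) : numSolutions F h ≤ ((r * m : ℕ) : ℕ∞) := by
  have hr := H.hr
  have hm := H.hm
  set e : ℕ → ℂ := fun k => Complex.exp (2 * Real.pi * Complex.I * (k / r)) with he
  have her : ∀ k, e k ^ r = 1 := fun k => by
    simp only [he]
    rw [← Complex.exp_nat_mul, Complex.exp_eq_one_iff]
    have hr0 : (r : ℂ) ≠ 0 := by exact_mod_cast (by omega : r ≠ 0)
    exact ⟨k, by push_cast; field_simp⟩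
  have hen : ∀ k, ‖e k‖ = 1 := fun k => Complex.norm_eq_one_of_pow_eq_one (her k) (by omega)
  refine (H.numSolutions_le ((Finset.range r).image e) ?_ ?_).trans ?_
  · intro ω hω
    obtain ⟨k, -, rfl⟩ := Finset.mem_image.1 hω
    exact hen k
  · intro p hp
    have hpos := hp.size_pos
    have hnorm := Q.norm_xi_eq_norm_eta (by omega) hD p
    unfold size at hpos
    rw [← hnorm, max_self] at hpos
    have hξ : Q.xi p.1 p.2 ≠ 0 := norm_pos_iff.1 hpos
    have hη : Q.eta p.1 p.2 ≠ 0 := norm_pos_iff.1 (hnorm ▸ hpos)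
    refine ⟨hξ, hη, ?_⟩
    obtain ⟨k, hk, φ, hφ, hv⟩ := exists_root_of_unity_arc (r := r) (by omega)
      (v := Q.eta p.1 p.2 / Q.xi p.1 p.2) (by rw [norm_div, hnorm, div_self (hnorm ▸ hpos.ne')])
    refine ⟨e k, Finset.mem_image_of_mem _ hk, ?_⟩
    have hF := Q.norm_sub_le_of_mem hp.1
    rw [div_eq_iff hξ] at hv
    rw [hv] at hF ⊢
    exact padeClose_of_arc (by omega) (her k) hφ hξ hF
  · have hc : ((Finset.range r).image e).card ≤ r := by
      simpa using Finset.card_image_le (s := Finset.range r) (f := e)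
    have : (m - 1) * ((Finset.range r).image e).card + 1 ≤ r * m := by
      obtain ⟨k, rfl⟩ := Nat.exists_eq_add_of_le' hm
      rw [show k + 3 - 1 = k + 2 by omega]
      nlinarith
    exact_mod_cast this

/-! ### Positive discriminant -/

/-- For positive discriminant, at a large solution the `r`-th powers of both forms are real and
have the same sign. -/
theorem LargeDet.exists_mul_pos {Q : QuadResolvent F r} {m : ℕ} {h : ℤ}
    (H : Q.LargeDet m h) (hD : 0 < Q.disc) {p : ℤ × ℤ} (hp : Q.IsLargeSolution h p) :
    ∃ X Y : ℝ, Q.xi p.1 p.2 ^ r = X ∧ Q.eta p.1 p.2 ^ r = Y ∧ 0 < X * Y := by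
  have hr := H.hr
  obtain ⟨⟨X, hX⟩, Y, hY⟩ := Q.exists_real_of_pos (by omega) hD p.1 p.2
  rw [Complex.ofReal_intCast, Complex.ofReal_intCast] at hX hY
  refine ⟨X, Y, hX, hY, ?_⟩
  by_contra hle
  push Not at hle
  have hF := Q.norm_sub_le_of_mem hp.1
  rw [hX, hY, ← Complex.ofReal_sub, Complex.norm_real, Real.norm_eq_abs] at hF
  -- Without equal signs nothing cancels in `X - Y`, so the size to the power `r` is at most `h`,
  -- against `h² < (‖Q.det‖ / 2) ^ r`.
  have habs : |X| + |Y| ≤ h := by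
    refine le_trans (le_of_eq ?_) hF
    rcases le_total 0 X with h1 | h1 <;> rcases le_total 0 Y with h2 | h2
    · rcases h1.eq_or_lt with rfl | h1
      · simp
      · have : Y = 0 := le_antisymm (by nlinarith) h2
        simp [this]
    · rw [abs_of_nonneg h1, abs_of_nonpos h2, abs_of_nonneg (by linarith)]; ring
    · rw [abs_of_nonpos h1, abs_of_nonneg h2, abs_of_nonpos (by linarith)]; ring
    · rcases h1.eq_or_lt with rfl | h1
      · simp
      · have : Y = 0 := le_antisymm h2 (by nlinarith)
        simp [this]
  have hZ : Q.size p ^ r ≤ h := by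
    have e1 : ‖Q.xi p.1 p.2‖ ^ r = |X| := by rw [← norm_pow, hX, Complex.norm_real, Real.norm_eq_abs]
    have e2 : ‖Q.eta p.1 p.2‖ ^ r = |Y| := by
      rw [← norm_pow, hY, Complex.norm_real, Real.norm_eq_abs]
    unfold size
    rcases max_choice ‖Q.xi p.1 p.2‖ ‖Q.eta p.1 p.2‖ with h1 | h1 <;> rw [h1]
    · rw [e1]; linarith [abs_nonneg Y]
    · rw [e2]; linarith [abs_nonneg X]
  have h1 := H.lt
  have h2 : (‖Q.det‖ / 2) ^ r ≤ (Q.size p ^ 2) ^ r := by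
    have := Q.det_norm_pos
    have := hp.2
    gcongr
  have h3 : (Q.size p ^ 2) ^ r = (Q.size p ^ r) ^ 2 := by rw [← pow_mul, ← pow_mul, mul_comm]
  have h4 : (Q.size p ^ r) ^ 2 ≤ (h : ℝ) ^ 2 := by
    have := Q.size_nonneg p
    gcongr
  linarith

/-- For real `s` both conjugates in `exists_tau` are real, and the common factor `χ` cancels. -/
theorem exists_real_ratio (hD : 0 < Q.disc) {p q : ℤ × ℤ} (hp : Q.eta p.1 p.2 * Q.xi q.1 q.2 ≠ 0) :
    ∃ ρ : ℝ, Q.eta q.1 q.2 * Q.xi p.1 p.2 = ρ * (Q.eta p.1 p.2 * Q.xi q.1 q.2) := by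
  rcases Q.conj_s_or with h | h
  · obtain ⟨t, ht⟩ := Complex.conj_eq_iff_real.1 h.1
    obtain ⟨a, b, h1, h2⟩ := Q.exists_tau p.1 p.2 q.1 q.2
    rw [ht] at h1 h2
    refine ⟨(a + b * ((Q.b + t) / 2)) / (a + b * ((Q.b - t) / 2)), ?_⟩
    rw [h1, h2]
    have h3 : (a : ℂ) + b * ((Q.b - t) / 2) ≠ 0 := by
      intro h3
      rw [h2, h3, mul_zero] at hp
      exact hp rfl
    push_cast
    rw [div_mul_eq_mul_div, eq_div_iff h3]
    ring
  · exact absurd h.2 (by omega)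

/-- Take `ω` to be the direction of `η/ξ` at one large solution. At every other one the quotient is
a real multiple of `ω`, and its `r`-th power is positive, so a negative multiple forces `r` even. -/
theorem LargeDet.exists_roots_of_pos {Q : QuadResolvent F r} {m : ℕ} {h : ℤ}
    (H : Q.LargeDet m h) (hD : 0 < Q.disc) :
    ∃ ω : ℂ, ω ^ r = 1 ∧ ∀ p, Q.IsLargeSolution h p → Q.xi p.1 p.2 ≠ 0 ∧ Q.eta p.1 p.2 ≠ 0 ∧
      (PadeClose r h ω (Q.xi p.1 p.2) (Q.eta p.1 p.2) ∨
        Even r ∧ PadeClose r h (-ω) (Q.xi p.1 p.2) (Q.eta p.1 p.2)) := by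
  have hr := H.hr
  have hne : ∀ p, Q.IsLargeSolution h p → Q.xi p.1 p.2 ≠ 0 ∧ Q.eta p.1 p.2 ≠ 0 := by
    intro p hp
    obtain ⟨X, Y, hX, hY, hXY⟩ := H.exists_mul_pos hD hp
    constructor
    · intro h0
      rw [h0, zero_pow (by omega)] at hX
      have : X = 0 := by exact_mod_cast hX.symm
      simp [this] at hXY
    · intro h0
      rw [h0, zero_pow (by omega)] at hY
      have : Y = 0 := by exact_mod_cast hY.symm
      simp [this] at hXY
  by_cases hex : ∃ p, Q.IsLargeSolution h p
  swap
  · exact ⟨1, one_pow r, fun p hp => absurd ⟨p, hp⟩ hex⟩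
  obtain ⟨q, hq⟩ := hex
  have hqne := hne q hq
  have hratio : ∀ p, Q.IsLargeSolution h p →
      ∃ t : ℝ, 0 < t ∧ (Q.eta p.1 p.2 / Q.xi p.1 p.2) ^ r = t := by
    intro p hp
    obtain ⟨X, Y, hX, hY, hXY⟩ := H.exists_mul_pos hD hp
    have hX0 : X ≠ 0 := by rintro rfl; simp at hXY
    refine ⟨Y / X, ?_, ?_⟩
    · have : Y / X = X * Y / X ^ 2 := by field_simp
      rw [this]; positivity
    · rw [div_pow, hX, hY]; push_cast; rfl
  set v := Q.eta q.1 q.2 / Q.xi q.1 q.2 with hv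
  have hv0 : v ≠ 0 := div_ne_zero hqne.2 hqne.1
  obtain ⟨t, ht0, ht⟩ := hratio q hq
  have hvn : 0 < ‖v‖ := norm_pos_iff.2 hv0
  have hvnc : (‖v‖ : ℂ) ≠ 0 := by exact_mod_cast hvn.ne'
  set ω := v / ‖v‖ with hω
  have hωr : ω ^ r = 1 := by
    have h1 : ‖v‖ ^ r = t := by
      rw [← norm_pow, ht, Complex.norm_real, Real.norm_of_nonneg ht0.le]
    rw [hω, div_pow, ht, ← Complex.ofReal_pow, h1, div_self (by exact_mod_cast ht0.ne')]
  refine ⟨ω, hωr, fun p hp => ⟨(hne p hp).1, (hne p hp).2, ?_⟩⟩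
  obtain ⟨hξ, hη⟩ := hne p hp
  obtain ⟨ρ, hρ⟩ := Q.exists_real_ratio hD (p := q) (q := p) (mul_ne_zero hqne.2 hξ)
  have hηv : Q.eta p.1 p.2 = ρ * v * Q.xi p.1 p.2 := by
    rw [hv]; have := hqne.1; field_simp; linear_combination hρ
  have hρ0 : ρ ≠ 0 := by
    rintro rfl
    rw [hηv] at hη
    simp at hη
  have hvω : v = ω * ‖v‖ := by rw [hω]; field_simp
  have hF := Q.norm_sub_le_of_mem hp.1
  rcases lt_or_gt_of_ne hρ0 with hneg | hpos
  · have heven : Even r := by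
      by_contra hodd
      rw [Nat.not_even_iff_odd] at hodd
      obtain ⟨t', ht'0, ht'⟩ := hratio p hp
      have h1 : Q.eta p.1 p.2 / Q.xi p.1 p.2 = ρ * v := by rw [hηv]; field_simp
      rw [h1, mul_pow, ht] at ht'
      have h2 : ρ ^ r * t = t' := by exact_mod_cast ht'
      have h3 := hodd.pow_neg hneg
      nlinarith
    right
    refine ⟨heven, ?_⟩
    have e : Q.eta p.1 p.2 = -ω * ((-ρ * ‖v‖ : ℝ) : ℂ) * Q.xi p.1 p.2 := by
      rw [hηv]; nth_rewrite 1 [hvω]; push_cast; ring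
    rw [e] at hF ⊢
    exact padeClose_of_pos (by omega) (by rw [heven.neg_pow, hωr])
      (mul_pos (by linarith) hvn) hξ hF
  · left
    have e : Q.eta p.1 p.2 = ω * ((ρ * ‖v‖ : ℝ) : ℂ) * Q.xi p.1 p.2 := by
      rw [hηv]; nth_rewrite 1 [hvω]; push_cast; ring
    rw [e] at hF ⊢
    exact padeClose_of_pos (by omega) hωr (mul_pos hpos hvn) hξ hF

theorem LargeDet.numSolutions_le_of_pos {Q : QuadResolvent F r} {m : ℕ} {h : ℤ}
    (H : Q.LargeDet m h) (hD : 0 < Q.disc) :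
    numSolutions F h ≤ ((2 * m : ℕ) : ℕ∞) ∧ (Odd r → numSolutions F h ≤ (m : ℕ∞)) := by
  have hr := H.hr
  have hm := H.hm
  obtain ⟨ω, hω, hcl⟩ := H.exists_roots_of_pos hD
  have hωn : ‖ω‖ = 1 := Complex.norm_eq_one_of_pow_eq_one hω (by omega)
  constructor
  · refine (H.numSolutions_le {ω, -ω} ?_ ?_).trans ?_
    · intro z hz
      rcases Finset.mem_insert.1 hz with rfl | hz
      · exact hωn
      · rw [Finset.mem_singleton.1 hz, norm_neg, hωn]
    · intro p hp
      obtain ⟨h1, h2, h3 | ⟨-, h3⟩⟩ := hcl p hp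
      · exact ⟨h1, h2, ω, by simp, h3⟩
      · exact ⟨h1, h2, -ω, by simp, h3⟩
    · have hc : ({ω, -ω} : Finset ℂ).card ≤ 2 := Finset.card_le_two
      have : (m - 1) * ({ω, -ω} : Finset ℂ).card + 1 ≤ 2 * m := by
        obtain ⟨k, rfl⟩ := Nat.exists_eq_add_of_le' hm
        rw [show k + 3 - 1 = k + 2 by omega]
        nlinarith
      exact_mod_cast this
  · intro hodd
    refine (H.numSolutions_le {ω} ?_ ?_).trans ?_
    · intro z hz
      rw [Finset.mem_singleton.1 hz, hωn]
    · intro p hp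
      obtain ⟨h1, h2, h3 | ⟨h3, -⟩⟩ := hcl p hp
      · exact ⟨h1, h2, ω, by simp, h3⟩
      · exact absurd h3 (Nat.not_even_iff_odd.2 hodd)
    · have : (m - 1) * ({ω} : Finset ℂ).card + 1 ≤ m := by
        rw [Finset.card_singleton]; omega
      exact_mod_cast this

/-! ### Definite forms -/

theorem _root_.IsDefinite.mul_pos {F : MvPolynomial (Fin 2) ℤ} (hF : IsDefinite F) {x y x' y' : ℝ}
    (h : (x, y) ≠ (0, 0)) (h' : (x', y') ≠ (0, 0)) : 0 < realVal F x y * realVal F x' y' := by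
  rcases hF with hF | hF
  · exact _root_.mul_pos (hF _ _ h) (hF _ _ h')
  · exact mul_pos_of_neg_of_neg (hF _ _ h) (hF _ _ h')

/-- If `ξ` is not a real isomorphism from `ℝ²` to `ℂ`, it has a nontrivial real zero; there `η ^ r =
-conj (ξ ^ r)` vanishes too, hence `F` does. Otherwise Cramer's rule solves the equation. -/
theorem exists_xi_eq_of_neg (hr : 1 ≤ r) (hF : IsDefinite F) (hD : Q.disc < 0) (z : ℂ) :
    ∃ x y : ℝ, Q.xi x y = z := by
  set d := (Q.α * conj Q.β).im with hd
  have him : ∀ u v : ℂ, ((u * conj v).im : ℂ) * (2 * Complex.I) = u * conj v - conj u * v := by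
    intro u v
    have := Complex.sub_conj (u * conj v)
    rw [map_mul, Complex.conj_conj] at this
    rw [this]; push_cast; ring
  have hI : (2 * Complex.I) ≠ 0 := by simp
  by_cases h0 : d = 0
  · exfalso
    have hzero : ∃ x y : ℝ, (x, y) ≠ (0, 0) ∧ Q.xi x y = 0 := by
      by_cases hβ : Q.β = 0
      · exact ⟨0, 1, by simp, by simp [xi, hβ]⟩
      · refine ⟨Complex.normSq Q.β, -(Q.α * conj Q.β).re, ?_, ?_⟩
        · intro h
          exact hβ (Complex.normSq_eq_zero.1 (Prod.mk.inj h).1)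
        · have h1 : (((Q.α * conj Q.β).re : ℝ) : ℂ) = Q.α * conj Q.β := by
            refine Complex.ext ?_ ?_
            · simp
            · rw [Complex.ofReal_im, ← hd, h0]
          unfold xi
          rw [Complex.ofReal_neg, h1, ← Complex.mul_conj]; ring
    obtain ⟨x, y, hxy, hz⟩ := hzero
    have h1 := Q.conj_xi_pow_of_neg hr hD x y
    have h2 := Q.realVal_eq x y
    rw [hz, zero_pow (by omega)] at h1 h2
    rw [map_zero] at h1
    have h3 : realVal F x y = 0 := by
      have : ((realVal F x y : ℝ) : ℂ) = 0 := by rw [h2]; linear_combination -h1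
      exact_mod_cast this
    have := hF.mul_pos hxy hxy
    rw [h3] at this
    simp at this
  · refine ⟨(z * conj Q.β).im / d, -((z * conj Q.α).im / d), ?_⟩
    have hdc : (d : ℂ) ≠ 0 := by exact_mod_cast h0
    unfold xi
    push_cast
    field_simp
    refine mul_right_cancel₀ hI ?_
    have e1 := him z Q.β
    have e2 := him z Q.α
    have e3 := him Q.α Q.β
    rw [← hd] at e3
    linear_combination Q.α * e1 - Q.β * e2 - z * e3

/-- Here `F` is twice the real part of `ξ ^ r`, and `ξ` takes the values `1` and `exp (π i / r)`. -/
theorem not_isDefinite_of_neg (hr : 1 ≤ r) (hD : Q.disc < 0) : ¬ IsDefinite F := by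
  intro hF
  have hr0 : (r : ℂ) ≠ 0 := by exact_mod_cast (by omega : r ≠ 0)
  set z := Complex.exp (Real.pi * Complex.I / r) with hz
  have hzr : z ^ r = -1 := by
    rw [hz, ← Complex.exp_nat_mul, mul_div_cancel₀ _ hr0, Complex.exp_pi_mul_I]
  obtain ⟨x, y, hxy⟩ := Q.exists_xi_eq_of_neg hr hF hD 1
  obtain ⟨x', y', hxy'⟩ := Q.exists_xi_eq_of_neg hr hF hD z
  have h1 := Q.conj_xi_pow_of_neg hr hD x y
  have h2 := Q.realVal_eq x y
  have h1' := Q.conj_xi_pow_of_neg hr hD x' y'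
  have h2' := Q.realVal_eq x' y'
  rw [hxy, one_pow] at h1 h2
  rw [hxy', hzr] at h1' h2'
  rw [map_one] at h1
  rw [map_neg, map_one] at h1'
  have e : realVal F x y = 2 := by
    have : ((realVal F x y : ℝ) : ℂ) = 2 := by rw [h2]; linear_combination -h1
    exact_mod_cast this
  have e' : realVal F x' y' = -2 := by
    have : ((realVal F x' y' : ℝ) : ℂ) = -2 := by rw [h2']; linear_combination -h1'
    exact_mod_cast this
  have hne : (x, y) ≠ (0, 0) := by
    intro h
    obtain ⟨rfl, rfl⟩ := Prod.mk.inj h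
    simp [xi] at hxy
  have hne' : (x', y') ≠ (0, 0) := by
    intro h
    obtain ⟨rfl, rfl⟩ := Prod.mk.inj h
    simp [xi] at hxy'
    exact Complex.exp_ne_zero _ hxy'.symm
  have := hF.mul_pos hne hne'
  rw [e, e'] at this
  norm_num at this

theorem _root_.IsDefinite.even (hF : IsDefinite F) (Q : QuadResolvent F r) : Even r := by
  by_contra hodd
  rw [Nat.not_even_iff_odd] at hodd
  have h1 := Q.realVal_eq 1 0
  have h2 := Q.realVal_eq (-1) 0
  have e : realVal F (-1) 0 = -realVal F 1 0 := by
    have e1 : Q.xi ((-1 : ℝ) : ℂ) ((0 : ℝ) : ℂ) = -Q.xi ((1 : ℝ) : ℂ) ((0 : ℝ) : ℂ) := by simp [xi]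
    have e2 : Q.eta ((-1 : ℝ) : ℂ) ((0 : ℝ) : ℂ) = -Q.eta ((1 : ℝ) : ℂ) ((0 : ℝ) : ℂ) := by
      simp [eta]
    have : ((realVal F (-1) 0 : ℝ) : ℂ) = ((-realVal F 1 0 : ℝ) : ℂ) := by
      rw [h2, e1, e2, hodd.neg_pow, hodd.neg_pow, Complex.ofReal_neg, h1]; ring
    exact_mod_cast this
  have := hF.mul_pos (x := 1) (y := 0) (x' := -1) (y' := 0) (by simp) (by simp)
  rw [e] at this
  nlinarith [sq_nonneg (realVal F 1 0)]

/-- For positive discriminant, `ξ` and `η` are complex multiples of real linear forms and have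
nontrivial real zeros. At a zero of `η` the form is an even power times `X`, at a zero of `ξ` minus
an even power times `Y`; as `X` and `Y` have the same sign, this contradicts definiteness. -/
theorem LargeDet.not_isDefinite {Q : QuadResolvent F r} {m : ℕ} {h : ℤ}
    (H : Q.LargeDet m h) {p : ℤ × ℤ} (hp : Q.IsLargeSolution h p) : ¬ IsDefinite F := by
  intro hF
  have hr := H.hr
  rcases Q.conj_s_or with ⟨hs, hD⟩ | ⟨-, hD⟩
  swap
  · exact Q.not_isDefinite_of_neg (by omega) hD hF
  have heven := hF.even Q
  obtain ⟨X, Y, hX, hY, hXY⟩ := H.exists_mul_pos hD hp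
  obtain ⟨t, ht⟩ := Complex.conj_eq_iff_real.1 hs
  obtain ⟨x, y⟩ := p
  simp only at hX hY
  have hξ : Q.xi x y ≠ 0 := by
    intro h0
    rw [h0, zero_pow (by omega)] at hX
    have : X = 0 := by exact_mod_cast hX.symm
    simp [this] at hXY
  have hη : Q.eta x y ≠ 0 := by
    intro h0
    rw [h0, zero_pow (by omega)] at hY
    have : Y = 0 := by exact_mod_cast hY.symm
    simp [this] at hXY
  -- real coefficients of `eta p * xi / χ` and `xi p * eta / χ`
  obtain ⟨u, hu⟩ : ∃ u : ℝ, Q.eta x y * Q.α = Q.χ * u := ⟨Q.a * x + Q.b * y - y * ((Q.b - t) / 2), by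
    push_cast; rw [← ht]; unfold eta
    linear_combination (x : ℂ) * Q.mul_a + (1 / 2 : ℂ) * y * Q.mul_b - (1 / 2 : ℂ) * y * Q.mul_s⟩
  obtain ⟨v, hv⟩ : ∃ v : ℝ, Q.eta x y * Q.β = Q.χ * v := ⟨Q.c * y + x * ((Q.b - t) / 2), by
    push_cast; rw [← ht]; unfold eta
    linear_combination (y : ℂ) * Q.mul_c + (1 / 2 : ℂ) * x * Q.mul_b + (1 / 2 : ℂ) * x * Q.mul_s⟩
  obtain ⟨u', hu'⟩ : ∃ u : ℝ, Q.xi x y * Q.γ = Q.χ * u :=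
    ⟨Q.a * x + Q.b * y - y * ((Q.b + t) / 2), by
    push_cast; rw [← ht]; unfold xi
    linear_combination (x : ℂ) * Q.mul_a + (1 / 2 : ℂ) * y * Q.mul_b + (1 / 2 : ℂ) * y * Q.mul_s⟩
  obtain ⟨v', hv'⟩ : ∃ v : ℝ, Q.xi x y * Q.δ = Q.χ * v := ⟨Q.c * y + x * ((Q.b + t) / 2), by
    push_cast; rw [← ht]; unfold xi
    linear_combination (y : ℂ) * Q.mul_c + (1 / 2 : ℂ) * x * Q.mul_b - (1 / 2 : ℂ) * x * Q.mul_s⟩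
  have hχ := Q.chi_ne_zero
  have hdet := Q.det_ne_zero
  unfold det at hdet
  -- a zero of `xi` and a zero of `eta`
  have hxi0 : Q.xi v ((-u : ℝ) : ℂ) = 0 := by
    refine (mul_eq_zero.1 (?_ : Q.eta x y * Q.xi v ((-u : ℝ) : ℂ) = 0)).resolve_left hη
    unfold xi; push_cast; linear_combination v * hu - u * hv
  have heta0 : Q.eta v' ((-u' : ℝ) : ℂ) = 0 := by
    refine (mul_eq_zero.1 (?_ : Q.xi x y * Q.eta v' ((-u' : ℝ) : ℂ) = 0)).resolve_left hξ
    unfold eta; push_cast; linear_combination v' * hu' - u' * hv'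
  have hne : (v, -u) ≠ (0, 0) := by
    intro h
    have h1 := (Prod.mk.inj h).1
    have h2 : u = 0 := by linarith [(Prod.mk.inj h).2]
    rw [h2, Complex.ofReal_zero, mul_zero] at hu
    rw [h1, Complex.ofReal_zero, mul_zero] at hv
    have h3 := (mul_eq_zero.1 hu).resolve_left hη
    have h4 := (mul_eq_zero.1 hv).resolve_left hη
    exact hdet (by rw [h3, h4]; ring)
  have hne' : (v', -u') ≠ (0, 0) := by
    intro h
    have h1 := (Prod.mk.inj h).1
    have h2 : u' = 0 := by linarith [(Prod.mk.inj h).2]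
    rw [h2, Complex.ofReal_zero, mul_zero] at hu'
    rw [h1, Complex.ofReal_zero, mul_zero] at hv'
    have h3 := (mul_eq_zero.1 hu').resolve_left hξ
    have h4 := (mul_eq_zero.1 hv').resolve_left hξ
    exact hdet (by rw [h3, h4]; ring)
  -- the sign of `F` at the two points
  obtain ⟨ρ, hρ⟩ : ∃ ρ : ℝ, Q.xi v' ((-u' : ℝ) : ℂ) = ρ * Q.xi x y := by
    have e1 : Q.eta x y * Q.xi v' ((-u' : ℝ) : ℂ) = Q.χ * ((u * v' - v * u' : ℝ) : ℂ) := by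
      unfold xi; push_cast; linear_combination v' * hu - u' * hv
    have e2 : Q.eta x y * Q.xi x y = Q.χ * ((u * x + v * y : ℝ) : ℂ) := by
      have h1 : Q.xi x y = Q.α * x + Q.β * y := rfl
      push_cast
      linear_combination Q.eta x y * h1 + (x : ℂ) * hu + (y : ℂ) * hv
    have e3 : ((u * x + v * y : ℝ) : ℂ) ≠ 0 := by
      intro h0
      rw [h0, mul_zero] at e2
      exact mul_ne_zero hη hξ e2
    refine ⟨(u * v' - v * u') / (u * x + v * y), mul_left_cancel₀ hη ?_⟩
    rw [Complex.ofReal_div, e1]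
    field_simp
    linear_combination -((u * v' - v * u' : ℝ) : ℂ) * e2
  obtain ⟨ρ', hρ'⟩ : ∃ ρ : ℝ, Q.eta v ((-u : ℝ) : ℂ) = ρ * Q.eta x y := by
    have e1 : Q.xi x y * Q.eta v ((-u : ℝ) : ℂ) = Q.χ * ((u' * v - v' * u : ℝ) : ℂ) := by
      unfold eta; push_cast; linear_combination v * hu' - u * hv'
    have e2 : Q.xi x y * Q.eta x y = Q.χ * ((u' * x + v' * y : ℝ) : ℂ) := by
      have h1 : Q.eta x y = Q.γ * x + Q.δ * y := rfl
      push_cast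
      linear_combination Q.xi x y * h1 + (x : ℂ) * hu' + (y : ℂ) * hv'
    have e3 : ((u' * x + v' * y : ℝ) : ℂ) ≠ 0 := by
      intro h0
      rw [h0, mul_zero] at e2
      exact mul_ne_zero hξ hη e2
    refine ⟨(u' * v - v' * u) / (u' * x + v' * y), mul_left_cancel₀ hξ ?_⟩
    rw [Complex.ofReal_div, e1]
    field_simp
    linear_combination -((u' * v - v' * u : ℝ) : ℂ) * e2
  have f1 : realVal F v' (-u') = ρ ^ r * X := by
    have := Q.realVal_eq v' (-u')
    rw [heta0, hρ, zero_pow (by omega), sub_zero, mul_pow, hX] at this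
    exact_mod_cast this
  have f2 : realVal F v (-u) = -(ρ' ^ r * Y) := by
    have := Q.realVal_eq v (-u)
    rw [hxi0, hρ', zero_pow (by omega), zero_sub, mul_pow, hY] at this
    exact_mod_cast this
  have h1 := hF.mul_pos hne' hne
  rw [f1, f2] at h1
  have h2 : 0 ≤ ρ ^ r * ρ' ^ r := mul_nonneg (heven.pow_nonneg _) (heven.pow_nonneg _)
  have h3 := mul_nonneg h2 hXY.le
  nlinarith

theorem LargeDet.numSolutions_le_one {Q : QuadResolvent F r} {m : ℕ} {h : ℤ}
    (H : Q.LargeDet m h) (hF : IsDefinite F) : numSolutions F h ≤ 1 := by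
  have := H.numSolutions_le ∅ (by simp) fun p hp => absurd hF (H.not_isDefinite hp)
  simpa using this

end QuadResolvent

theorem theorem1p4 (F : MvPolynomial (Fin 2) ℤ) (r m : ℕ) (h : ℤ)
    (hr : 5 ≤ r) (hm : 3 ≤ m) (hh : 0 < h)
    (hF : IsDiagonalizable F r)
    (hDelta : discrPrime F r h ≥ (r : ℝ) ^ alphaOne r m * (h : ℝ) ^ alphaTwo r m) :
    (∃ D : ℤ, IsQuadDisc F r D) ∧
    (∀ D : ℤ, IsQuadDisc F r D →
      (D < 0 → numSolutions F h ≤ ((r * m : ℕ) : ℕ∞)) ∧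
      (0 < D → Even r → IsIndefinite F → numSolutions F h ≤ ((2 * m : ℕ) : ℕ∞)) ∧
      (0 < D → Odd r → IsIndefinite F → numSolutions F h ≤ (m : ℕ∞))) ∧
    (IsDefinite F → numSolutions F h ≤ 1) := by
  have hex := exists_isQuadDisc (by omega) hF
  refine ⟨hex, fun D hD => ?_, fun hdef => ?_⟩
  · obtain ⟨Q, e, he, rfl⟩ := hD.exists_quadResolvent
    have he2 : 0 < e ^ 2 := by positivity
    have H := Q.largeDet hr hm hh hDelta
    refine ⟨fun hD => ?_, fun hD _ _ => ?_, fun hD hodd _ => ?_⟩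
    · exact H.numSolutions_le_of_neg (neg_of_mul_neg_right hD he2.le)
    · exact (H.numSolutions_le_of_pos (pos_of_mul_pos_right hD he2.le)).1
    · exact (H.numSolutions_le_of_pos (pos_of_mul_pos_right hD he2.le)).2 hodd
  · obtain ⟨D, hD⟩ := hex
    obtain ⟨Q, -, -, -⟩ := hD.exists_quadResolvent
    exact (Q.largeDet hr hm hh hDelta).numSolutions_le_one hdef
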